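/- **Conventions.** A (unital) $C^*$-category $\mathcal C$ is a category whose hom-sets $\mathcal C(A,B)$ are complex Banach spaces, with bilinear composition satisfying $\|fg\|\le\|f\|\,\|g\|$ and an antilinear isometric involution $f\mapsto f^*$, $\mathcal C(A,B)\to\mathcal C(B,A)$, with $(fg)^*=g^*f^*$, such that $\|f\|^2=\|f^*f\|$ and $f^*f$ is positive in $\mathcal C(A):=\mathcal C(A,A)$ for every $f:A\to B$. The objects may form a proper class. $C^*$-functors are unital, complex linear on morphisms and preserve $*$. *Hilbert modules.* A Hilbert $\mathcal C$-module $H$ consists of Banach spaces $H(A)$, depending contravariantly and linearly on $A\in\mathcal C$ (for $x\in H(A)$ and $f:B\to A$ write $xf\in H(B)$), with scalar products $\langle y,x\rangle\in\mathcal C(A,B)$ for $x\in H(A)$, $y\in H(B)$, linear in $x$, with $\langle y,x\rangle^*=\langle x,y\rangle$, $\langle y,xf\rangle=\langle y,x\rangle f$, $\langle x,x\rangle\ge0$ and $\|x\|^2=\|\langle x,x\rangle\|$. A bounded linear map $T:H\to G$ is a natural family of linear maps $H(A)\to G(A)$ bounded uniformly in $A$; an operator is a bounded linear map that has an adjoint,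 i.e. a bounded linear map $T^*:G\to H$ with $\langle Tx,y\rangle=\langle x,T^*y\rangle$. $H$ is small if it is generated by a set of elements, i.e. there is a set of elements $g_i\in H(s_i)$ such that the finite sums $\sum_i g_if_i$ with $f_i:A\to s_i$ are dense in $H(A)$ for each $A$. $\mathcal H\mathcal C$ is the $C^*$-category of small Hilbert $\mathcal C$-modules and operators. The Yoneda embedding $\mathbb Y:\mathcal C\to\mathcal H\mathcal C$ is $\mathbb Y_A(B)=\mathcal C(B,A)$ with $\langle u,v\rangle=u^*v$; an element $x\in H(A)$ is identified with the operator $\hat x:\mathbb Y_A\to H$, $f\mapsto xf$. *Extension of scalars.* A $C^*$-functor $f:\mathcal C\to\mathcal D$ induces a $C^*$-functor $\mathcal Hf:\mathcal H\mathcal C\to\mathcal H\mathcal D$: $(\mathcal Hf)H$ is the Hilbert $\mathcal D$-module generated by elements $x\otimes1\in((\mathcal Hf)H)(fA)$ for $x\in H(A)$, with $\langle y\otimes1,x\otimes1\rangle=f(\langle y,x\rangle)$, and $(\mathcal Hf)T$ sends $x\otimes 1$ to $Tx\otimes1$. There is a canonical unitary isomorphism $\mathbb Y_{fA}\simeq(\mathcal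 Hf)\mathbb Y_A$ given by the element $1_A\otimes1$. **Pre-complete $C^*$-categories.** A pre-complete $C^*$-category is a unital $C^*$-category $\mathcal C$ with a $C^*$-functor $L:\mathcal H\mathcal C\to\mathcal C$ and a natural unitary isomorphism $\iota:\mathrm{Id}_{\mathcal C}\simeq L\circ\mathbb Y$. For $H\in\mathcal H\mathcal C$ let $\mu_H:H\to\mathbb Y_{LH}$ be the isometric embedding sending $x\in H(A)$ to $L(\hat x)\circ\iota_A:A\to LH$. A $C^*$-functor $f:\mathcal C\to\mathcal D$ between pre-complete $C^*$-categories $(\mathcal C,L,\iota)$ and $(\mathcal D,L',\iota')$ is *continuous* if there is a natural unitary isomorphism $f\circ L\simeq L'\circ\mathcal Hf$ which on each $\mathbb Y_A$ is the canonical one, $fL\mathbb Y_A\simeq fA\simeq L'\mathbb Y_{fA}\simeq L'(\mathcal Hf)\mathbb Y_A$. The category $\mathcal H\mathcal C$ is pre-complete through the functor $R:\mathcal H\mathcal H\mathcal C\to\mathcal H\mathcal C$ of restriction along $\mathbb Y$, $(RV)(A)=V(\mathbb Y_A)$, with the isomorphism $E\simeq R\,\mathbb Y_E$, $x\mapsto\hat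 x$. A hereditary subalgebra of $\mathcal C(X)$ is a closed $*$-subalgebra $\mathcal A$ with $\mathcal A\,\mathcal C(X)\,\mathcal A\subset\mathcal A$; $\mathcal AX\subset\mathbb Y_X$ is the closed submodule such that $(\mathcal AX)(B)$ is the closed linear span of the morphisms $ah$ with $a\in\mathcal A$, $h\in\mathcal C(B,X)$. In a pre-complete $C^*$-category, $\mathcal A$ is *weakly dense* if there is an isomorphism $\varphi:L(\mathcal AX)\to X$ with $\varphi\circ\mu_{\mathcal AX}(x)=x$ for all $B$ and $x\in(\mathcal AX)(B)$. Consider the following conditions on a pre-complete $C^*$-category $(\mathcal C,L,\iota)$. * (C1) For all $H\in\mathcal H\mathcal C$ and all $\lambda:LH\to A$ in $\mathcal C$, if $\lambda\circ\mu_H(x)=0$ for all $B$ and all $x\in H(B)$, then $\lambda=0$. * (C2) The functor $L:\mathcal H\mathcal C\to\mathcal C$ is continuous, for the pre-complete structure $R$ on $\mathcal H\mathcal C$. * (C3) For every object $X$ and all hereditary subalgebras $\mathcal A\subset\mathcal B\subset\mathcal C(X)$, if $\mathcal A$ is weakly dense then $\mathcal B$ is weakly dense. * (C4) For all $A,B\in\mathcal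 H\mathcal C$ and all bounded linear maps $f:A\to\mathbb Y_{LB}$, $g:B\to\mathbb Y_{LA}$ with $\langle f(a),\mu_B(b)\rangle=\langle\mu_A(a),g(b)\rangle$ for all $X$, $Z$, $a\in A(X)$, $b\in B(Z)$, there is an operator $\tilde f:\mathbb Y_{LA}\to\mathbb Y_{LB}$ with $\tilde f(\mu_A(a))=f(a)$ for all $X$ and $a\in A(X)$. **Proposition.** Let $(\mathcal C,L,\iota)$ be a pre-complete $C^*$-category. * If $\mathcal C$ satisfies (C1) and (C3), then $\mathcal C$ satisfies (C2). * If $\mathcal C$ satisfies (C1) and (C4), then $\mathcal C$ satisfies (C3), and hence also (C2). -/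

import Mathlib

universe v u v₁ u₁ v₂ u₂

open CategoryTheory

namespace CStarCat

/-- A (unital) Banach *-category. The morphisms between two objects form a set (`Type v`), the
objects form a possibly large class (`Type u`). -/
class BanachStarCategory (C : Type u) extends Category.{v} C where
  homGroup : ∀ A B : C, NormedAddCommGroup (A ⟶ B)
  homSpace : ∀ A B : C, NormedSpace ℂ (A ⟶ B)
  homComplete : ∀ A B : C, CompleteSpace (A ⟶ B)
  add_comp : ∀ {A B D : C} (f g : A ⟶ B) (h : B ⟶ D), (f + g) ≫ h = f ≫ h + g ≫ h
  comp_add : ∀ {A B D : C} (f : A ⟶ B) (g h : B ⟶ D), f ≫ (g + h) = f ≫ g + f ≫ h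
  smul_comp : ∀ {A B D : C} (c : ℂ) (f : A ⟶ B) (g : B ⟶ D), (c • f) ≫ g = c • (f ≫ g)
  comp_smul : ∀ {A B D : C} (c : ℂ) (f : A ⟶ B) (g : B ⟶ D), f ≫ (c • g) = c • (f ≫ g)
  norm_comp_le : ∀ {A B D : C} (f : A ⟶ B) (g : B ⟶ D), ‖f ≫ g‖ ≤ ‖f‖ * ‖g‖
  /-- the adjoint `f*` of a morphism `f` -/
  adj : ∀ {A B : C}, (A ⟶ B) → (B ⟶ A)
  adj_adj : ∀ {A B : C} (f : A ⟶ B), adj (adj f) = f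
  adj_comp : ∀ {A B D : C} (f : A ⟶ B) (g : B ⟶ D), adj (f ≫ g) = adj g ≫ adj f
  adj_add : ∀ {A B : C} (f g : A ⟶ B), adj (f + g) = adj f + adj g
  adj_smul : ∀ {A B : C} (c : ℂ) (f : A ⟶ B), adj (c • f) = (starRingEnd ℂ c) • adj f
  norm_adj : ∀ {A B : C} (f : A ⟶ B), ‖adj f‖ = ‖f‖

attribute [reducible, instance] BanachStarCategory.homGroup BanachStarCategory.homSpace
attribute [instance] BanachStarCategory.homComplete

open BanachStarCategory

/-- Positive elements of the C*-algebra of endomorphisms of `A`: those of the form `k* k`.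
(In diagrammatic order, `k ≫ adj k` is `k* k`.) -/
def IsPos {C : Type u} [BanachStarCategory.{v} C] {A : C} (a : A ⟶ A) : Prop :=
  ∃ k : A ⟶ A, a = k ≫ adj k

/-- A unital C*-category: a Banach *-category with `‖f‖ ^ 2 = ‖f* f‖` and `f* f` positive. -/
class CStarCategory (C : Type u) extends BanachStarCategory.{v} C where
  norm_sq : ∀ {A B : C} (f : A ⟶ B), ‖f‖ ^ 2 = ‖f ≫ adj f‖
  adj_pos : ∀ {A B : C} (f : A ⟶ B), IsPos (f ≫ adj f)

open CStarCategory

section Basic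

variable {C : Type u} [BanachStarCategory.{v} C]

/-- `f` is a unitary (i.e. isometric) isomorphism. -/
structure IsUnitary {A B : C} (f : A ⟶ B) : Prop where
  comp_adj : f ≫ adj f = 𝟙 A
  adj_comp : adj f ≫ f = 𝟙 B

def compL {A B D : C} (f : A ⟶ B) : (B ⟶ D) →ₗ[ℂ] (A ⟶ D) where
  toFun g := f ≫ g
  map_add' := comp_add f
  map_smul' c g := comp_smul c f g

def compR {A B D : C} (g : B ⟶ D) : (A ⟶ B) →ₗ[ℂ] (A ⟶ D) where
  toFun f := f ≫ g
  map_add' f f' := add_comp f f' g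
  map_smul' c f := smul_comp c f g

def adjL (A B : C) : (A ⟶ B) →ₗ⋆[ℂ] (B ⟶ A) where
  toFun f := adj f
  map_add' := adj_add
  map_smul' := adj_smul

@[simp] lemma comp_zero' {A B D : C} (f : A ⟶ B) : f ≫ (0 : B ⟶ D) = 0 := (compL f).map_zero
@[simp] lemma zero_comp' {A B D : C} (f : B ⟶ D) : (0 : A ⟶ B) ≫ f = 0 := (compR f).map_zero
@[simp] lemma adj_zero' {A B : C} : adj (0 : A ⟶ B) = 0 := (adjL A B).map_zero
lemma comp_neg' {A B D : C} (f : A ⟶ B) (g : B ⟶ D) : f ≫ (-g) = -(f ≫ g) := (compL f).map_neg g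
lemma neg_comp' {A B D : C} (f : A ⟶ B) (g : B ⟶ D) : (-f) ≫ g = -(f ≫ g) := (compR g).map_neg f
lemma comp_sub' {A B D : C} (f : A ⟶ B) (g h : B ⟶ D) : f ≫ (g - h) = f ≫ g - f ≫ h :=
  (compL f).map_sub g h
lemma sub_comp' {A B D : C} (f g : A ⟶ B) (h : B ⟶ D) : (f - g) ≫ h = f ≫ h - g ≫ h :=
  (compR h).map_sub f g
lemma adj_sub' {A B : C} (f g : A ⟶ B) : adj (f - g) = adj f - adj g := (adjL A B).map_sub f g
lemma comp_sum' {ι : Type*} {A B D : C} (s : Finset ι) (f : A ⟶ B) (g : ι → (B ⟶ D)) :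
    f ≫ (∑ i ∈ s, g i) = ∑ i ∈ s, f ≫ g i := map_sum (compL f) g s
lemma sum_comp' {ι : Type*} {A B D : C} (s : Finset ι) (f : ι → (A ⟶ B)) (g : B ⟶ D) :
    (∑ i ∈ s, f i) ≫ g = ∑ i ∈ s, f i ≫ g := map_sum (compR g) f s
lemma adj_sum' {ι : Type*} {A B : C} (s : Finset ι) (f : ι → (A ⟶ B)) :
    adj (∑ i ∈ s, f i) = ∑ i ∈ s, adj (f i) := map_sum (adjL A B) f s

@[simp] lemma adj_id (A : C) : adj (𝟙 A) = 𝟙 A := by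
  have h := adj_comp (adj (𝟙 A)) (𝟙 A)
  rw [Category.comp_id, adj_adj, Category.comp_id] at h
  exact h.symm

lemma continuous_adj {A B : C} : Continuous (adj : (A ⟶ B) → (B ⟶ A)) :=
  (LinearMap.mkContinuous (adjL A B) 1 fun f => by
    rw [one_mul]; exact (norm_adj f).le).continuous

lemma continuous_comp' {A B D : C} :
    Continuous fun p : (A ⟶ B) × (B ⟶ D) => p.1 ≫ p.2 :=
  (LinearMap.mkContinuous₂ (LinearMap.mk₂ ℂ (fun (f : A ⟶ B) (g : B ⟶ D) => f ≫ g)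
    add_comp (fun c f g => smul_comp c f g) comp_add (fun c f g => comp_smul c f g)) 1
    (fun f g => by simpa using norm_comp_le f g)).continuous₂

lemma cont_comp {X : Type*} [TopologicalSpace X] {A B D : C} {f : X → (A ⟶ B)}
    {g : X → (B ⟶ D)} (hf : Continuous f) (hg : Continuous g) :
    Continuous fun x => f x ≫ g x := continuous_comp'.comp (hf.prodMk hg)

noncomputable instance endNormedRing (A : C) : NormedRing (End A) :=
  { homGroup A A, End.monoid (X := A) with
    zero_mul := fun a => comp_zero' _
    mul_zero := fun a => zero_comp' _
    left_distrib := fun a b c => add_comp (A := A) (B := A) (D := A) b c a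
    right_distrib := fun a b c => comp_add (A := A) (B := A) (D := A) c a b
    norm_mul_le := fun a b => by
      rw [mul_comm]; exact norm_comp_le (A := A) (B := A) (D := A) b a }

noncomputable instance endStarRing (A : C) : StarRing (End A) where
  star a := adj (A := A) (B := A) a
  star_involutive a := adj_adj (A := A) (B := A) a
  star_mul a b := adj_comp (A := A) (B := A) (D := A) b a
  star_add a b := adj_add (A := A) (B := A) a b

noncomputable instance endModule (A : C) : Module ℂ (End A) :=
  { (homSpace A A).toModule with }

noncomputable instance endAlgebra (A : C) : Algebra ℂ (End A) :=
  Algebra.ofModule (R := ℂ) (A := End A)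
    (fun c a b => comp_smul (A := A) (B := A) (D := A) c b a)
    (fun c a b => smul_comp (A := A) (B := A) (D := A) c b a)

noncomputable instance endNormedAlgebra (A : C) : NormedAlgebra ℂ (End A) :=
  { endAlgebra A with
    norm_smul_le := fun c a => norm_smul_le (α := ℂ) (β := (A ⟶ A)) c a }

/-- The endomorphisms of an object form a C*-algebra as soon as the C*-identity holds. -/
noncomputable abbrev endCStarAlgebraOf (A : C) (h : ∀ f : A ⟶ A, ‖f‖ ^ 2 = ‖f ≫ adj f‖) :
    CStarAlgebra (End A) :=
  { endNormedRing A, endStarRing A, endNormedAlgebra A with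
    complete := (homComplete A A).complete
    norm_mul_self_le := fun a => by
      rw [← sq]; exact (h a).le
    star_smul := fun c a => adj_smul (A := A) (B := A) c a }

end Basic

section Basic

variable {C : Type u} [CStarCategory.{v} C]

noncomputable instance endCStarAlgebra (A : C) : CStarAlgebra (End A) :=
  endCStarAlgebraOf A norm_sq


attribute [local instance] CStarAlgebra.spectralOrder CStarAlgebra.spectralOrderedRing

lemma isPos_iff {A : C} (a : A ⟶ A) : IsPos a ↔ (0 : End A) ≤ a := by
  rw [CStarAlgebra.nonneg_iff_eq_star_mul_self]; rfl

lemma isPos_comp_adj {A B : C} (f : A ⟶ B) : IsPos (f ≫ adj f) := adj_pos f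

lemma IsPos.adj_eq {A : C} {a : A ⟶ A} (h : IsPos a) : adj a = a := by
  obtain ⟨k, rfl⟩ := h
  rw [BanachStarCategory.adj_comp, adj_adj]

lemma isPos_zero {A : C} : IsPos (0 : A ⟶ A) := ⟨0, by simp⟩

lemma IsPos.add {A : C} {a b : A ⟶ A} (ha : IsPos a) (hb : IsPos b) : IsPos (a + b) := by
  rw [isPos_iff] at *
  exact add_nonneg ha hb

lemma IsPos.sum {ι : Type*} {A : C} (s : Finset ι) {a : ι → (A ⟶ A)}
    (h : ∀ i ∈ s, IsPos (a i)) : IsPos (∑ i ∈ s, a i) := by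
  classical
  induction s using Finset.induction_on with
  | empty => simpa using isPos_zero
  | insert i s hi ih =>
    rw [Finset.sum_insert hi]
    exact (h i (by simp)).add (ih fun j hj => h j (by simp [hj]))

lemma IsPos.conj {A B : C} {a : A ⟶ A} (ha : IsPos a) (c : B ⟶ A) : IsPos (c ≫ a ≫ adj c) := by
  obtain ⟨k, rfl⟩ := ha
  have := isPos_comp_adj (c ≫ k)
  rw [BanachStarCategory.adj_comp] at this
  simpa only [Category.assoc] using this

lemma IsPos.smul {A : C} {a : A ⟶ A} (ha : IsPos a) {r : ℝ} (hr : 0 ≤ r) :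
    IsPos ((r : ℂ) • a) := by
  obtain ⟨k, rfl⟩ := ha
  refine ⟨((Real.sqrt r : ℝ) : ℂ) • k, ?_⟩
  rw [adj_smul, comp_smul, smul_comp, smul_smul, Complex.conj_ofReal, ← Complex.ofReal_mul,
    Real.mul_self_sqrt hr]

lemma isClosed_isPos (A : C) : IsClosed {a : A ⟶ A | IsPos a} := by
  have : {a : A ⟶ A | IsPos a} = {a : End A | 0 ≤ a} := Set.ext fun a => isPos_iff a
  rw [this]
  exact CStarAlgebra.isClosed_nonneg (A := End A)

lemma IsPos.norm_le {A : C} {a b : A ⟶ A} (ha : IsPos a) (hab : IsPos (b - a)) : ‖a‖ ≤ ‖b‖ := by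
  rw [isPos_iff] at *
  exact CStarAlgebra.norm_le_norm_of_nonneg_of_le (A := End A) ha (sub_nonneg.1 hab)

lemma IsPos.eq_zero {A : C} {a : A ⟶ A} (ha : IsPos a) (ha' : IsPos (-a)) : a = 0 := by
  rw [isPos_iff] at *
  exact le_antisymm (α := End A) (neg_nonneg.1 ha') ha

lemma IsPos.smul_id_sub {A : C} {a : A ⟶ A} (ha : IsPos a) {r : ℝ} (hr : ‖a‖ ≤ r) :
    IsPos ((r : ℂ) • 𝟙 A - a) := by
  have hsa : @IsSelfAdjoint (End A) _ a := ha.adj_eq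
  have h1 := hsa.le_algebraMap_norm_self
  rw [← sub_nonneg] at h1
  have h2 : IsPos ((‖a‖ : ℂ) • 𝟙 A - a) := by
    rw [isPos_iff]; exact h1
  have h3 : IsPos (((r - ‖a‖ : ℝ) : ℂ) • 𝟙 A) :=
    IsPos.smul ⟨𝟙 A, by simp⟩ (sub_nonneg.2 hr)
  have := h2.add h3
  convert this using 1
  push_cast
  module

end Basic

/-- A (right) pre-Hilbert module over `C`: a contravariant linear functor (`act x f` is `x ∘ f`)
with a scalar product `inner y x : A ⟶ B` for `y` over `B` and `x` over `A`, linear in `x`. -/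
structure PreHilbertModule (C : Type u) [CStarCategory.{v} C] where
  obj : C → Type v
  addCommGroup : ∀ A, AddCommGroup (obj A)
  module : ∀ A, Module ℂ (obj A)
  act : ∀ {A B : C}, obj A → (B ⟶ A) → obj B
  add_act : ∀ {A B : C} (x y : obj A) (f : B ⟶ A), act (x + y) f = act x f + act y f
  smul_act : ∀ {A B : C} (c : ℂ) (x : obj A) (f : B ⟶ A), act (c • x) f = c • act x f
  act_add : ∀ {A B : C} (x : obj A) (f g : B ⟶ A), act x (f + g) = act x f + act x g
  act_smul : ∀ {A B : C} (c : ℂ) (x : obj A) (f : B ⟶ A), act x (c • f) = c • act x f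
  act_id : ∀ {A : C} (x : obj A), act x (𝟙 A) = x
  act_comp : ∀ {A B D : C} (x : obj A) (f : B ⟶ A) (g : D ⟶ B),
    act x (g ≫ f) = act (act x f) g
  inner : ∀ {A B : C}, obj B → obj A → (A ⟶ B)
  adj_inner : ∀ {A B : C} (y : obj B) (x : obj A), adj (inner y x) = inner x y
  inner_add : ∀ {A B : C} (y : obj B) (x x' : obj A), inner y (x + x') = inner y x + inner y x'
  inner_smul : ∀ {A B : C} (c : ℂ) (y : obj B) (x : obj A), inner y (c • x) = c • inner y x
  inner_act : ∀ {A B D : C} (y : obj B) (x : obj A) (f : D ⟶ A),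
    inner y (act x f) = f ≫ inner y x
  inner_self_pos : ∀ {A : C} (x : obj A), IsPos (inner x x)

/-- A Hilbert module over `C`: a pre-Hilbert module that is separated and complete for the norm
`‖x‖ = ‖⟨x, x⟩‖ ^ (1 / 2)`. -/
structure HilbertModule (C : Type u) [CStarCategory.{v} C] where
  obj : C → Type v
  normedAddCommGroup : ∀ A, NormedAddCommGroup (obj A)
  normedSpace : ∀ A, NormedSpace ℂ (obj A)
  completeSpace : ∀ A, CompleteSpace (obj A)
  act : ∀ {A B : C}, obj A → (B ⟶ A) → obj B
  add_act : ∀ {A B : C} (x y : obj A) (f : B ⟶ A), act (x + y) f = act x f + act y f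
  smul_act : ∀ {A B : C} (c : ℂ) (x : obj A) (f : B ⟶ A), act (c • x) f = c • act x f
  act_add : ∀ {A B : C} (x : obj A) (f g : B ⟶ A), act x (f + g) = act x f + act x g
  act_smul : ∀ {A B : C} (c : ℂ) (x : obj A) (f : B ⟶ A), act x (c • f) = c • act x f
  act_id : ∀ {A : C} (x : obj A), act x (𝟙 A) = x
  act_comp : ∀ {A B D : C} (x : obj A) (f : B ⟶ A) (g : D ⟶ B),
    act x (g ≫ f) = act (act x f) g
  inner : ∀ {A B : C}, obj B → obj A → (A ⟶ B)
  adj_inner : ∀ {A B : C} (y : obj B) (x : obj A), adj (inner y x) = inner x y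
  inner_add : ∀ {A B : C} (y : obj B) (x x' : obj A), inner y (x + x') = inner y x + inner y x'
  inner_smul : ∀ {A B : C} (c : ℂ) (y : obj B) (x : obj A), inner y (c • x) = c • inner y x
  inner_act : ∀ {A B D : C} (y : obj B) (x : obj A) (f : D ⟶ A),
    inner y (act x f) = f ≫ inner y x
  inner_self_pos : ∀ {A : C} (x : obj A), IsPos (inner x x)
  norm_sq : ∀ {A : C} (x : obj A), ‖x‖ ^ 2 = ‖inner x x‖

attribute [instance] HilbertModule.normedAddCommGroup HilbertModule.normedSpace
  HilbertModule.completeSpace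

namespace PreHilbertModule

attribute [local instance] PreHilbertModule.addCommGroup PreHilbertModule.module

variable {C : Type u} [CStarCategory.{v} C] (P : PreHilbertModule C)

def innerL {A B : C} (y : P.obj B) : P.obj A →ₗ[ℂ] (A ⟶ B) where
  toFun x := P.inner y x
  map_add' := P.inner_add y
  map_smul' c x := P.inner_smul c y x

lemma inner_add_left {A B : C} (y y' : P.obj B) (x : P.obj A) :
    P.inner (y + y') x = P.inner y x + P.inner y' x := by
  rw [← P.adj_inner, P.inner_add, adj_add, P.adj_inner, P.adj_inner]

lemma inner_smul_left {A B : C} (c : ℂ) (y : P.obj B) (x : P.obj A) :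
    P.inner (c • y) x = (starRingEnd ℂ c) • P.inner y x := by
  rw [← P.adj_inner, P.inner_smul, adj_smul, P.adj_inner]

lemma inner_sub {A B : C} (y : P.obj B) (x x' : P.obj A) :
    P.inner y (x - x') = P.inner y x - P.inner y x' := (P.innerL y).map_sub x x'

lemma inner_sub_left {A B : C} (y y' : P.obj B) (x : P.obj A) :
    P.inner (y - y') x = P.inner y x - P.inner y' x := by
  rw [← P.adj_inner, P.inner_sub, adj_sub', P.adj_inner, P.adj_inner]

lemma inner_act_left {A B D : C} (y : P.obj B) (x : P.obj A) (f : D ⟶ B) :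
    P.inner (P.act y f) x = P.inner y x ≫ adj f := by
  rw [← P.adj_inner, P.inner_act, BanachStarCategory.adj_comp, P.adj_inner]

/-- The Cauchy-Schwarz inequality. -/
lemma norm_inner_sq_le {A B : C} (x : P.obj A) (y : P.obj B) :
    ‖P.inner x y‖ ^ 2 ≤ ‖P.inner x x‖ * ‖P.inner y y‖ := by
  have key : ∀ K : ℝ, ‖P.inner x x‖ < K → ‖P.inner x y‖ ^ 2 ≤ K * ‖P.inner y y‖ := by
    intro K hK
    have hK0 : 0 < K := (norm_nonneg _).trans_lt hK
    set c := P.inner x y with hc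
    have hc' : P.inner y x = adj c := by rw [hc, P.adj_inner]
    have h1 := P.inner_self_pos (P.act x c - (K : ℂ) • y)
    have h2 := ((P.inner_self_pos x).smul_id_sub hK.le).conj c
    have h3 := h1.add h2
    have e : P.inner (P.act x c - (K : ℂ) • y) (P.act x c - (K : ℂ) • y)
        + c ≫ ((K : ℂ) • 𝟙 A - P.inner x x) ≫ adj c
        = ((K ^ 2 : ℝ) : ℂ) • P.inner y y - (K : ℂ) • (c ≫ adj c) := by
      rw [P.inner_sub, P.inner_sub_left, P.inner_sub_left, P.inner_smul, P.inner_smul,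
        P.inner_smul_left, P.inner_smul_left, P.inner_act, P.inner_act_left, P.inner_act,
        P.inner_act_left, sub_comp', comp_sub', smul_comp, comp_smul, Category.id_comp, hc', ← hc]
      simp only [Complex.conj_ofReal, smul_smul]
      push_cast
      module
    rw [e] at h3
    have h4 := ((isPos_comp_adj c).smul hK0.le).norm_le h3
    rw [norm_smul, norm_smul, ← CStarCategory.norm_sq, Complex.norm_real, Complex.norm_real,
      Real.norm_of_nonneg hK0.le, Real.norm_of_nonneg (by positivity), sq K, mul_assoc] at h4
    exact le_of_mul_le_mul_left h4 hK0
  refine le_of_forall_pos_le_add fun ε hε => ?_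
  have hy : 0 < ‖P.inner y y‖ + 1 := by positivity
  refine (key (‖P.inner x x‖ + ε / (‖P.inner y y‖ + 1)) (lt_add_of_pos_right _ (by positivity))).trans
    ?_
  rw [add_mul]
  gcongr
  rw [div_mul_eq_mul_div, div_le_iff₀ hy]
  nlinarith

noncomputable def pnorm {A : C} (x : P.obj A) : ℝ := Real.sqrt ‖P.inner x x‖

lemma pnorm_sq {A : C} (x : P.obj A) : P.pnorm x ^ 2 = ‖P.inner x x‖ :=
  Real.sq_sqrt (norm_nonneg _)

lemma pnorm_nonneg {A : C} (x : P.obj A) : 0 ≤ P.pnorm x := Real.sqrt_nonneg _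

lemma norm_inner_le_pnorm {A B : C} (x : P.obj A) (y : P.obj B) :
    ‖P.inner x y‖ ≤ P.pnorm x * P.pnorm y := by
  refine le_of_sq_le_sq ?_ (mul_nonneg (P.pnorm_nonneg x) (P.pnorm_nonneg y))
  rw [mul_pow, pnorm_sq, pnorm_sq]
  exact P.norm_inner_sq_le x y

noncomputable instance (A : C) : Norm (P.obj A) := ⟨P.pnorm⟩

lemma core (A : C) : SeminormedSpace.Core ℂ (P.obj A) where
  norm_nonneg := P.pnorm_nonneg
  norm_smul c x := by
    refine (sq_eq_sq₀ (P.pnorm_nonneg _) (mul_nonneg (norm_nonneg _) (P.pnorm_nonneg _))).1 ?_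
    rw [mul_pow, pnorm_sq, pnorm_sq, P.inner_smul, P.inner_smul_left, smul_smul, norm_smul]
    simp [sq]
  norm_triangle x y := by
    refine le_of_sq_le_sq ?_ (add_nonneg (P.pnorm_nonneg _) (P.pnorm_nonneg _))
    change P.pnorm (x + y) ^ 2 ≤ (P.pnorm x + P.pnorm y) ^ 2
    rw [pnorm_sq, P.inner_add, P.inner_add_left, P.inner_add_left]
    have h1 := P.norm_inner_le_pnorm x y
    have h2 := P.norm_inner_le_pnorm y x
    have h3 := P.pnorm_sq x
    have h4 := P.pnorm_sq y
    have := norm_add₄_le (a := P.inner x x) (b := P.inner y x) (c := P.inner x y)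
      (d := P.inner y y)
    rw [← add_assoc]
    nlinarith

/-- The semi-norm `‖x‖ = ‖⟨x, x⟩‖ ^ (1 / 2)`. -/
noncomputable abbrev seminormedAddCommGroup (A : C) : SeminormedAddCommGroup (P.obj A) :=
  SeminormedAddCommGroup.ofCore (P.core A)

noncomputable abbrev normedSpace (A : C) :
    @NormedSpace ℂ (P.obj A) _ (P.seminormedAddCommGroup A) :=
  letI := P.seminormedAddCommGroup A
  { P.module A with norm_smul_le := fun c x => ((P.core A).norm_smul c x).le }

end PreHilbertModule

namespace PreHilbertModule

open UniformSpace

variable {C : Type u} [CStarCategory.{v} C] (P : PreHilbertModule C)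

attribute [local instance] seminormedAddCommGroup normedSpace

lemma norm_eq {A : C} (x : P.obj A) : ‖x‖ = P.pnorm x := rfl

lemma norm_act_le {A B : C} (x : P.obj A) (f : B ⟶ A) : ‖P.act x f‖ ≤ ‖f‖ * ‖x‖ := by
  refine le_of_sq_le_sq ?_ (by positivity)
  rw [mul_pow, norm_eq, norm_eq, pnorm_sq, pnorm_sq, P.inner_act, P.inner_act_left]
  refine (norm_comp_le _ _).trans ?_
  rw [sq, mul_assoc]
  refine mul_le_mul_of_nonneg_left ((norm_comp_le _ _).trans ?_) (norm_nonneg _)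
  rw [norm_adj, mul_comm]

noncomputable def actL {A B : C} (f : B ⟶ A) : P.obj A →L[ℂ] P.obj B :=
  LinearMap.mkContinuous
    { toFun := fun x => P.act x f
      map_add' := fun x y => P.add_act x y f
      map_smul' := fun c x => P.smul_act c x f } ‖f‖ fun x => P.norm_act_le x f

noncomputable def cact {A B : C} (x : Completion (P.obj A)) (f : B ⟶ A) : Completion (P.obj B) :=
  Completion.map (P.actL f) x

lemma cact_coe {A B : C} (x : P.obj A) (f : B ⟶ A) :
    P.cact (x : Completion (P.obj A)) f = ((P.act x f : P.obj B) : Completion (P.obj B)) :=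
  Completion.map_coe (P.actL f).uniformContinuous x

lemma continuous_cact {A B : C} (f : B ⟶ A) :
    Continuous fun x : Completion (P.obj A) => P.cact x f := Completion.continuous_map

noncomputable def innerHom {A B : C} : P.obj B →+ P.obj A →+ (A ⟶ B) where
  toFun y := (P.innerL y).toAddMonoidHom
  map_zero' := by
    ext x
    change P.inner 0 x = 0
    have := P.inner_sub_left (0 : P.obj B) 0 x
    simpa using this
  map_add' y y' := by
    ext x
    exact P.inner_add_left y y' x

lemma continuous_inner {A B : C} :
    Continuous fun p : P.obj B × P.obj A => P.inner p.1 p.2 := by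
  let T := (LinearMap.mkContinuous₂ (LinearMap.mk₂'ₛₗ (starRingEnd ℂ) (RingHom.id ℂ)
    (fun (y : P.obj B) (x : P.obj A) => P.inner y x) P.inner_add_left P.inner_smul_left
    P.inner_add P.inner_smul) 1 (fun y x => by
      rw [one_mul]; exact P.norm_inner_le_pnorm y x))
  exact (T.continuous.comp continuous_fst).clm_apply continuous_snd

noncomputable def cinner {A B : C} (y : Completion (P.obj B)) (x : Completion (P.obj A)) : A ⟶ B :=
  (Completion.isDenseInducing_coe.prodMap Completion.isDenseInducing_coe).extend
    (fun p : P.obj B × P.obj A => P.inner p.1 p.2) (y, x)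

lemma cinner_coe {A B : C} (y : P.obj B) (x : P.obj A) :
    P.cinner (y : Completion (P.obj B)) (x : Completion (P.obj A)) = P.inner y x :=
  (Completion.isDenseInducing_coe.prodMap Completion.isDenseInducing_coe).extend_eq
    P.continuous_inner (y, x)

lemma continuous_cinner {A B : C} :
    Continuous fun p : Completion (P.obj B) × Completion (P.obj A) => P.cinner p.1 p.2 :=
  (Completion.isDenseInducing_toCompl (P.obj B)).extend_Z_bilin
    (Completion.isDenseInducing_toCompl (P.obj A)) (φ := P.innerHom) P.continuous_inner

lemma continuous_cinner' {A B : C} {X : Type*} [TopologicalSpace X]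
    {f : X → Completion (P.obj B)} {g : X → Completion (P.obj A)} (hf : Continuous f)
    (hg : Continuous g) : Continuous fun t => P.cinner (f t) (g t) :=
  P.continuous_cinner.comp (hf.prodMk hg)

/-- The Hilbert module obtained from a pre-Hilbert module by separated completion. -/
noncomputable def completion : HilbertModule C where
  obj A := Completion (P.obj A)
  normedAddCommGroup A := inferInstance
  normedSpace A := inferInstance
  completeSpace A := inferInstance
  act x f := P.cact x f
  add_act x y f := by
    refine Completion.induction_on₂ x y (isClosed_eq ?_ ?_) fun x y => ?_
    · exact (P.continuous_cact f).comp (continuous_fst.add continuous_snd)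
    · exact ((P.continuous_cact f).comp continuous_fst).add
        ((P.continuous_cact f).comp continuous_snd)
    · rw [← Completion.coe_add]
      simp only [cact_coe]
      rw [P.add_act]
      exact Completion.coe_add _ _
  smul_act c x f := by
    refine Completion.induction_on x (isClosed_eq ?_ ?_) fun x => ?_
    · exact (P.continuous_cact f).comp (continuous_const_smul c)
    · exact (P.continuous_cact f).const_smul c
    · rw [← Completion.coe_smul]
      simp only [cact_coe]
      rw [P.smul_act]
      exact Completion.coe_smul _ _
  act_add x f g := by
    refine Completion.induction_on x (isClosed_eq ?_ ?_) fun x => ?_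
    · exact P.continuous_cact _
    · exact (P.continuous_cact _).add (P.continuous_cact _)
    · simp only [cact_coe]
      rw [P.act_add]
      exact Completion.coe_add _ _
  act_smul c x f := by
    refine Completion.induction_on x (isClosed_eq ?_ ?_) fun x => ?_
    · exact P.continuous_cact _
    · exact (P.continuous_cact _).const_smul c
    · simp only [cact_coe]
      rw [P.act_smul]
      exact Completion.coe_smul _ _
  act_id x := by
    refine Completion.induction_on x (isClosed_eq ?_ ?_) fun x => ?_
    · exact P.continuous_cact _
    · exact continuous_id
    · simp only [cact_coe]
      rw [P.act_id]
  act_comp x f g := by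
    refine Completion.induction_on x (isClosed_eq ?_ ?_) fun x => ?_
    · exact P.continuous_cact _
    · exact (P.continuous_cact _).comp (P.continuous_cact _)
    · simp only [cact_coe]
      rw [P.act_comp]
  inner y x := P.cinner y x
  adj_inner y x := by
    refine Completion.induction_on₂ y x (isClosed_eq ?_ ?_) fun y x => ?_
    · exact continuous_adj.comp P.continuous_cinner
    · exact P.continuous_cinner' continuous_snd continuous_fst
    · simp only [cinner_coe]
      rw [P.adj_inner]
  inner_add y x x' := by
    refine Completion.induction_on₃ y x x' (isClosed_eq ?_ ?_) fun y x x' => ?_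
    · exact P.continuous_cinner' (by fun_prop) (by fun_prop)
    · exact (P.continuous_cinner' (by fun_prop) (by fun_prop)).add
        (P.continuous_cinner' (by fun_prop) (by fun_prop))
    · rw [← Completion.coe_add]
      simp only [cinner_coe]
      rw [P.inner_add]
  inner_smul c y x := by
    refine Completion.induction_on₂ y x (isClosed_eq ?_ ?_) fun y x => ?_
    · exact P.continuous_cinner' continuous_fst (continuous_snd.const_smul c)
    · exact P.continuous_cinner.const_smul c
    · rw [← Completion.coe_smul]
      simp only [cinner_coe]
      rw [P.inner_smul]
  inner_act y x f := by
    refine Completion.induction_on₂ y x (isClosed_eq ?_ ?_) fun y x => ?_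
    · exact P.continuous_cinner' continuous_fst ((P.continuous_cact f).comp continuous_snd)
    · exact cont_comp continuous_const P.continuous_cinner
    · simp only [cact_coe, cinner_coe]
      rw [P.inner_act]
  inner_self_pos {A} x := by
    refine Completion.induction_on x ?_ fun x => ?_
    · exact (isClosed_isPos A).preimage (P.continuous_cinner' continuous_id continuous_id)
    · simp only [cinner_coe]
      exact P.inner_self_pos x
  norm_sq x := by
    refine Completion.induction_on x (isClosed_eq ?_ ?_) fun x => ?_
    · exact continuous_norm.pow 2
    · exact (P.continuous_cinner' continuous_id continuous_id).norm
    · simp only [cinner_coe, Completion.norm_coe]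
      exact P.pnorm_sq x

/-- The canonical map from a pre-Hilbert module to its completion. -/
noncomputable def toCompletion {A : C} : P.obj A →ₗ[ℂ] P.completion.obj A :=
  (Completion.toComplL : P.obj A →L[ℂ] Completion (P.obj A)).toLinearMap

lemma inner_toCompletion {A B : C} (y : P.obj B) (x : P.obj A) :
    P.completion.inner (P.toCompletion y) (P.toCompletion x) = P.inner y x := P.cinner_coe y x

lemma act_toCompletion {A B : C} (x : P.obj A) (f : B ⟶ A) :
    P.completion.act (P.toCompletion x) f = P.toCompletion (P.act x f) := P.cact_coe x f

lemma denseRange_toCompletion {A : C} : DenseRange (P.toCompletion (A := A)) :=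
  Completion.denseRange_coe

end PreHilbertModule

namespace HilbertModule

variable {C : Type u} [CStarCategory.{v} C] (E F G : HilbertModule C)

/-- The underlying pre-Hilbert module. -/
abbrev toPre : PreHilbertModule C where
  obj := E.obj
  addCommGroup _ := inferInstance
  module _ := inferInstance
  act := E.act
  add_act := E.add_act
  smul_act := E.smul_act
  act_add := E.act_add
  act_smul := E.act_smul
  act_id := E.act_id
  act_comp := E.act_comp
  inner := E.inner
  adj_inner := E.adj_inner
  inner_add := E.inner_add
  inner_smul := E.inner_smul
  inner_act := E.inner_act
  inner_self_pos := E.inner_self_pos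

variable {E F G}

lemma inner_add_left {A B : C} (y y' : E.obj B) (x : E.obj A) :
    E.inner (y + y') x = E.inner y x + E.inner y' x := E.toPre.inner_add_left y y' x

lemma inner_smul_left {A B : C} (c : ℂ) (y : E.obj B) (x : E.obj A) :
    E.inner (c • y) x = (starRingEnd ℂ c) • E.inner y x := E.toPre.inner_smul_left c y x

lemma inner_sub {A B : C} (y : E.obj B) (x x' : E.obj A) :
    E.inner y (x - x') = E.inner y x - E.inner y x' := E.toPre.inner_sub y x x'

lemma inner_sub_left {A B : C} (y y' : E.obj B) (x : E.obj A) :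
    E.inner (y - y') x = E.inner y x - E.inner y' x := E.toPre.inner_sub_left y y' x

lemma inner_act_left {A B D : C} (y : E.obj B) (x : E.obj A) (f : D ⟶ B) :
    E.inner (E.act y f) x = E.inner y x ≫ adj f := E.toPre.inner_act_left y x f

/-- `x ↦ ⟨y, x⟩` as a linear map. -/
def innerL {A B : C} (y : E.obj B) : E.obj A →ₗ[ℂ] (A ⟶ B) where
  toFun x := E.inner y x
  map_add' := E.inner_add y
  map_smul' c x := E.inner_smul c y x

@[simp] lemma inner_zero {A B : C} (y : E.obj B) : E.inner y (0 : E.obj A) = 0 :=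
  (innerL y).map_zero

@[simp] lemma inner_zero_left {A B : C} (x : E.obj A) : E.inner (0 : E.obj B) x = 0 := by
  rw [← E.adj_inner, inner_zero, adj_zero']

lemma inner_sum {ι : Type*} {A B : C} (s : Finset ι) (y : E.obj B) (x : ι → E.obj A) :
    E.inner y (∑ i ∈ s, x i) = ∑ i ∈ s, E.inner y (x i) :=
  map_sum (innerL y) x s

lemma inner_sum_left {ι : Type*} {A B : C} (s : Finset ι) (y : ι → E.obj B) (x : E.obj A) :
    E.inner (∑ i ∈ s, y i) x = ∑ i ∈ s, E.inner (y i) x := by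
  rw [← E.adj_inner, inner_sum, adj_sum']
  simp only [E.adj_inner]

lemma norm_eq_pnorm {A : C} (x : E.obj A) : ‖x‖ = E.toPre.pnorm x := by
  refine (sq_eq_sq₀ (norm_nonneg _) (E.toPre.pnorm_nonneg _)).1 ?_
  exact (E.norm_sq x).trans (E.toPre.pnorm_sq x).symm

lemma norm_inner_le {A B : C} (y : E.obj B) (x : E.obj A) : ‖E.inner y x‖ ≤ ‖y‖ * ‖x‖ := by
  rw [norm_eq_pnorm, norm_eq_pnorm]
  exact E.toPre.norm_inner_le_pnorm y x

lemma norm_act_le {A B : C} (x : E.obj A) (f : B ⟶ A) : ‖E.act x f‖ ≤ ‖f‖ * ‖x‖ := by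
  rw [norm_eq_pnorm, norm_eq_pnorm]
  exact E.toPre.norm_act_le x f

lemma continuous_inner {A B : C} :
    Continuous fun p : E.obj B × E.obj A => E.inner p.1 p.2 := by
  let T := (LinearMap.mkContinuous₂ (LinearMap.mk₂'ₛₗ (starRingEnd ℂ) (RingHom.id ℂ)
    (fun (y : E.obj B) (x : E.obj A) => E.inner y x) inner_add_left inner_smul_left
    E.inner_add E.inner_smul) 1 (fun y x => by
      rw [one_mul]; exact norm_inner_le y x))
  exact (T.continuous.comp continuous_fst).clm_apply continuous_snd

lemma cont_inner {X : Type*} [TopologicalSpace X] {A B : C} {f : X → E.obj B} {g : X → E.obj A}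
    (hf : Continuous f) (hg : Continuous g) : Continuous fun t => E.inner (f t) (g t) :=
  continuous_inner.comp (hf.prodMk hg)

/-- `x ↦ x f` as a linear map. -/
def actL {A B : C} (f : B ⟶ A) : E.obj A →ₗ[ℂ] E.obj B where
  toFun x := E.act x f
  map_add' x y := E.add_act x y f
  map_smul' c x := E.smul_act c x f

/-- `f ↦ x f` as a linear map. -/
def actR {A B : C} (x : E.obj A) : (B ⟶ A) →ₗ[ℂ] E.obj B where
  toFun f := E.act x f
  map_add' := E.act_add x
  map_smul' c f := E.act_smul c x f

lemma continuous_actL {A B : C} (f : B ⟶ A) : Continuous fun x : E.obj A => E.act x f :=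
  (LinearMap.mkContinuous (actL f) ‖f‖ fun x => norm_act_le x f).continuous

lemma continuous_actR {A B : C} (x : E.obj A) : Continuous fun f : B ⟶ A => E.act x f :=
  (LinearMap.mkContinuous (actR x) ‖x‖ fun f => by
    rw [mul_comm]; exact norm_act_le x f).continuous

lemma eq_zero_of_inner_self {A : C} {x : E.obj A} (h : E.inner x x = 0) : x = 0 := by
  have := E.norm_sq x
  rw [h, norm_zero] at this
  exact norm_eq_zero.1 (pow_eq_zero_iff two_ne_zero |>.1 this)

lemma ext_inner {A : C} {x x' : E.obj A} (h : ∀ (B : C) (y : E.obj B), E.inner y x = E.inner y x') :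
    x = x' := by
  rw [← sub_eq_zero]
  refine eq_zero_of_inner_self ?_
  rw [inner_sub, h, sub_self]

/-- The finite sums of elements `g i ∘ f` are dense in `E.obj A` for every `A`: the family `g`
generates the module `E`. -/
def Generates (E : HilbertModule C) {I : Type*} {s : I → C} (g : ∀ i, E.obj (s i)) : Prop :=
  ∀ A : C, Dense (Submodule.span ℂ
    {x : E.obj A | ∃ (i : I) (f : A ⟶ s i), x = E.act (g i) f} : Set (E.obj A))

lemma Generates.induction {I : Type*} {s : I → C} {g : ∀ i, E.obj (s i)} (hg : E.Generates g)
    {A : C} {p : E.obj A → Prop} (hc : IsClosed {x | p x}) (hgen : ∀ i f, p (E.act (g i) f))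
    (h0 : p 0) (hadd : ∀ x y, p x → p y → p (x + y)) (hsmul : ∀ (c : ℂ) x, p x → p (c • x))
    (x : E.obj A) : p x := by
  refine hc.closure_subset_iff.2 (fun y hy => ?_) (hg A x)
  change p y
  induction hy using Submodule.span_induction with
  | mem y hy =>
    obtain ⟨i, f, rfl⟩ := hy
    exact hgen i f
  | zero => exact h0
  | add y z _ _ hy hz => exact hadd y z hy hz
  | smul c y _ hy => exact hsmul c y hy

lemma Generates.ext {I : Type*} {s : I → C} {g : ∀ i, E.obj (s i)} (hg : E.Generates g)
    {A : C} {x x' : E.obj A} (h : ∀ i, E.inner (g i) x = E.inner (g i) x') : x = x' := by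
  refine ext_inner fun B y => ?_
  refine hg.induction (p := fun y => E.inner y x = E.inner y x') ?_ ?_ ?_ ?_ ?_ y
  · exact isClosed_eq (cont_inner continuous_id continuous_const)
      (cont_inner continuous_id continuous_const)
  · intro i f
    rw [inner_act_left, inner_act_left, h]
  · rw [inner_zero_left, inner_zero_left]
  · intro y z hy hz
    rw [inner_add_left, inner_add_left, hy, hz]
  · intro c y hy
    rw [inner_smul_left, inner_smul_left, hy]

/-- Families of linear maps `E(A) → F(A)`. -/
abbrev LinFam (E F : HilbertModule C) := ∀ A : C, E.obj A →ₗ[ℂ] F.obj A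

/-- `T` is a bounded linear map from `E` to `F`: natural and uniformly bounded. -/
structure IsBounded (T : LinFam E F) : Prop where
  naturality : ∀ {A B : C} (x : E.obj A) (f : B ⟶ A), T B (E.act x f) = F.act (T A x) f
  bound : ∃ K : ℝ, ∀ (A : C) (x : E.obj A), ‖T A x‖ ≤ K * ‖x‖

/-- `⟨T x, y⟩ = ⟨x, S y⟩` for all `x`, `y`. -/
def IsAdjointPair (T : LinFam E F) (S : LinFam F E) : Prop :=
  ∀ (A B : C) (x : E.obj A) (y : F.obj B), F.inner (T A x) y = E.inner x (S B y)

/-- `T` is an operator: a bounded linear map that has an adjoint. -/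
def IsOperator (T : LinFam E F) : Prop :=
  IsBounded T ∧ ∃ S : LinFam F E, IsBounded S ∧ IsAdjointPair T S

lemma IsAdjointPair.symm {T : LinFam E F} {S : LinFam F E} (h : IsAdjointPair T S) :
    IsAdjointPair S T := by
  intro A B y x
  rw [← E.adj_inner, ← h, F.adj_inner]

lemma IsAdjointPair.naturality {T : LinFam E F} {S : LinFam F E} (h : IsAdjointPair T S)
    {A B : C} (x : E.obj A) (f : B ⟶ A) : T B (E.act x f) = F.act (T A x) f := by
  refine ext_inner fun D y => ?_
  rw [F.inner_act, ← h.symm, ← h.symm, E.inner_act]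

lemma IsAdjointPair.bound {T : LinFam E F} {S : LinFam F E} (h : IsAdjointPair T S) {K : ℝ}
    (hK0 : 0 ≤ K) (hK : ∀ (A : C) (x : E.obj A), ‖T A x‖ ≤ K * ‖x‖) (A : C) (y : F.obj A) :
    ‖S A y‖ ≤ K * ‖y‖ := by
  have h1 : ‖S A y‖ * ‖S A y‖ ≤ (K * ‖y‖) * ‖S A y‖ := by
    rw [← sq, E.norm_sq, ← h]
    refine (norm_inner_le _ _).trans ?_
    have := mul_le_mul_of_nonneg_right (hK A (S A y)) (norm_nonneg y)
    nlinarith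
  rcases (norm_nonneg (S A y)).eq_or_lt with h0 | h0
  · rw [← h0]; positivity
  · exact le_of_mul_le_mul_right h1 h0

lemma isOperator_of_pair {T : LinFam E F} {S : LinFam F E} (h : IsAdjointPair T S) (K : ℝ)
    (hK : ∀ (A : C) (x : E.obj A), ‖T A x‖ ≤ K * ‖x‖) : IsOperator T := by
  have hK' : ∀ (A : C) (x : E.obj A), ‖T A x‖ ≤ |K| * ‖x‖ := fun A x =>
    (hK A x).trans (mul_le_mul_of_nonneg_right (le_abs_self K) (norm_nonneg x))
  exact ⟨⟨h.naturality, K, hK⟩, S, ⟨h.symm.naturality, |K|, h.bound (abs_nonneg K) hK'⟩, h⟩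

variable (E F) in
/-- The space of operators from `E` to `F`. -/
def operators : Submodule ℂ (LinFam E F) where
  carrier := {T | IsOperator T}
  add_mem' := by
    rintro T T' ⟨hT, S, hS, h⟩ ⟨hT', S', hS', h'⟩
    obtain ⟨K, hK⟩ := hT.bound
    obtain ⟨K', hK'⟩ := hT'.bound
    refine isOperator_of_pair (S := S + S') ?_ (K + K') fun A x => ?_
    · intro A B x y
      simp only [Pi.add_apply, LinearMap.add_apply]
      rw [inner_add_left, E.inner_add, h, h']
    · simp only [Pi.add_apply, LinearMap.add_apply]
      rw [add_mul]
      exact (norm_add_le _ _).trans (add_le_add (hK A x) (hK' A x))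
  zero_mem' := by
    refine isOperator_of_pair (S := 0) ?_ 0 fun A x => ?_
    · intro A B x y
      simp
    · simp
  smul_mem' := by
    rintro c T ⟨hT, S, hS, h⟩
    obtain ⟨K, hK⟩ := hT.bound
    refine isOperator_of_pair (S := (starRingEnd ℂ c) • S) ?_ (‖c‖ * K) fun A x => ?_
    · intro A B x y
      simp only [Pi.smul_apply, LinearMap.smul_apply]
      rw [inner_smul_left, E.inner_smul, h]
    · simp only [Pi.smul_apply, LinearMap.smul_apply]
      rw [norm_smul, mul_assoc]
      exact mul_le_mul_of_nonneg_left (hK A x) (norm_nonneg c)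

/-- A bounded linear map is determined by its values on a generating family. -/
lemma Generates.eq_of_eq {I : Type*} {s : I → C} {g : ∀ i, E.obj (s i)} (hg : E.Generates g)
    {T T' : LinFam E F} (hT : IsBounded T) (hT' : IsBounded T')
    (h : ∀ i, T (s i) (g i) = T' (s i) (g i)) : T = T' := by
  funext A
  obtain ⟨K, hK⟩ := hT.bound
  obtain ⟨K', hK'⟩ := hT'.bound
  have hc : Continuous (T A) := (LinearMap.mkContinuous (T A) K (hK A)).continuous
  have hc' : Continuous (T' A) := (LinearMap.mkContinuous (T' A) K' (hK' A)).continuous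
  have hs : Submodule.span ℂ {x : E.obj A | ∃ (i : I) (f : A ⟶ s i), x = E.act (g i) f} ≤
      LinearMap.eqLocus (T A) (T' A) := by
    rw [Submodule.span_le]
    rintro x ⟨i, f, rfl⟩
    change T A _ = T' A _
    rw [hT.naturality, hT'.naturality, h]
  ext x
  exact congrFun (Continuous.ext_on (hg A) hc hc' fun x hx => hs hx) x

end HilbertModule

/-- The objects of the category `H C`: the small Hilbert modules over `C`, that is, those that are
generated by a set (an element of `Type v`) of elements. -/
structure HMod (C : Type u) [CStarCategory.{v} C] extends HilbertModule C where
  small : ∃ (I : Type v) (s : I → C) (g : ∀ i, obj (s i)), toHilbertModule.Generates g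

namespace HMod

open HilbertModule

variable {C : Type u} [CStarCategory.{v} C]

instance small_operators (E F : HMod C) :
    Small.{v} (operators E.toHilbertModule F.toHilbertModule) := by
  obtain ⟨I, s, g, hg⟩ := E.small
  refine small_of_injective (β := ∀ i : I, F.obj (s i)) (f := fun T i => T.1 (s i) (g i)) ?_
  intro T T' h
  exact Subtype.ext (hg.eq_of_eq T.2.1 T'.2.1 fun i => congrFun h i)

/-- The morphisms of `H C` are the operators. They form a set because of smallness, so that one
can take a copy of the space of operators in `Type v`. -/
def Hom (E F : HMod C) : Type v := Shrink.{v} (operators E.toHilbertModule F.toHilbertModule)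

noncomputable instance (E F : HMod C) : AddCommGroup (Hom E F) :=
  inferInstanceAs (AddCommGroup (Shrink.{v} (operators E.toHilbertModule F.toHilbertModule)))

noncomputable instance (E F : HMod C) : Module ℂ (Hom E F) :=
  inferInstanceAs (Module ℂ (Shrink.{v} (operators E.toHilbertModule F.toHilbertModule)))

/-- The identification of morphisms of `H C` with operators. -/
noncomputable def homEquiv (E F : HMod C) :
    Hom E F ≃ₗ[ℂ] operators E.toHilbertModule F.toHilbertModule :=
  Shrink.linearEquiv ℂ (operators E.toHilbertModule F.toHilbertModule)

/-- The value of a morphism of `H C` on an element. -/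
noncomputable def Hom.ap {E F : HMod C} (T : Hom E F) {A : C} (x : E.obj A) : F.obj A :=
  (homEquiv E F T).1 A x

/-- A pair of adjoint bounded linear maps as a morphism of `H C`. -/
noncomputable def Hom.mk {E F : HMod C} (T : LinFam E.toHilbertModule F.toHilbertModule)
    (h : IsOperator T) : Hom E F :=
  (homEquiv E F).symm ⟨T, h⟩

namespace Hom

variable {E F G : HMod C}

@[simp] lemma mk_ap (T : LinFam E.toHilbertModule F.toHilbertModule) (h : IsOperator T)
    {A : C} (x : E.obj A) : (Hom.mk T h).ap x = T A x := by
  simp [Hom.ap, Hom.mk]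

lemma ext {T T' : Hom E F} (h : ∀ (A : C) (x : E.obj A), T.ap x = T'.ap x) : T = T' := by
  refine (homEquiv E F).injective (Subtype.ext ?_)
  funext A
  ext x
  exact h A x

@[simp] lemma add_ap (T T' : Hom E F) {A : C} (x : E.obj A) : (T + T').ap x = T.ap x + T'.ap x := by
  simp [Hom.ap]

@[simp] lemma zero_ap {A : C} (x : E.obj A) : (0 : Hom E F).ap x = 0 := by
  simp [Hom.ap]

@[simp] lemma neg_ap (T : Hom E F) {A : C} (x : E.obj A) : (-T).ap x = -T.ap x := by
  simp [Hom.ap]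

@[simp] lemma sub_ap (T T' : Hom E F) {A : C} (x : E.obj A) : (T - T').ap x = T.ap x - T'.ap x := by
  simp [Hom.ap]

@[simp] lemma smul_ap (c : ℂ) (T : Hom E F) {A : C} (x : E.obj A) : (c • T).ap x = c • T.ap x := by
  simp [Hom.ap]

lemma ap_add (T : Hom E F) {A : C} (x y : E.obj A) : T.ap (x + y) = T.ap x + T.ap y :=
  ((homEquiv E F T).1 A).map_add x y

lemma ap_sub (T : Hom E F) {A : C} (x y : E.obj A) : T.ap (x - y) = T.ap x - T.ap y :=
  ((homEquiv E F T).1 A).map_sub x y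

lemma ap_smul (T : Hom E F) (c : ℂ) {A : C} (x : E.obj A) : T.ap (c • x) = c • T.ap x :=
  ((homEquiv E F T).1 A).map_smul c x

@[simp] lemma ap_zero (T : Hom E F) {A : C} : T.ap (0 : E.obj A) = 0 :=
  ((homEquiv E F T).1 A).map_zero

lemma ap_sum (T : Hom E F) {ι : Type*} (s : Finset ι) {A : C} (x : ι → E.obj A) :
    T.ap (∑ i ∈ s, x i) = ∑ i ∈ s, T.ap (x i) :=
  map_sum ((homEquiv E F T).1 A) x s

lemma ap_act (T : Hom E F) {A B : C} (x : E.obj A) (f : B ⟶ A) :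
    T.ap (E.act x f) = F.act (T.ap x) f := (homEquiv E F T).2.1.naturality x f

lemma exists_bound (T : Hom E F) : ∃ K : ℝ, ∀ (A : C) (x : E.obj A), ‖T.ap x‖ ≤ K * ‖x‖ :=
  (homEquiv E F T).2.1.bound

/-- The adjoint of an operator. -/
noncomputable def adjoint (T : Hom E F) : Hom F E :=
  Hom.mk (homEquiv E F T).2.2.choose
    ⟨(homEquiv E F T).2.2.choose_spec.1, (homEquiv E F T).1, (homEquiv E F T).2.1,
      (homEquiv E F T).2.2.choose_spec.2.symm⟩

lemma inner_ap_left (T : Hom E F) {A B : C} (x : E.obj A) (y : F.obj B) :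
    F.inner (T.ap x) y = E.inner x (T.adjoint.ap y) := by
  have h : T.adjoint.ap y = (homEquiv E F T).2.2.choose B y := mk_ap _ _ y
  rw [h]
  exact (homEquiv E F T).2.2.choose_spec.2 A B x y

lemma inner_ap_right (T : Hom E F) {A B : C} (x : E.obj A) (y : F.obj B) :
    F.inner y (T.ap x) = E.inner (T.adjoint.ap y) x := by
  rw [← F.adj_inner, inner_ap_left, E.adj_inner]

lemma eq_adjoint {T : Hom E F} {S : Hom F E}
    (h : ∀ (A B : C) (x : E.obj A) (y : F.obj B), F.inner (T.ap x) y = E.inner x (S.ap y)) :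
    S = T.adjoint := by
  refine ext fun B y => ext_inner fun A x => ?_
  rw [← h, inner_ap_left]

/-- The operator norm `‖T‖ = sup ‖T_A‖`, i.e. the least uniform bound. -/
noncomputable instance : Norm (Hom E F) :=
  ⟨fun T => sInf {K : ℝ | 0 ≤ K ∧ ∀ (A : C) (x : E.obj A), ‖T.ap x‖ ≤ K * ‖x‖}⟩

lemma bddBelow_bounds (T : Hom E F) :
    BddBelow {K : ℝ | 0 ≤ K ∧ ∀ (A : C) (x : E.obj A), ‖T.ap x‖ ≤ K * ‖x‖} :=
  ⟨0, fun _ h => h.1⟩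

lemma norm_le {T : Hom E F} {K : ℝ} (hK : 0 ≤ K)
    (h : ∀ (A : C) (x : E.obj A), ‖T.ap x‖ ≤ K * ‖x‖) : ‖T‖ ≤ K :=
  csInf_le T.bddBelow_bounds ⟨hK, h⟩

lemma norm_nonneg' (T : Hom E F) : 0 ≤ ‖T‖ := Real.sInf_nonneg fun _ h => h.1

lemma norm_ap_le (T : Hom E F) {A : C} (x : E.obj A) : ‖T.ap x‖ ≤ ‖T‖ * ‖x‖ := by
  have hne : {K : ℝ | 0 ≤ K ∧ ∀ (A : C) (x : E.obj A), ‖T.ap x‖ ≤ K * ‖x‖}.Nonempty := by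
    obtain ⟨K, hK⟩ := T.exists_bound
    exact ⟨|K|, abs_nonneg K, fun A x =>
      (hK A x).trans (mul_le_mul_of_nonneg_right (le_abs_self K) (norm_nonneg x))⟩
  have hcl : IsClosed {K : ℝ | 0 ≤ K ∧ ∀ (A : C) (x : E.obj A), ‖T.ap x‖ ≤ K * ‖x‖} := by
    simp only [Set.ofPred_and, Set.ofPred_forall]
    refine (isClosed_le continuous_const continuous_id).inter ?_
    refine isClosed_iInter fun A => isClosed_iInter fun x => ?_
    exact isClosed_le continuous_const (continuous_id.mul continuous_const)
  exact (hcl.csInf_mem hne T.bddBelow_bounds).2 A x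

lemma core (E F : HMod C) : NormedSpace.Core ℂ (Hom E F) where
  norm_nonneg := norm_nonneg'
  norm_smul c T := by
    have h1 : ∀ (c : ℂ) (T : Hom E F), ‖c • T‖ ≤ ‖c‖ * ‖T‖ := by
      intro c T
      refine norm_le (mul_nonneg (norm_nonneg c) T.norm_nonneg') fun A x => ?_
      rw [smul_ap, norm_smul, mul_assoc]
      exact mul_le_mul_of_nonneg_left (T.norm_ap_le x) (norm_nonneg c)
    refine le_antisymm (h1 c T) ?_
    rcases eq_or_ne c 0 with rfl | hc
    · simpa using norm_nonneg' _
    · have h2 := h1 c⁻¹ (c • T)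
      rw [inv_smul_smul₀ hc, norm_inv] at h2
      rwa [← le_inv_mul_iff₀ (norm_pos_iff.2 hc)]
  norm_triangle T T' := by
    refine norm_le (add_nonneg T.norm_nonneg' T'.norm_nonneg') fun A x => ?_
    rw [add_ap, add_mul]
    exact (norm_add_le _ _).trans (add_le_add (T.norm_ap_le x) (T'.norm_ap_le x))
  norm_eq_zero_iff T := by
    constructor
    · intro h
      refine ext fun A x => ?_
      have := T.norm_ap_le x
      rw [h, zero_mul] at this
      rw [zero_ap]
      exact norm_le_zero_iff.1 this
    · rintro rfl
      exact le_antisymm (norm_le le_rfl fun A x => by simp) (norm_nonneg' _)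

noncomputable instance : NormedAddCommGroup (Hom E F) := NormedAddCommGroup.ofCore (core E F)

noncomputable instance : NormedSpace ℂ (Hom E F) where
  norm_smul_le c T := ((core E F).norm_smul c T).le

@[simp] lemma adjoint_adjoint (T : Hom E F) : T.adjoint.adjoint = T := by
  refine (eq_adjoint fun A B x y => ?_).symm
  rw [inner_ap_right]

lemma norm_adjoint_le (T : Hom E F) : ‖T.adjoint‖ ≤ ‖T‖ := by
  refine norm_le (norm_nonneg _) fun A y => ?_
  refine IsAdjointPair.bound (T := (homEquiv E F T).1) (S := (homEquiv F E T.adjoint).1)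
    ?_ (norm_nonneg T) (fun A x => T.norm_ap_le x) A y
  intro A B x y
  exact T.inner_ap_left x y

lemma norm_adjoint (T : Hom E F) : ‖T.adjoint‖ = ‖T‖ :=
  le_antisymm T.norm_adjoint_le (by simpa using T.adjoint.norm_adjoint_le)

/-- Identity operator. -/
noncomputable def id (E : HMod C) : Hom E E :=
  Hom.mk (fun _ => LinearMap.id) (isOperator_of_pair (S := fun _ => LinearMap.id)
    (fun _ _ _ _ => rfl) 1 (fun A x => by simp))

/-- Composition of operators, in diagrammatic order. -/
noncomputable def comp (T : Hom E F) (S : Hom F G) : Hom E G :=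
  Hom.mk (fun A => (homEquiv F G S).1 A ∘ₗ (homEquiv E F T).1 A)
    (isOperator_of_pair
      (S := fun A => (homEquiv F E T.adjoint).1 A ∘ₗ (homEquiv G F S.adjoint).1 A)
      (fun A B x y => by
        change G.inner (S.ap (T.ap x)) y = E.inner x (T.adjoint.ap (S.adjoint.ap y))
        rw [inner_ap_left, inner_ap_left]) (‖S‖ * ‖T‖) (fun A x => by
        change ‖S.ap (T.ap x)‖ ≤ _
        refine (S.norm_ap_le _).trans ?_
        rw [mul_assoc]
        exact mul_le_mul_of_nonneg_left (T.norm_ap_le x) (norm_nonneg S)))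

@[simp] lemma id_ap {A : C} (x : E.obj A) : (id E).ap x = x := by simp [id]

@[simp] lemma comp_ap (T : Hom E F) (S : Hom F G) {A : C} (x : E.obj A) :
    (T.comp S).ap x = S.ap (T.ap x) := by
  rw [comp, mk_ap]; rfl

lemma norm_comp_le (T : Hom E F) (S : Hom F G) : ‖T.comp S‖ ≤ ‖T‖ * ‖S‖ := by
  refine norm_le (by positivity) fun A x => ?_
  rw [comp_ap]
  refine (S.norm_ap_le _).trans ?_
  rw [mul_comm ‖T‖, mul_assoc]
  exact mul_le_mul_of_nonneg_left (T.norm_ap_le x) (norm_nonneg S)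

lemma norm_sq (T : Hom E F) : ‖T‖ ^ 2 = ‖T.comp T.adjoint‖ := by
  refine le_antisymm ?_ ?_
  · have h : ‖T‖ ≤ Real.sqrt ‖T.comp T.adjoint‖ := by
      refine norm_le (Real.sqrt_nonneg _) fun A x => ?_
      refine le_of_sq_le_sq ?_ (by positivity)
      rw [mul_pow, Real.sq_sqrt (norm_nonneg _), F.norm_sq, inner_ap_left, ← comp_ap, sq,
        ← mul_assoc]
      refine (norm_inner_le _ _).trans ?_
      have := (T.comp T.adjoint).norm_ap_le x
      have := mul_le_mul_of_nonneg_left this (norm_nonneg x)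
      nlinarith
    calc ‖T‖ ^ 2 ≤ (Real.sqrt ‖T.comp T.adjoint‖) ^ 2 := by gcongr
      _ = _ := Real.sq_sqrt (norm_nonneg _)
  · refine (norm_comp_le _ _).trans ?_
    rw [norm_adjoint, sq]

instance : CompleteSpace (Hom E F) := by
  refine Metric.complete_of_cauchySeq_tendsto fun u hu => ?_
  have hb := cauchySeq_bdd hu
  have hpt : ∀ {E F : HMod C} (u : ℕ → Hom E F), CauchySeq u → ∀ (A : C) (x : E.obj A),
      ∃ z, Filter.Tendsto (fun n => (u n).ap x) Filter.atTop (nhds z) := by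
    intro E F u hu A x
    refine cauchySeq_tendsto_of_complete ?_
    rw [Metric.cauchySeq_iff'] at hu ⊢
    intro ε hε
    obtain ⟨N, hN⟩ := hu (ε / (‖x‖ + 1)) (by positivity)
    refine ⟨N, fun n hn => ?_⟩
    have h1 := hN n hn
    rw [dist_eq_norm, ← sub_ap]
    rw [dist_eq_norm, lt_div_iff₀ (by positivity)] at h1
    refine ((u n - u N).norm_ap_le x).trans_lt (lt_of_le_of_lt ?_ h1)
    exact mul_le_mul_of_nonneg_left (by linarith) (norm_nonneg _)
  have hu' : CauchySeq fun n => (u n).adjoint := by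
    rw [Metric.cauchySeq_iff'] at hu ⊢
    intro ε hε
    obtain ⟨N, hN⟩ := hu ε hε
    refine ⟨N, fun n hn => ?_⟩
    have : (u n).adjoint - (u N).adjoint = (u n - u N).adjoint := by
      refine eq_adjoint fun A B x y => ?_
      rw [sub_ap, sub_ap, HilbertModule.inner_sub_left, HilbertModule.inner_sub, inner_ap_left,
        inner_ap_left]
    rw [dist_eq_norm, this, norm_adjoint, ← dist_eq_norm]
    exact hN n hn
  choose L hL using hpt u hu
  choose M hM using hpt _ hu'
  obtain ⟨K, hK⟩ : ∃ K : ℝ, ∀ n, ‖u n‖ ≤ K := by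
    obtain ⟨R, _, hR⟩ := hb
    refine ⟨R + ‖u 0‖, fun n => ?_⟩
    have h1 := (hR n 0).le
    rw [dist_eq_norm] at h1
    have := norm_add_le (u n - u 0) (u 0)
    rw [sub_add_cancel] at this
    linarith
  have hadd : ∀ {E F : HMod C} (u : ℕ → Hom E F) (L : ∀ A, E.obj A → F.obj A)
      (hL : ∀ (A : C) (x : E.obj A),
        Filter.Tendsto (fun n => (u n).ap x) Filter.atTop (nhds (L A x))),
      ∃ T : LinFam E.toHilbertModule F.toHilbertModule, ∀ A x, T A x = L A x := by
    intro E F u L hL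
    refine ⟨fun A => ⟨⟨L A, fun x y => ?_⟩, fun c x => ?_⟩, fun A x => rfl⟩
    · refine tendsto_nhds_unique (hL A (x + y)) ?_
      simpa only [ap_add] using (hL A x).add (hL A y)
    · refine tendsto_nhds_unique (hL A (c • x)) ?_
      rw [RingHom.id_apply]
      simpa only [ap_smul] using (hL A x).const_smul c
  obtain ⟨T, hT⟩ := hadd u L hL
  obtain ⟨S, hS⟩ := hadd _ M hM
  have hop : IsOperator T := by
    refine isOperator_of_pair (S := S) ?_ K fun A x => ?_
    · intro A B x y
      rw [hT, hS]
      have h1 : Filter.Tendsto (fun n => F.inner ((u n).ap x) y) Filter.atTop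
          (nhds (F.inner (L A x) y)) :=
        ((cont_inner continuous_id continuous_const).tendsto (L A x)).comp (hL A x)
      have h2 : Filter.Tendsto (fun n => E.inner x ((u n).adjoint.ap y)) Filter.atTop
          (nhds (E.inner x (M B y))) :=
        ((cont_inner continuous_const continuous_id).tendsto (M B y)).comp (hM B y)
      simp only [← inner_ap_left] at h2
      exact tendsto_nhds_unique h1 h2
    · rw [hT]
      refine le_of_tendsto (hL A x).norm (Filter.Eventually.of_forall fun n => ?_)
      exact ((u n).norm_ap_le x).trans (mul_le_mul_of_nonneg_right (hK n) (norm_nonneg x))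
  refine ⟨Hom.mk T hop, ?_⟩
  rw [Metric.tendsto_atTop]
  intro ε hε
  rw [Metric.cauchySeq_iff] at hu
  obtain ⟨N, hN⟩ := hu (ε / 2) (by positivity)
  refine ⟨N, fun n hn => ?_⟩
  rw [dist_eq_norm]
  refine lt_of_le_of_lt (b := ε / 2) (norm_le (by positivity) fun A x => ?_) (by linarith)
  rw [sub_ap, mk_ap, hT]
  refine le_of_tendsto ((tendsto_const_nhds.sub (hL A x)).norm)
    (Filter.eventually_atTop.2 ⟨N, fun m hm => ?_⟩)
  rw [← sub_ap]
  refine ((u n - u m).norm_ap_le x).trans (mul_le_mul_of_nonneg_right ?_ (norm_nonneg x))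
  rw [← dist_eq_norm]
  exact (hN n hn m hm).le

lemma add_comp (T T' : Hom E F) (S : Hom F G) : (T + T').comp S = T.comp S + T'.comp S :=
  ext fun A x => by simp [ap_add]

lemma comp_add (T : Hom E F) (S S' : Hom F G) : T.comp (S + S') = T.comp S + T.comp S' :=
  ext fun A x => by simp

lemma smul_comp (c : ℂ) (T : Hom E F) (S : Hom F G) : (c • T).comp S = c • T.comp S :=
  ext fun A x => by simp [ap_smul]

lemma comp_smul (c : ℂ) (T : Hom E F) (S : Hom F G) : T.comp (c • S) = c • T.comp S :=
  ext fun A x => by simp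

lemma adjoint_comp (T : Hom E F) (S : Hom F G) :
    (T.comp S).adjoint = S.adjoint.comp T.adjoint :=
  (eq_adjoint fun A B x y => by
    rw [comp_ap, comp_ap, inner_ap_left, inner_ap_left]).symm

lemma adjoint_add (T S : Hom E F) : (T + S).adjoint = T.adjoint + S.adjoint :=
  (eq_adjoint fun A B x y => by
    rw [add_ap, add_ap, HilbertModule.inner_add_left, HilbertModule.inner_add, inner_ap_left,
      inner_ap_left]).symm

lemma adjoint_smul (c : ℂ) (T : Hom E F) : (c • T).adjoint = (starRingEnd ℂ c) • T.adjoint :=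
  (eq_adjoint fun A B x y => by
    rw [smul_ap, smul_ap, HilbertModule.inner_smul_left, HilbertModule.inner_smul,
      inner_ap_left]).symm

end Hom

noncomputable abbrev category : Category.{v} (HMod C) where
  Hom := Hom
  id := Hom.id
  comp := Hom.comp
  id_comp T := Hom.ext fun A x => by simp
  comp_id T := Hom.ext fun A x => by simp
  assoc T S R := Hom.ext fun A x => by simp

noncomputable abbrev banachStarCategory : BanachStarCategory.{v} (HMod C) where
  toCategory := category
  homGroup E F := inferInstanceAs (NormedAddCommGroup (Hom E F))
  homSpace E F := inferInstanceAs (NormedSpace ℂ (Hom E F))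
  homComplete E F := inferInstanceAs (CompleteSpace (Hom E F))
  add_comp := Hom.add_comp
  comp_add := Hom.comp_add
  smul_comp := Hom.smul_comp
  comp_smul := Hom.comp_smul
  norm_comp_le := Hom.norm_comp_le
  adj T := Hom.adjoint T
  adj_adj := Hom.adjoint_adjoint
  adj_comp := Hom.adjoint_comp
  adj_add := Hom.adjoint_add
  adj_smul := Hom.adjoint_smul
  norm_adj := Hom.norm_adjoint

end HMod

section Positivity

attribute [local instance] CStarAlgebra.spectralOrder CStarAlgebra.spectralOrderedRing

/-- A criterion for the positivity of a self-adjoint element. -/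
lemma exists_eq_star_mul_self {R : Type*} [CStarAlgebra R] {a : R} (ha : IsSelfAdjoint a)
    (h : ∀ m : R, IsSelfAdjoint m → (m * m) * a * (m * m) = -((m * m * m) * (m * m * m)) →
      m * m * m = 0) : ∃ k : R, a = star k * k := by
  have hn := CFC.negPart_nonneg a
  set m := CFC.sqrt a⁻ with hm
  have hmm : m * m = a⁻ := CFC.sqrt_mul_sqrt_self a⁻ hn
  have hsa : IsSelfAdjoint m := (CFC.sqrt_nonneg a⁻).isSelfAdjoint
  have e1 : a * a⁻ = -(a⁻ * a⁻) := by
    calc a * a⁻ = (a⁺ - a⁻) * a⁻ := by rw [CFC.posPart_sub_negPart a ha]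
      _ = _ := by rw [sub_mul, CFC.posPart_mul_negPart, zero_sub]
  have h0 : m * m * m = 0 := by
    refine h m hsa ?_
    rw [hmm, mul_assoc, e1]
    have : a⁻ * m * (a⁻ * m) = a⁻ * (a⁻ * a⁻) := by
      rw [← hmm]; noncomm_ring
    rw [this, mul_neg]
  have h1 : a⁻ * a⁻ = 0 := by
    rw [← hmm, ← mul_assoc, h0, zero_mul]
  have h2 : a⁻ = 0 := by
    have := CStarRing.norm_star_mul_self (x := a⁻)
    rw [hn.isSelfAdjoint.star_eq, h1, norm_zero] at this
    exact norm_eq_zero.1 (mul_self_eq_zero.1 this.symm)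
  have h3 : 0 ≤ a := by
    rw [← CFC.posPart_sub_negPart a ha, h2, sub_zero]
    exact CFC.posPart_nonneg a
  exact (CStarAlgebra.nonneg_iff_eq_star_mul_self).1 h3

end Positivity

namespace HMod

variable {C : Type u} [CStarCategory.{v} C]

attribute [local instance] banachStarCategory in
lemma adjoint_comp_pos {E F : HMod C} (T : Hom E F) :
    ∃ k : Hom E E, T.comp T.adjoint = k.comp k.adjoint := by
  let _ : CStarAlgebra (End E) := endCStarAlgebraOf E (fun f => Hom.norm_sq f)
  refine exists_eq_star_mul_self (R := End E) (a := T.comp T.adjoint) ?_ ?_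
  · change (T.comp T.adjoint).adjoint = T.comp T.adjoint
    rw [Hom.adjoint_comp, Hom.adjoint_adjoint]
  · intro m hm h
    have hm' : Hom.adjoint m = m := hm
    obtain ⟨S, hS⟩ : ∃ S : Hom E E, S = Hom.comp m m := ⟨_, rfl⟩
    have hS' : S.adjoint = S := by rw [hS, Hom.adjoint_comp, hm']
    obtain ⟨R, hR⟩ : ∃ R : Hom E E, R = Hom.comp m S := ⟨_, rfl⟩
    have hR' : R.adjoint = R := by
      rw [hR, Hom.adjoint_comp, hS', hm', hS]
      exact Hom.ext fun A x => by simp only [Hom.comp_ap]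
    have h' : S.comp ((T.comp T.adjoint).comp S) = -(R.comp R) := by
      rw [hS, hR, hS]; exact h
    suffices R = 0 by
      rw [hR, hS] at this; exact this
    refine Hom.ext fun A x => ?_
    rw [Hom.zero_ap]
    refine HilbertModule.eq_zero_of_inner_self ?_
    refine IsPos.eq_zero (E.inner_self_pos _) ?_
    have : F.inner (T.ap (S.ap x)) (T.ap (S.ap x)) = - E.inner (R.ap x) (R.ap x) := by
      have e1 : F.inner (T.ap (S.ap x)) (T.ap (S.ap x)) =
          E.inner x ((S.comp ((T.comp T.adjoint).comp S)).ap x) := by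
        rw [Hom.inner_ap_left, Hom.inner_ap_left, hS']
        simp only [Hom.comp_ap]
      have e2 : E.inner (R.ap x) (R.ap x) = E.inner x ((R.comp R).ap x) := by
        rw [Hom.inner_ap_left, hR', Hom.comp_ap]
      rw [e1, e2, h', Hom.neg_ap]
      exact (HilbertModule.innerL x).map_neg _
    rw [← this]
    exact F.inner_self_pos _

noncomputable instance : CStarCategory.{v} (HMod C) where
  toBanachStarCategory := banachStarCategory
  norm_sq := Hom.norm_sq
  adj_pos := adjoint_comp_pos

end HMod

/-- A (unital) C*-functor. -/
structure CStarFunctor (C : Type u) [CStarCategory.{v} C] (D : Type u₁) [CStarCategory.{v} D]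
    extends C ⥤ D where
  map_add : ∀ {A B : C} (f g : A ⟶ B), map (f + g) = map f + map g
  map_smul : ∀ {A B : C} (c : ℂ) (f : A ⟶ B), map (c • f) = c • map f
  map_adj : ∀ {A B : C} (f : A ⟶ B), map (adj f) = adj (map f)

namespace CStarFunctor

variable {C : Type u} [CStarCategory.{v} C] {D : Type u₁} [CStarCategory.{v} D]
  (f : CStarFunctor C D)

/-- `f` on morphisms, as a linear map. -/
def mapL (A B : C) : (A ⟶ B) →ₗ[ℂ] (f.obj A ⟶ f.obj B) where
  toFun h := f.map h
  map_add' := f.map_add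
  map_smul' := f.map_smul

@[simp] lemma map_zero {A B : C} : f.map (0 : A ⟶ B) = 0 := (f.mapL A B).map_zero

lemma map_sub {A B : C} (h k : A ⟶ B) : f.map (h - k) = f.map h - f.map k :=
  (f.mapL A B).map_sub h k

lemma map_sum {ι : Type*} {A B : C} (s : Finset ι) (h : ι → (A ⟶ B)) :
    f.map (∑ i ∈ s, h i) = ∑ i ∈ s, f.map (h i) := _root_.map_sum (f.mapL A B) h s

/-- The action of `f` on the endomorphisms of `A`. -/
def mapEnd (A : C) : End A →⋆ₙₐ[ℂ] End (f.obj A) where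
  toFun h := f.map h
  map_smul' := f.map_smul (A := A) (B := A)
  map_zero' := f.map_zero
  map_add' := f.map_add (A := A) (B := A)
  map_mul' h k := f.map_comp (X := A) (Y := A) (Z := A) k h
  map_star' := f.map_adj (A := A) (B := A)

lemma norm_map_le {A B : C} (h : A ⟶ B) : ‖f.map h‖ ≤ ‖h‖ := by
  refine le_of_sq_le_sq ?_ (norm_nonneg _)
  rw [CStarCategory.norm_sq, CStarCategory.norm_sq, ← f.map_adj, ← f.map_comp]
  exact NonUnitalStarAlgHom.norm_apply_le (A := End A) (B := End (f.obj A)) (f.mapEnd A) _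

lemma continuous_map {A B : C} : Continuous fun h : A ⟶ B => f.map h :=
  (LinearMap.mkContinuous (f.mapL A B) 1 fun h => by
    rw [one_mul]; exact f.norm_map_le h).continuous

lemma isPos_map {A : C} {a : A ⟶ A} (h : IsPos a) : IsPos (f.map a) := by
  obtain ⟨k, rfl⟩ := h
  exact ⟨f.map k, by rw [f.map_comp, f.map_adj]⟩

end CStarFunctor

namespace HMod

variable {C : Type u} [CStarCategory.{v} C] {E F G : HMod C}

/-- The value of a morphism of `H C` on an element. -/
noncomputable def ap (T : E ⟶ F) {A : C} (x : E.obj A) : F.obj A := Hom.ap T x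

lemma hom_ext {T T' : E ⟶ F} (h : ∀ (A : C) (x : E.obj A), ap T x = ap T' x) : T = T' :=
  Hom.ext h

lemma ap_mk (T : HilbertModule.LinFam E.toHilbertModule F.toHilbertModule)
    (h : HilbertModule.IsOperator T) {A : C} (x : E.obj A) :
    ap (Hom.mk T h : E ⟶ F) x = T A x := Hom.mk_ap T h x

@[simp] lemma id_ap {A : C} (x : E.obj A) : ap (𝟙 E) x = x := Hom.id_ap x
@[simp] lemma comp_ap (T : E ⟶ F) (S : F ⟶ G) {A : C} (x : E.obj A) :
    ap (T ≫ S) x = ap S (ap T x) := Hom.comp_ap T S x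
@[simp] lemma add_ap (T T' : E ⟶ F) {A : C} (x : E.obj A) :
    ap (T + T') x = ap T x + ap T' x := Hom.add_ap T T' x
@[simp] lemma sub_ap (T T' : E ⟶ F) {A : C} (x : E.obj A) :
    ap (T - T') x = ap T x - ap T' x := Hom.sub_ap T T' x
@[simp] lemma zero_ap {A : C} (x : E.obj A) : ap (0 : E ⟶ F) x = 0 := Hom.zero_ap x
@[simp] lemma smul_ap (c : ℂ) (T : E ⟶ F) {A : C} (x : E.obj A) :
    ap (c • T) x = c • ap T x := Hom.smul_ap c T x
lemma ap_add (T : E ⟶ F) {A : C} (x y : E.obj A) : ap T (x + y) = ap T x + ap T y :=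
  Hom.ap_add T x y
lemma ap_sub (T : E ⟶ F) {A : C} (x y : E.obj A) : ap T (x - y) = ap T x - ap T y :=
  Hom.ap_sub T x y
lemma ap_smul (T : E ⟶ F) (c : ℂ) {A : C} (x : E.obj A) : ap T (c • x) = c • ap T x :=
  Hom.ap_smul T c x
@[simp] lemma ap_zero (T : E ⟶ F) {A : C} : ap T (0 : E.obj A) = 0 := Hom.ap_zero T
lemma ap_act (T : E ⟶ F) {A B : C} (x : E.obj A) (f : B ⟶ A) :
    ap T (E.act x f) = F.act (ap T x) f := Hom.ap_act T x f
lemma inner_ap_left (T : E ⟶ F) {A B : C} (x : E.obj A) (y : F.obj B) :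
    F.inner (ap T x) y = E.inner x (ap (adj T) y) := Hom.inner_ap_left T x y
lemma inner_ap_right (T : E ⟶ F) {A B : C} (x : E.obj A) (y : F.obj B) :
    F.inner y (ap T x) = E.inner (ap (adj T) y) x := Hom.inner_ap_right T x y
lemma eq_adj {T : E ⟶ F} {S : F ⟶ E}
    (h : ∀ (A B : C) (x : E.obj A) (y : F.obj B), F.inner (ap T x) y = E.inner x (ap S y)) :
    S = adj T := Hom.eq_adjoint h
lemma norm_ap_le (T : E ⟶ F) {A : C} (x : E.obj A) : ‖ap T x‖ ≤ ‖T‖ * ‖x‖ := Hom.norm_ap_le T x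
lemma norm_le {T : E ⟶ F} {K : ℝ} (hK : 0 ≤ K)
    (h : ∀ (A : C) (x : E.obj A), ‖ap T x‖ ≤ K * ‖x‖) : ‖T‖ ≤ K := Hom.norm_le hK h

lemma sum_ap {ι : Type*} (r : Finset ι) (T : ι → (E ⟶ F)) {A : C} (x : E.obj A) :
    ap (∑ k ∈ r, T k) x = ∑ k ∈ r, ap (T k) x := by
  classical
  induction r using Finset.induction_on with
  | empty => simp
  | insert i r hi ih => rw [Finset.sum_insert hi, Finset.sum_insert hi, add_ap, ih]

lemma continuous_ap (T : E ⟶ F) {A : C} : Continuous fun x : E.obj A => ap T x :=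
  (LinearMap.mkContinuous ((homEquiv E F T).1 A) ‖T‖ fun x => norm_ap_le T x).continuous

end HMod

section Yoneda

variable {C : Type u} [CStarCategory.{v} C]

/-- The representable Hilbert module `Y_A(B) = C(B, A)`, with `⟨u, v⟩ = u* v`. -/
def yonedaModule (A : C) : HilbertModule C where
  obj B := B ⟶ A
  normedAddCommGroup B := inferInstance
  normedSpace B := inferInstance
  completeSpace B := inferInstance
  act x f := f ≫ x
  add_act x y f := comp_add f x y
  smul_act c x f := comp_smul c f x
  act_add x f g := add_comp f g x
  act_smul c x f := smul_comp c f x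
  act_id x := Category.id_comp x
  act_comp x f g := Category.assoc g f x
  inner u v := v ≫ adj u
  adj_inner u v := by rw [BanachStarCategory.adj_comp, adj_adj]
  inner_add u v w := add_comp v w (adj u)
  inner_smul c u v := smul_comp c v (adj u)
  inner_act u v f := Category.assoc f v (adj u)
  inner_self_pos u := CStarCategory.adj_pos u
  norm_sq u := CStarCategory.norm_sq u

lemma yonedaModule_generates (A : C) :
    (yonedaModule A).Generates (I := PUnit.{v + 1}) (s := fun _ => A) (fun _ => 𝟙 A) := by
  intro B x
  refine subset_closure (Submodule.subset_span ⟨PUnit.unit, x, ?_⟩)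
  exact (Category.comp_id (X := B) (Y := A) x).symm

/-- `Y_A` as an object of `H C`. -/
def Y (A : C) : HMod C where
  toHilbertModule := yonedaModule A
  small := ⟨PUnit, fun _ => A, fun _ => 𝟙 A, yonedaModule_generates A⟩

/-- A morphism `B ⟶ A` seen as an element of `Y_A(B)`. -/
def Y.elem {A B : C} (f : B ⟶ A) : (Y A).obj B := f

/-- An element of `Y_A(B)` seen as a morphism `B ⟶ A`. -/
def Y.arrow {A B : C} (f : (Y A).obj B) : B ⟶ A := f

/-- The operator `Y_A → E`, `f ↦ e f` that corresponds to an element `e` of `E(A)`; its adjoint is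
`x ↦ ⟨e, x⟩`. -/
noncomputable def hat (E : HMod C) {A : C} (e : E.obj A) : Y A ⟶ E :=
  HMod.Hom.mk (E := Y A) (F := E) (fun B => HilbertModule.actR (E := E.toHilbertModule) (B := B) e)
    (HilbertModule.isOperator_of_pair
      (S := fun B => HilbertModule.innerL (E := E.toHilbertModule) (A := B) e)
      (fun B B' f x => by
        change E.inner (E.act e f) x = E.inner e x ≫ adj f
        exact HilbertModule.inner_act_left _ _ _) ‖e‖ (fun B f => by
        change ‖E.act e f‖ ≤ ‖e‖ * ‖f‖
        rw [mul_comm]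
        exact HilbertModule.norm_act_le e f))

lemma hat_ap (E : HMod C) {A B : C} (e : E.obj A) (f : (Y A).obj B) :
    HMod.ap (hat E e) f = E.act e (Y.arrow f) := HMod.Hom.mk_ap _ _ _

lemma adj_hat_ap (E : HMod C) {A B : C} (e : E.obj A) (x : E.obj B) :
    HMod.ap (adj (hat E e)) x = Y.elem (E.inner e x) := by
  refine HilbertModule.ext_inner fun D y => ?_
  rw [← HMod.inner_ap_left, hat_ap]
  exact HilbertModule.inner_act_left _ _ _

lemma hat_add (E : HMod C) {A : C} (e e' : E.obj A) : hat E (e + e') = hat E e + hat E e' :=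
  HMod.hom_ext fun B f => by
    rw [HMod.add_ap, hat_ap, hat_ap, hat_ap, E.add_act]

lemma hat_smul (E : HMod C) {A : C} (c : ℂ) (e : E.obj A) : hat E (c • e) = c • hat E e :=
  HMod.hom_ext fun B f => by
    rw [HMod.smul_ap, hat_ap, hat_ap, E.smul_act]

/-- `e ↦ hat e` as a linear map. -/
noncomputable def hatL (E : HMod C) (A : C) : E.obj A →ₗ[ℂ] (Y A ⟶ E) where
  toFun e := hat E e
  map_add' := hat_add E
  map_smul' c e := hat_smul E c e

lemma hat_comp {E F : HMod C} {A : C} (e : E.obj A) (T : E ⟶ F) :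
    hat E e ≫ T = hat F (HMod.ap T e) :=
  HMod.hom_ext fun B f => by
    rw [HMod.comp_ap, hat_ap, hat_ap, HMod.ap_act]

lemma hat_one (E : HMod C) {A : C} (e : E.obj A) : HMod.ap (hat E e) (Y.elem (𝟙 A)) = e := by
  rw [hat_ap]; exact E.act_id e

/-- The Yoneda lemma. -/
lemma eq_hat {E : HMod C} {A : C} (T : Y A ⟶ E) : T = hat E (HMod.ap T (Y.elem (𝟙 A))) :=
  HMod.hom_ext fun B f => by
    rw [hat_ap, ← HMod.ap_act]
    congr 1
    exact (Category.comp_id (Y.arrow f)).symm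

lemma norm_hat_le (E : HMod C) {A : C} (e : E.obj A) : ‖hat E e‖ ≤ ‖e‖ :=
  HMod.norm_le (norm_nonneg e) fun B f => by
    rw [hat_ap, mul_comm]; exact HilbertModule.norm_act_le e (Y.arrow f)

/-- The Yoneda embedding on morphisms. -/
noncomputable def yonedaMap {A B : C} (f : A ⟶ B) : Y A ⟶ Y B := hat (Y B) (Y.elem f)

lemma yonedaMap_ap {A B D : C} (f : A ⟶ B) (g : (Y A).obj D) :
    HMod.ap (yonedaMap f) g = Y.elem (Y.arrow g ≫ f) := hat_ap _ _ _

lemma yonedaMap_hat (E : HMod C) {A B : C} (f : B ⟶ A) (e : E.obj A) :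
    yonedaMap f ≫ hat E e = hat E (E.act e f) := by
  rw [yonedaMap, hat_comp, hat_ap]; rfl

lemma hat_comp_adj_hat (E : HMod C) {A B : C} (e : E.obj A) (e' : E.obj B) :
    hat E e ≫ adj (hat E e') = yonedaMap (E.inner e' e) := by
  rw [hat_comp, adj_hat_ap, yonedaMap]

variable (C) in
/-- The Yoneda embedding. -/
noncomputable def yonedaF : CStarFunctor C (HMod C) where
  obj := Y
  map := yonedaMap
  map_id A := HMod.hom_ext fun B f => by
    rw [yonedaMap_ap, HMod.id_ap]
    exact Category.comp_id (Y.arrow f)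
  map_comp f g := HMod.hom_ext fun B h => by
    rw [HMod.comp_ap, yonedaMap_ap, yonedaMap_ap, yonedaMap_ap]
    exact (Category.assoc (Y.arrow h) f g).symm
  map_add f g := hat_add _ _ _
  map_smul c f := hat_smul _ _ _
  map_adj {A B} f := HMod.eq_adj fun D D' g h => by
    rw [yonedaMap_ap, yonedaMap_ap]
    change Y.arrow h ≫ adj (Y.arrow g ≫ f) = (Y.arrow h ≫ adj f) ≫ adj (Y.arrow g)
    rw [BanachStarCategory.adj_comp, Category.assoc]

/-- The inverse of the Yoneda embedding on morphisms. -/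
noncomputable def unY {A B : C} (T : Y A ⟶ Y B) : A ⟶ B := Y.arrow (HMod.ap T (Y.elem (𝟙 A)))

@[simp] lemma yonedaMap_unY {A B : C} (T : Y A ⟶ Y B) : yonedaMap (unY T) = T := (eq_hat T).symm

@[simp] lemma unY_yonedaMap {A B : C} (f : A ⟶ B) : unY (yonedaMap f) = f := by
  rw [unY, yonedaMap_ap]
  exact Category.id_comp f

lemma yonedaMap_injective {A B : C} {f g : A ⟶ B} (h : yonedaMap f = yonedaMap g) : f = g := by
  rw [← unY_yonedaMap f, h, unY_yonedaMap]

lemma norm_yonedaMap {A B : C} (f : A ⟶ B) : ‖yonedaMap f‖ = ‖f‖ := by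
  refine le_antisymm ((yonedaF C).norm_map_le f) ?_
  have h1 : ‖𝟙 A‖ ≤ 1 := by
    have := CStarCategory.norm_sq (𝟙 A)
    rw [adj_id, Category.comp_id] at this
    nlinarith [norm_nonneg (𝟙 A)]
  have h2 := HMod.norm_ap_le (yonedaMap f) (Y.elem (𝟙 A))
  rw [yonedaMap_ap] at h2
  have h3 : ‖f‖ ≤ ‖yonedaMap f‖ * ‖𝟙 A‖ := by
    have : Y.arrow (Y.elem (𝟙 A)) ≫ f = f := Category.id_comp f
    rw [this] at h2
    exact h2
  nlinarith [norm_nonneg (yonedaMap f)]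

lemma norm_hat (E : HMod C) {A : C} (e : E.obj A) : ‖hat E e‖ = ‖e‖ := by
  refine (sq_eq_sq₀ (norm_nonneg _) (norm_nonneg _)).1 ?_
  rw [CStarCategory.norm_sq, hat_comp_adj_hat, norm_yonedaMap, ← E.norm_sq]

end Yoneda

section Restriction

variable {C : Type u} [CStarCategory.{v} C]

/-- The restriction of a Hilbert module over `H C` along the Yoneda embedding. -/
noncomputable def restrModule (V : HMod (HMod C)) : HilbertModule C where
  obj A := V.obj (Y A)
  normedAddCommGroup A := inferInstance
  normedSpace A := inferInstance
  completeSpace A := inferInstance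
  act x f := V.act x (yonedaMap f)
  add_act x y f := V.add_act x y _
  smul_act c x f := V.smul_act c x _
  act_add x f g := by rw [← V.act_add]; exact congrArg _ ((yonedaF C).map_add f g)
  act_smul c x f := by rw [← V.act_smul]; exact congrArg _ ((yonedaF C).map_smul c f)
  act_id {A} x := (congrArg (V.act x) ((yonedaF C).map_id A)).trans (V.act_id x)
  act_comp x f g := (congrArg (V.act x) ((yonedaF C).map_comp g f)).trans (V.act_comp x _ _)
  inner y x := unY (V.inner y x)
  adj_inner y x := yonedaMap_injective (by
    rw [yonedaMap_unY, ← V.adj_inner y x]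
    refine ((yonedaF C).map_adj _).trans ?_
    exact congrArg adj (yonedaMap_unY _))
  inner_add y x x' := yonedaMap_injective (by
    refine ((yonedaMap_unY _).trans ?_).trans ((yonedaF C).map_add _ _).symm
    refine (V.inner_add y x x').trans ?_
    exact congrArg₂ _ (yonedaMap_unY _).symm (yonedaMap_unY _).symm)
  inner_smul c y x := yonedaMap_injective (by
    refine ((yonedaMap_unY _).trans ?_).trans ((yonedaF C).map_smul _ _).symm
    refine (V.inner_smul c y x).trans ?_
    exact congrArg _ (yonedaMap_unY _).symm)
  inner_act y x f := yonedaMap_injective (by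
    refine ((yonedaMap_unY _).trans ?_).trans ((yonedaF C).map_comp _ _).symm
    refine (V.inner_act y x _).trans ?_
    exact congrArg _ (yonedaMap_unY _).symm)
  inner_self_pos x := by
    obtain ⟨k, hk⟩ := V.inner_self_pos x
    refine ⟨unY k, yonedaMap_injective ?_⟩
    rw [yonedaMap_unY, hk]
    refine Eq.symm (((yonedaF C).map_comp _ _).trans ?_)
    refine congrArg₂ _ (yonedaMap_unY _) (((yonedaF C).map_adj _).trans ?_)
    exact congrArg adj (yonedaMap_unY _)
  norm_sq x := (V.norm_sq x).trans (by
    rw [← norm_yonedaMap (unY (V.inner x x)), yonedaMap_unY])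

lemma restrModule_generates (V : HMod (HMod C)) {I : Type*} {s : I → HMod C}
    {x : ∀ i, V.obj (s i)} (hx : V.Generates x) {J : I → Type*} {t : ∀ i, J i → C}
    {g : ∀ i j, (s i).obj (t i j)} (hg : ∀ i, (s i).Generates (g i)) :
    (restrModule V).Generates (I := Σ i, J i) (s := fun p => t p.1 p.2)
      (fun p => V.act (x p.1) (hat (s p.1) (g p.1 p.2))) := by
  intro A
  set W := Submodule.span ℂ {y : V.obj (Y A) | ∃ (p : Σ i, J i) (f : A ⟶ t p.1 p.2),
    y = V.act (V.act (x p.1) (hat (s p.1) (g p.1 p.2))) (yonedaMap f)} with hW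
  have key : ∀ (i : I) (e : (s i).obj A), V.act (x i) (hat (s i) e) ∈ W.topologicalClosure := by
    intro i e
    have hc : Continuous fun e : (s i).obj A => V.act (x i) (hat (s i) e) := by
      refine (HilbertModule.continuous_actR (E := V.toHilbertModule) (x i)).comp ?_
      exact (LinearMap.mkContinuous (hatL (s i) A) 1 fun e => by
        rw [one_mul]; exact norm_hat_le (s i) e).continuous
    have hcl : IsClosed {e : (s i).obj A | V.act (x i) (hat (s i) e) ∈ W.topologicalClosure} :=
      W.isClosed_topologicalClosure.preimage hc
    refine hcl.closure_subset_iff.2 ?_ (hg i A e)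
    intro e he
    change V.act (x i) (hat (s i) e) ∈ W.topologicalClosure
    induction he using Submodule.span_induction with
    | mem y hy =>
      obtain ⟨j, f, rfl⟩ := hy
      refine W.le_topologicalClosure (Submodule.subset_span ⟨⟨i, j⟩, f, ?_⟩)
      rw [← V.act_comp, yonedaMap_hat]
    | zero =>
      have : hat (s i) (0 : (s i).obj A) = 0 := by
        have := hat_smul (s i) (0 : ℂ) (0 : (s i).obj A)
        rwa [zero_smul, zero_smul] at this
      rw [this]
      have h0 := V.act_smul (0 : ℂ) (x i) (0 : Y A ⟶ s i)
      rw [zero_smul, zero_smul] at h0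
      rw [h0]
      exact Submodule.zero_mem _
    | add y z _ _ hy hz =>
      rw [hat_add, V.act_add]
      exact Submodule.add_mem _ hy hz
    | smul c y _ hy =>
      rw [hat_smul, V.act_smul]
      exact Submodule.smul_mem _ c hy
  have h2 : Submodule.span ℂ {y : V.obj (Y A) | ∃ (i : I) (f : Y A ⟶ s i), y = V.act (x i) f} ≤
      W.topologicalClosure := by
    rw [Submodule.span_le]
    rintro y ⟨i, f, rfl⟩
    rw [eq_hat f]
    exact key i _
  intro y
  exact closure_minimal h2 W.isClosed_topologicalClosure (hx (Y A) y)

/-- The restriction of a small Hilbert module over `H C` along the Yoneda embedding. -/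
noncomputable def restr (V : HMod (HMod C)) : HMod C where
  toHilbertModule := restrModule V
  small := by
    obtain ⟨I, s, x, hx⟩ := V.small
    choose J t g hg using fun i => (s i).small
    exact ⟨_, _, _, restrModule_generates V hx hg⟩

/-- An element of `V(Y_A)` seen as an element of the restriction of `V`. -/
def restr.elem {V : HMod (HMod C)} {A : C} (x : V.obj (Y A)) : (restr V).obj A := x

/-- An element of the restriction of `V` over `A` seen as an element of `V(Y_A)`. -/
def restr.val {V : HMod (HMod C)} {A : C} (x : (restr V).obj A) : V.obj (Y A) := x

/-- The restriction of an operator along the Yoneda embedding. -/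
noncomputable def restrMap {V W : HMod (HMod C)} (T : V ⟶ W) : restr V ⟶ restr W :=
  HMod.Hom.mk (E := restr V) (F := restr W)
    (fun A => (HMod.homEquiv V W T).1 (Y A))
    (HilbertModule.isOperator_of_pair (S := fun A => (HMod.homEquiv W V (adj T)).1 (Y A))
      (fun _ _ x y => congrArg unY (HMod.inner_ap_left T (restr.val x) (restr.val y)))
      ‖T‖ (fun _ x => HMod.norm_ap_le T (restr.val x)))

lemma restrMap_ap {V W : HMod (HMod C)} (T : V ⟶ W) {A : C} (x : (restr V).obj A) :
    HMod.ap (restrMap T) x = restr.elem (HMod.ap T (restr.val x)) := HMod.ap_mk _ _ _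

variable (C) in
/-- The restriction functor `R : H (H C) → H C`. -/
noncomputable def restrF : CStarFunctor (HMod (HMod C)) (HMod C) where
  obj := restr
  map := restrMap
  map_id V := HMod.hom_ext fun A x => by
    rw [restrMap_ap, HMod.id_ap, HMod.id_ap]; rfl
  map_comp T S := HMod.hom_ext fun A x => by
    rw [HMod.comp_ap, restrMap_ap, restrMap_ap, restrMap_ap, HMod.comp_ap]; rfl
  map_add T S := HMod.hom_ext fun A x => by
    rw [HMod.add_ap, restrMap_ap, restrMap_ap, restrMap_ap, HMod.add_ap]; rfl
  map_smul c T := HMod.hom_ext fun A x => by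
    rw [HMod.smul_ap, restrMap_ap, restrMap_ap, HMod.smul_ap]; rfl
  map_adj T := HMod.eq_adj fun A B x y => by
    rw [restrMap_ap, restrMap_ap]
    exact congrArg unY (HMod.inner_ap_left T (restr.val x) (restr.val y))

/-- The canonical isomorphism from `E` to the restriction of `Y_E`; it sends `e ∈ E(A)` to
the operator `Y_A → E` that corresponds to `e`. -/
noncomputable def restrUnit (E : HMod C) : E ⟶ restr (Y E) :=
  HMod.Hom.mk (E := E) (F := restr (Y E))
    (fun A => ⟨⟨fun e => restr.elem (Y.elem (hat E e)), hat_add E⟩, hat_smul E⟩)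
    (HilbertModule.isOperator_of_pair
      (S := fun A => ⟨⟨fun T => HMod.ap (Y.arrow (restr.val T)) (Y.elem (𝟙 A)),
        fun T T' => HMod.add_ap _ _ _⟩, fun c T => HMod.smul_ap _ _ _⟩)
      (fun A B e T => by
        change unY (Y.arrow (restr.val T) ≫ adj (hat E e)) = E.inner e (HMod.ap _ _)
        rw [eq_hat (Y.arrow (restr.val T)), hat_comp_adj_hat, unY_yonedaMap, hat_one])
      1 (fun A e => by
        rw [one_mul]
        exact norm_hat_le E e))

lemma restrUnit_ap (E : HMod C) {A : C} (e : E.obj A) :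
    HMod.ap (restrUnit E) e = restr.elem (Y.elem (hat E e)) := HMod.ap_mk _ _ _

lemma adj_restrUnit_ap (E : HMod C) {A : C} (T : (restr (Y E)).obj A) :
    HMod.ap (adj (restrUnit E)) T = HMod.ap (Y.arrow (restr.val T)) (Y.elem (𝟙 A)) := by
  refine HilbertModule.ext_inner fun B e => ?_
  rw [← HMod.inner_ap_left, restrUnit_ap]
  change unY (Y.arrow (restr.val T) ≫ adj (hat E e)) = E.inner e (HMod.ap _ _)
  rw [eq_hat (Y.arrow (restr.val T)), hat_comp_adj_hat, unY_yonedaMap, hat_one]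

lemma restrUnit_isUnitary (E : HMod C) : IsUnitary (restrUnit E) where
  comp_adj := HMod.hom_ext fun A e => by
    rw [HMod.comp_ap, restrUnit_ap, adj_restrUnit_ap, HMod.id_ap]
    exact hat_one E e
  adj_comp := HMod.hom_ext fun A T => by
    rw [HMod.comp_ap, restrUnit_ap, adj_restrUnit_ap, HMod.id_ap, ← eq_hat]
    rfl

lemma restrUnit_natural {E F : HMod C} (T : E ⟶ F) :
    T ≫ restrUnit F = restrUnit E ≫ restrMap (yonedaMap T) :=
  HMod.hom_ext fun A e => by
    rw [HMod.comp_ap, HMod.comp_ap, restrUnit_ap, restrUnit_ap, restrMap_ap]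
    change _ = restr.elem (HMod.ap (yonedaMap T) (Y.elem (hat E e)))
    rw [yonedaMap_ap, ← hat_comp]
    rfl

end Restriction

section Gram

section Algebra

attribute [local instance] CStarAlgebra.spectralOrder CStarAlgebra.spectralOrderedRing

/-- Approximate square roots of the inverse of a positive element. -/
lemma exists_approx_inv {R : Type*} [CStarAlgebra R] {K : R} (hK : 0 ≤ K) {ε : ℝ} (hε : 0 < ε) :
    ∃ S : R, star S = S ∧ star (1 - S * K * S) = 1 - S * K * S ∧
      ‖(1 - S * K * S) * K * (1 - S * K * S)‖ ≤ ε := by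
  have hsp : ∀ t ∈ spectrum ℝ K, 0 ≤ t := fun t ht => spectrum_nonneg_of_nonneg hK ht
  have hsa : IsSelfAdjoint K := hK.isSelfAdjoint
  have hc1 : ContinuousOn (fun t : ℝ => (Real.sqrt (t + ε))⁻¹) (spectrum ℝ K) := by
    refine ContinuousOn.inv₀ (by fun_prop) fun t ht => ?_
    have := hsp t ht
    exact (Real.sqrt_pos.2 (by linarith)).ne'
  have hc2 : ContinuousOn (fun t : ℝ => ε / (t + ε)) (spectrum ℝ K) := by
    refine ContinuousOn.div (by fun_prop) (by fun_prop) fun t ht => ?_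
    have := hsp t ht
    linarith
  set S : R := cfc (fun t : ℝ => (Real.sqrt (t + ε))⁻¹) K with hS
  have hM : 1 - S * K * S = cfc (fun t : ℝ => ε / (t + ε)) K := by
    have e1 : S * K * S = cfc (fun t : ℝ => (Real.sqrt (t + ε))⁻¹ * t * (Real.sqrt (t + ε))⁻¹) K := by
      conv_lhs => rw [hS]; enter [1, 2]; rw [← cfc_id' ℝ K]
      rw [← cfc_mul _ _ K, ← cfc_mul _ _ K]
    rw [e1, ← cfc_one ℝ K, ← cfc_sub _ _ K]
    refine cfc_congr fun t ht => ?_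
    have h0 := hsp t ht
    have h1 : 0 < t + ε := by linarith
    have h2 : (Real.sqrt (t + ε))⁻¹ * (Real.sqrt (t + ε))⁻¹ = (t + ε)⁻¹ := by
      rw [← mul_inv, Real.mul_self_sqrt h1.le]
    simp only [Pi.one_apply]
    rw [mul_right_comm, h2]
    field_simp
    ring
  refine ⟨S, (cfc_predicate _ K : IsSelfAdjoint S).star_eq, ?_, ?_⟩
  · rw [hM]
    exact (cfc_predicate _ K : IsSelfAdjoint _).star_eq
  · have e2 : (1 - S * K * S) * K * (1 - S * K * S)
        = cfc (fun t : ℝ => ε / (t + ε) * t * (ε / (t + ε))) K := by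
      rw [hM]
      conv_lhs => enter [1, 2]; rw [← cfc_id' ℝ K]
      rw [← cfc_mul _ _ K, ← cfc_mul _ _ K]
    rw [e2]
    refine norm_cfc_le hε.le fun t ht => ?_
    have h0 := hsp t ht
    have h1 : 0 < t + ε := by linarith
    rw [Real.norm_of_nonneg (by positivity), div_mul_eq_mul_div, div_mul_div_comm,
      div_le_iff₀ (by positivity)]
    nlinarith [mul_nonneg h0 hε.le, sq_nonneg t, mul_nonneg hε.le (sq_nonneg t), pow_pos hε 3, mul_nonneg h0 (sq_nonneg ε)]

end Algebra

variable {C : Type u} [CStarCategory.{v} C]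

/-- The Gram matrix of a finite family of elements of a Hilbert module is a limit of matrices of
the form `b* b`. -/
lemma gram_approx (E : HMod C) {ι : Type*} (r : Finset ι) {s : ι → C} (g : ∀ i, E.obj (s i)) :
    ∃ b : ℕ → ∀ k i : ι, (s i ⟶ s k), ∀ i ∈ r, ∀ j ∈ r,
      Filter.Tendsto (fun n => ∑ k ∈ r, b n k j ≫ adj (b n k i)) Filter.atTop
        (nhds (E.inner (g i) (g j))) := by
  classical
  obtain ⟨K, hK⟩ : ∃ K : E ⟶ E, K = ∑ k ∈ r, adj (hat E (g k)) ≫ hat E (g k) := ⟨_, rfl⟩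
  have hterm : ∀ k, IsPos (adj (hat E (g k)) ≫ hat E (g k)) := fun k => by
    have := isPos_comp_adj (adj (hat E (g k)))
    rwa [adj_adj] at this
  have hKpos : IsPos K := by
    rw [hK]; exact IsPos.sum r fun k _ => hterm k
  have hex : ∀ n : ℕ, ∃ S : E ⟶ E, adj S = S ∧ adj (𝟙 E - S ≫ K ≫ S) = 𝟙 E - S ≫ K ≫ S ∧
      ‖(𝟙 E - S ≫ K ≫ S) ≫ K ≫ (𝟙 E - S ≫ K ≫ S)‖ ≤ 1 / ((n : ℝ) + 1) := fun n =>
    exists_approx_inv (R := End E) ((isPos_iff K).1 hKpos) (by positivity)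
  choose S hS hM hle using hex
  refine ⟨fun n k i => E.inner (g k) (HMod.ap (S n) (g i)), fun i hi j hj => ?_⟩
  obtain ⟨M, hMdef⟩ : ∃ M : ℕ → (E ⟶ E), ∀ n, M n = 𝟙 E - S n ≫ K ≫ S n := ⟨_, fun _ => rfl⟩
  simp only [← hMdef] at hM hle
  have hKap : ∀ {A : C} (x : E.obj A), HMod.ap K x = ∑ k ∈ r, E.act (g k) (E.inner (g k) x) := by
    intro A x
    rw [hK, HMod.sum_ap]
    refine Finset.sum_congr rfl fun k _ => ?_
    rw [HMod.comp_ap, adj_hat_ap, hat_ap]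
    rfl
  have hMx : ∀ n, ‖HMod.ap (M n) (g j)‖ ^ 2 ≤ 1 / ((n : ℝ) + 1) := by
    intro n
    refine le_trans ?_ (hle n)
    rw [← norm_hat, ← hat_comp, ← norm_adj, CStarCategory.norm_sq, BanachStarCategory.adj_comp,
      BanachStarCategory.adj_comp, adj_adj, adj_adj, hM n]
    have h1 := ((hterm j).conj (M n))
    have h2 : IsPos (K - adj (hat E (g j)) ≫ hat E (g j)) := by
      rw [hK, ← Finset.add_sum_erase r _ hj, add_sub_cancel_left]
      exact IsPos.sum _ fun k _ => hterm k
    have h3 := h2.conj (M n)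
    rw [hM n, sub_comp', comp_sub'] at h3
    rw [hM n] at h1
    simpa only [Category.assoc] using h1.norm_le h3
  have hdiff : ∀ n, E.inner (g i) (g j) - ∑ k ∈ r, E.inner (g k) (HMod.ap (S n) (g j)) ≫
      adj (E.inner (g k) (HMod.ap (S n) (g i))) = E.inner (g i) (HMod.ap (M n) (g j)) := by
    intro n
    rw [hMdef, HMod.sub_ap, HilbertModule.inner_sub, HMod.id_ap, HMod.comp_ap, HMod.comp_ap, hKap,
      HMod.inner_ap_right, hS, HilbertModule.inner_sum]
    congr 1
    refine Finset.sum_congr rfl fun k _ => ?_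
    rw [E.inner_act, E.adj_inner]
  rw [tendsto_iff_norm_sub_tendsto_zero]
  have hlim : Filter.Tendsto (fun n : ℕ => ‖g i‖ * Real.sqrt (1 / ((n : ℝ) + 1))) Filter.atTop
      (nhds 0) := by
    have h := (Real.continuous_sqrt.tendsto 0).comp
      (tendsto_one_div_add_atTop_nhds_zero_nat (𝕜 := ℝ))
    rw [Real.sqrt_zero] at h
    simpa using h.const_mul ‖g i‖
  refine squeeze_zero (fun n => norm_nonneg _) (fun n => ?_) hlim
  rw [norm_sub_rev, hdiff]
  refine (HilbertModule.norm_inner_le _ _).trans ?_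
  exact mul_le_mul_of_nonneg_left (Real.le_sqrt_of_sq_le (hMx n)) (norm_nonneg _)

/-- The Gram matrix of a finite family of elements of a Hilbert module stays positive under
C*-functors. -/
lemma isPos_gram {D : Type u₁} [CStarCategory.{v} D] (f : CStarFunctor C D) (E : HMod C)
    {ι : Type*} (r : Finset ι) {s : ι → C} (g : ∀ i, E.obj (s i)) {B : D}
    (p : ∀ i, B ⟶ f.obj (s i)) :
    IsPos (∑ i ∈ r, ∑ j ∈ r, p j ≫ f.map (E.inner (g i) (g j)) ≫ adj (p i)) := by
  obtain ⟨b, hb⟩ := gram_approx E r g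
  have hlim : Filter.Tendsto (fun n => ∑ i ∈ r, ∑ j ∈ r,
      p j ≫ f.map (∑ k ∈ r, b n k j ≫ adj (b n k i)) ≫ adj (p i)) Filter.atTop
      (nhds (∑ i ∈ r, ∑ j ∈ r, p j ≫ f.map (E.inner (g i) (g j)) ≫ adj (p i))) := by
    refine tendsto_finsetSum _ fun i hi => tendsto_finsetSum _ fun j hj => ?_
    have hc : Continuous fun h : s j ⟶ s i => p j ≫ f.map h ≫ adj (p i) :=
      cont_comp continuous_const (cont_comp f.continuous_map continuous_const)
    exact (hc.tendsto _).comp (hb i hi j hj)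
  refine (isClosed_isPos B).mem_of_tendsto hlim (Filter.Eventually.of_forall fun n => ?_)
  have e : ∑ i ∈ r, ∑ j ∈ r, p j ≫ f.map (∑ k ∈ r, b n k j ≫ adj (b n k i)) ≫ adj (p i) =
      ∑ k ∈ r, (∑ j ∈ r, p j ≫ f.map (b n k j)) ≫ adj (∑ j ∈ r, p j ≫ f.map (b n k j)) := by
    simp only [f.map_sum, f.map_comp, f.map_adj, sum_comp', comp_sum', adj_sum',
      BanachStarCategory.adj_comp, Category.assoc]
    symm
    rw [Finset.sum_comm]
    refine Finset.sum_congr rfl fun i _ => ?_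
    rw [Finset.sum_comm]
  change IsPos _
  rw [e]
  exact IsPos.sum _ fun k _ => isPos_comp_adj _

end Gram

section Extension

variable {C : Type u} [CStarCategory.{v} C] {D : Type u₁} [CStarCategory.{v} D]

namespace ExtPre

variable (f : CStarFunctor C D) (E : HMod C) {I : Type v} {s : I → C} (g : ∀ i, E.obj (s i))

open Classical in
/-- The scalar product `⟨∑ g_i ⊗ y_i, ∑ g_j ⊗ x_j⟩ = ∑ y_i* f(⟨g_i, g_j⟩) x_j`. -/
noncomputable def inner {A B : D} (y : Π₀ i, (B ⟶ f.obj (s i))) (x : Π₀ i, (A ⟶ f.obj (s i))) :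
    A ⟶ B :=
  ∑ i ∈ y.support, ∑ j ∈ x.support, x j ≫ f.map (E.inner (g i) (g j)) ≫ adj (y i)

lemma inner_eq {A B : D} (y : Π₀ i, (B ⟶ f.obj (s i))) (x : Π₀ i, (A ⟶ f.obj (s i)))
    (r : Finset I) (hy : ∀ i ∉ r, y i = 0) (hx : ∀ i ∉ r, x i = 0) :
    inner f E g y x = ∑ i ∈ r, ∑ j ∈ r, x j ≫ f.map (E.inner (g i) (g j)) ≫ adj (y i) := by
  classical
  unfold inner
  have hy' : y.support ⊆ r := fun i hi => by
    by_contra h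
    exact (DFinsupp.mem_support_iff.1 hi) (hy i h)
  have hx' : x.support ⊆ r := fun i hi => by
    by_contra h
    exact (DFinsupp.mem_support_iff.1 hi) (hx i h)
  have e1 : ∀ i, ∑ j ∈ x.support, x j ≫ f.map (E.inner (g i) (g j)) ≫ adj (y i) =
      ∑ j ∈ r, x j ≫ f.map (E.inner (g i) (g j)) ≫ adj (y i) := fun i =>
    Finset.sum_subset hx' fun j _ hj => by
      rw [DFinsupp.notMem_support_iff.1 hj, zero_comp']
  convert Finset.sum_subset hy' fun i _ hi => ?_ using 1
  · exact Finset.sum_congr (by congr!) fun i _ => (e1 i).symm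
  · refine Finset.sum_eq_zero fun j _ => ?_
    rw [DFinsupp.notMem_support_iff.1 hi, adj_zero', comp_zero', comp_zero']

lemma exists_supp {A : D} (x : Π₀ i, (A ⟶ f.obj (s i))) : ∃ r : Finset I, ∀ i ∉ r, x i = 0 := by
  classical
  exact ⟨x.support, fun i hi => DFinsupp.notMem_support_iff.1 hi⟩

lemma exists_supp₂ {A B : D} (x : Π₀ i, (A ⟶ f.obj (s i))) (y : Π₀ i, (B ⟶ f.obj (s i))) :
    ∃ r : Finset I, (∀ i ∉ r, x i = 0) ∧ (∀ i ∉ r, y i = 0) := by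
  classical
  obtain ⟨r, hr⟩ := exists_supp f x
  obtain ⟨q, hq⟩ := exists_supp f y
  exact ⟨r ∪ q, fun i hi => hr i fun h => hi (Finset.mem_union_left _ h),
    fun i hi => hq i fun h => hi (Finset.mem_union_right _ h)⟩

lemma exists_supp₃ {A B A' : D} (x : Π₀ i, (A ⟶ f.obj (s i))) (y : Π₀ i, (B ⟶ f.obj (s i)))
    (z : Π₀ i, (A' ⟶ f.obj (s i))) :
    ∃ r : Finset I, (∀ i ∉ r, x i = 0) ∧ (∀ i ∉ r, y i = 0) ∧ (∀ i ∉ r, z i = 0) := by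
  classical
  obtain ⟨r, hr, hr'⟩ := exists_supp₂ f x y
  obtain ⟨q, hq⟩ := exists_supp f z
  exact ⟨r ∪ q, fun i hi => hr i fun h => hi (Finset.mem_union_left _ h),
    fun i hi => hr' i fun h => hi (Finset.mem_union_left _ h),
    fun i hi => hq i fun h => hi (Finset.mem_union_right _ h)⟩

/-- The action `(∑ g_i ⊗ x_i) d = ∑ g_i ⊗ (x_i d)`. -/
def act {A B : D} (x : Π₀ i, (A ⟶ f.obj (s i))) (d : B ⟶ A) : Π₀ i, (B ⟶ f.obj (s i)) :=
  DFinsupp.mapRange (fun _ p => d ≫ p) (fun _ => comp_zero' d) x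

@[simp] lemma act_apply {A B : D} (x : Π₀ i, (A ⟶ f.obj (s i))) (d : B ⟶ A) (i : I) :
    act f x d i = d ≫ x i := DFinsupp.mapRange_apply _ _ _ _

/-- The algebraic extension of scalars of `E` along `f`: it consists of the formal finite sums
`∑ g_i ⊗ x_i` with `x_i : B ⟶ f(s_i)`. -/
noncomputable def module : PreHilbertModule D where
  obj B := Π₀ i, (B ⟶ f.obj (s i))
  addCommGroup B := inferInstance
  module B := inferInstance
  act x d := act f x d
  add_act x y d := DFinsupp.ext fun i => by simp [comp_add]
  smul_act c x d := DFinsupp.ext fun i => by simp [comp_smul]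
  act_add x d e := DFinsupp.ext fun i => by simp [add_comp]
  act_smul c x d := DFinsupp.ext fun i => by simp [smul_comp]
  act_id x := DFinsupp.ext fun i => by simp
  act_comp x d e := DFinsupp.ext fun i => by simp
  inner y x := inner f E g y x
  adj_inner y x := by
    obtain ⟨r, hy, hx⟩ := exists_supp₂ f y x
    rw [inner_eq f E g y x r hy hx, inner_eq f E g x y r hx hy, adj_sum', Finset.sum_comm]
    simp only [adj_sum', BanachStarCategory.adj_comp, adj_adj, Category.assoc, ← f.map_adj,
      E.adj_inner]
  inner_add y x x' := by
    obtain ⟨r, hy, hx, hx'⟩ := exists_supp₃ f y x x'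
    rw [inner_eq f E g y x r hy hx, inner_eq f E g y x' r hy hx',
      inner_eq f E g y (x + x') r hy fun i hi => by simp [hx i hi, hx' i hi]]
    simp only [← Finset.sum_add_distrib, DFinsupp.add_apply, add_comp]
  inner_smul c y x := by
    obtain ⟨r, hy, hx⟩ := exists_supp₂ f y x
    rw [inner_eq f E g y x r hy hx, inner_eq f E g y (c • x) r hy fun i hi => by simp [hx i hi]]
    simp only [Finset.smul_sum, DFinsupp.smul_apply, smul_comp]
  inner_act y x d := by
    obtain ⟨r, hy, hx⟩ := exists_supp₂ f y x
    rw [inner_eq f E g y x r hy hx, inner_eq f E g y (act f x d) r hy fun i hi => by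
      simp [hx i hi]]
    simp only [comp_sum', act_apply, Category.assoc]
  inner_self_pos x := by
    obtain ⟨r, hx⟩ := exists_supp f x
    rw [inner_eq f E g x x r hx hx]
    exact isPos_gram f E r g x

/-- The canonical map from the algebraic extension of scalars to its completion. -/
noncomputable def toC (A : D) :
    (Π₀ i, (A ⟶ f.obj (s i))) →ₗ[ℂ] (module f E g).completion.obj A :=
  (module f E g).toCompletion (A := A)

lemma inner_toC {A B : D} (y : Π₀ i, (B ⟶ f.obj (s i))) (x : Π₀ i, (A ⟶ f.obj (s i))) :
    (module f E g).completion.inner (toC f E g B y) (toC f E g A x) = inner f E g y x :=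
  (module f E g).inner_toCompletion (A := A) (B := B) y x

lemma act_toC {A B : D} (x : Π₀ i, (A ⟶ f.obj (s i))) (d : B ⟶ A) :
    (module f E g).completion.act (toC f E g A x) d = toC f E g B (act f x d) :=
  (module f E g).act_toCompletion (A := A) x d

lemma denseRange_toC (A : D) : DenseRange (toC f E g A) :=
  (module f E g).denseRange_toCompletion (A := A)

end ExtPre

end Extension

section Extension

namespace HilbertModule

variable {C : Type u} [CStarCategory.{v} C] {E F : HilbertModule C} {I : Type*} {s : I → C}

open Classical in
/-- `x ↦ ∑ g_i x_i` as a linear map. -/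
noncomputable def comb (g : ∀ i, E.obj (s i)) (A : C) : (Π₀ i, (A ⟶ s i)) →ₗ[ℂ] E.obj A :=
  DFinsupp.lsum ℂ fun i => actR (g i)

lemma lsum_eq {M : I → Type*} [∀ i, AddCommGroup (M i)] [∀ i, Module ℂ (M i)] {N : Type*}
    [AddCommGroup N] [Module ℂ N] [DecidableEq I] (φ : ∀ i, M i →ₗ[ℂ] N) (x : Π₀ i, M i)
    (r : Finset I) (h : ∀ i ∉ r, x i = 0) : DFinsupp.lsum ℂ φ x = ∑ i ∈ r, φ i (x i) := by
  classical
  rw [DFinsupp.lsum_apply_apply, DFinsupp.sumAddHom_apply, DFinsupp.sum]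
  refine Finset.sum_subset (fun i hi => ?_) fun i _ hi => ?_
  · by_contra hr
    exact (DFinsupp.mem_support_iff.1 hi) (h i hr)
  · rw [DFinsupp.notMem_support_iff.1 hi]
    exact map_zero (φ i)

lemma comb_eq (g : ∀ i, E.obj (s i)) {A : C} (x : Π₀ i, (A ⟶ s i)) (r : Finset I)
    (h : ∀ i ∉ r, x i = 0) : comb g A x = ∑ i ∈ r, E.act (g i) (x i) := by
  classical
  exact lsum_eq _ x r h

lemma inner_comb (g : ∀ i, E.obj (s i)) {A : C} (x : Π₀ i, (A ⟶ s i)) (r : Finset I)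
    (h : ∀ i ∉ r, x i = 0) : E.inner (comb g A x) (comb g A x) =
      ∑ i ∈ r, ∑ j ∈ r, x j ≫ E.inner (g i) (g j) ≫ adj (x i) := by
  rw [comb_eq g x r h, inner_sum_left]
  refine Finset.sum_congr rfl fun i _ => ?_
  rw [inner_sum]
  refine Finset.sum_congr rfl fun j _ => ?_
  rw [E.inner_act, inner_act_left]

open Classical in
lemma comb_single (g : ∀ i, E.obj (s i)) {A : C} (i : I) (f : A ⟶ s i) :
    comb g A (DFinsupp.single i f) = E.act (g i) f := by
  unfold comb
  rw [DFinsupp.lsum_single]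
  rfl

lemma Generates.denseRange {g : ∀ i, E.obj (s i)} (hg : E.Generates g) (A : C) :
    DenseRange (comb g A) := by
  classical
  have h : Submodule.span ℂ {x : E.obj A | ∃ (i : I) (f : A ⟶ s i), x = E.act (g i) f} ≤
      LinearMap.range (comb g A) := by
    rw [Submodule.span_le]
    rintro x ⟨i, f, rfl⟩
    exact ⟨DFinsupp.single i f, comb_single g i f⟩
  exact (hg A).mono h

/-- Extension of a bounded linear map from a generating family. -/
lemma Generates.exists_linFam {a : ∀ i, E.obj (s i)} (ha : E.Generates a) (b : ∀ i, F.obj (s i))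
    (K : ℝ) (h : ∀ (A : C) (x : Π₀ i, (A ⟶ s i)), ‖comb b A x‖ ≤ K * ‖comb a A x‖) :
    ∃ U : LinFam E F, (∀ (A : C) (i : I) (f : A ⟶ s i), U A (E.act (a i) f) = F.act (b i) f) ∧
      ∀ (A : C) (x : E.obj A), ‖U A x‖ ≤ K * ‖x‖ := by
  classical
  refine ⟨fun A => ((comb b A).extendOfNorm (comb a A) : E.obj A →L[ℂ] F.obj A).toLinearMap,
    fun A i f => ?_, fun A x =>
    LinearMap.norm_extendOfNorm_apply_le (ha.denseRange A) K (h A) x⟩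
  have := LinearMap.extendOfNorm_eq (f := comb b A) (ha.denseRange A) ⟨K, h A⟩
    (DFinsupp.single i f)
  rwa [comb_single, comb_single] at this

lemma Generates.isAdjointPair {J : Type*} {t : J → C} {a : ∀ i, E.obj (s i)} (ha : E.Generates a)
    {b : ∀ k, F.obj (t k)} (hb : F.Generates b) {U : LinFam E F} {V : LinFam F E} {K : ℝ}
    (hU : ∀ (A : C) (x : E.obj A), ‖U A x‖ ≤ K * ‖x‖)
    (hV : ∀ (A : C) (x : F.obj A), ‖V A x‖ ≤ K * ‖x‖)
    (h : ∀ (A B : C) (i : I) (f : A ⟶ s i) (k : J) (e : B ⟶ t k),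
      F.inner (U A (E.act (a i) f)) (F.act (b k) e) = E.inner (E.act (a i) f) (V B (F.act (b k) e))) :
    IsAdjointPair U V := by
  have hUc : ∀ A, Continuous (U A) := fun A => (LinearMap.mkContinuous (U A) K (hU A)).continuous
  have hVc : ∀ A, Continuous (V A) := fun A => (LinearMap.mkContinuous (V A) K (hV A)).continuous
  intro A B x y
  refine ha.induction (p := fun x => F.inner (U A x) y = E.inner x (V B y)) ?_ ?_ ?_ ?_ ?_ x
  · exact isClosed_eq (cont_inner (hUc A) continuous_const)
      (cont_inner continuous_id continuous_const)
  · intro i f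
    refine hb.induction (p := fun y => F.inner (U A (E.act (a i) f)) y =
      E.inner (E.act (a i) f) (V B y)) ?_ ?_ ?_ ?_ ?_ y
    · exact isClosed_eq (cont_inner continuous_const continuous_id)
        (cont_inner continuous_const (hVc B))
    · exact fun k e => h A B i f k e
    · simp
    · intro y z hy hz
      rw [F.inner_add, map_add, E.inner_add, hy, hz]
    · intro c y hy
      rw [F.inner_smul, map_smul, E.inner_smul, hy]
  · simp
  · intro y z hy hz
    rw [map_add, inner_add_left, inner_add_left, hy, hz]
  · intro c y hy
    rw [map_smul, inner_smul_left, inner_smul_left, hy]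

end HilbertModule

namespace HMod

variable {C : Type u} [CStarCategory.{v} C] (E : HMod C)

/-- The index set of a chosen generating family of `E`. -/
def GenIdx : Type v := E.small.choose

/-- The objects over which the chosen generators live. -/
noncomputable def genObj : E.GenIdx → C := E.small.choose_spec.choose

/-- A chosen generating family of `E`. -/
noncomputable def gen : ∀ i, E.obj (E.genObj i) := E.small.choose_spec.choose_spec.choose

lemma generates_gen : E.Generates E.gen := E.small.choose_spec.choose_spec.choose_spec

end HMod

variable {C : Type u} [CStarCategory.{v} C] {D : Type u₁} [CStarCategory.{v} D]
  (f : CStarFunctor C D)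

open Classical in
/-- The generators `g_i ⊗ 1` of the extension of scalars. -/
noncomputable def extGen (E : HMod C) (i : E.GenIdx) :
    (ExtPre.module f E E.gen).completion.obj (f.obj (E.genObj i)) :=
  ExtPre.toC f E E.gen _ (DFinsupp.single i (𝟙 (f.obj (E.genObj i))))

lemma inner_extGen (E : HMod C) (i j : E.GenIdx) :
    (ExtPre.module f E E.gen).completion.inner (extGen f E i) (extGen f E j) =
      f.map (E.inner (E.gen i) (E.gen j)) := by
  classical
  refine (ExtPre.inner_toC f E E.gen _ _).trans ?_
  refine (ExtPre.inner_eq f E E.gen _ _ {i, j} ?_ ?_).trans ?_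
  · intro k hk
    exact DFinsupp.single_eq_of_ne (by rintro rfl; simp at hk)
  · intro k hk
    exact DFinsupp.single_eq_of_ne (by rintro rfl; simp at hk)
  · rw [Finset.sum_eq_single_of_mem i (by simp), Finset.sum_eq_single_of_mem j (by simp)]
    · rw [DFinsupp.single_eq_same, DFinsupp.single_eq_same, adj_id, Category.comp_id,
        Category.id_comp]
    · intro k _ hk
      rw [DFinsupp.single_eq_of_ne hk, zero_comp']
    · intro k _ hk
      refine Finset.sum_eq_zero fun l _ => ?_
      rw [DFinsupp.single_eq_of_ne hk, adj_zero', comp_zero', comp_zero']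

lemma generates_extGen (E : HMod C) :
    (ExtPre.module f E E.gen).completion.Generates (extGen f E) := by
  classical
  intro A
  refine (ExtPre.denseRange_toC f E E.gen A).mono ?_
  rintro _ ⟨x, rfl⟩
  induction x using DFinsupp.induction with
  | h0 =>
    rw [map_zero]
    exact Submodule.zero_mem _
  | ha i p x _ _ hx =>
    rw [map_add]
    refine Submodule.add_mem _ (Submodule.subset_span ⟨i, p, ?_⟩) hx
    rw [extGen, ExtPre.act_toC]
    congr 1
    refine DFinsupp.ext fun k => ?_
    rw [ExtPre.act_apply]
    rcases eq_or_ne k i with rfl | hk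
    · rw [DFinsupp.single_eq_same, DFinsupp.single_eq_same, Category.comp_id]
    · rw [DFinsupp.single_eq_of_ne hk, DFinsupp.single_eq_of_ne hk, comp_zero']

/-- The extension of scalars of `E` along `f`, that is, the value of `H f` at `E`: the Hilbert
module over `D` generated by elements `g_i ⊗ 1` with `⟨g_i ⊗ 1, g_j ⊗ 1⟩ = f(⟨g_i, g_j⟩)`. -/
noncomputable def extObj (E : HMod C) : HMod D where
  toHilbertModule := (ExtPre.module f E E.gen).completion
  small := ⟨_, _, _, generates_extGen f E⟩

/-- The generators `g_i ⊗ 1` of the extension of scalars. -/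
noncomputable def extG (E : HMod C) (i : E.GenIdx) : (extObj f E).obj (f.obj (E.genObj i)) :=
  extGen f E i

lemma inner_extG (E : HMod C) (i j : E.GenIdx) :
    (extObj f E).inner (extG f E i) (extG f E j) = f.map (E.inner (E.gen i) (E.gen j)) :=
  inner_extGen f E i j

lemma generates_extG (E : HMod C) : (extObj f E).Generates (extG f E) := generates_extGen f E

open Classical in
/-- `∑ g_i h_i ↦ ∑ (g_i ⊗ 1) f(h_i)` on formal sums. -/
noncomputable def extUnitPre (E : HMod C) (A : C) :
    (Π₀ i, (A ⟶ E.genObj i)) →ₗ[ℂ] (extObj f E).obj (f.obj A) :=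
  DFinsupp.lsum ℂ fun i =>
    HilbertModule.actR (E := (extObj f E).toHilbertModule) (extG f E i) ∘ₗ f.mapL A (E.genObj i)

lemma norm_extUnitPre_le (E : HMod C) (A : C) (x : Π₀ i, (A ⟶ E.genObj i)) :
    ‖extUnitPre f E A x‖ ≤ 1 * ‖HilbertModule.comb (E := E.toHilbertModule) E.gen A x‖ := by
  classical
  obtain ⟨r, hr⟩ : ∃ r : Finset E.GenIdx, ∀ i ∉ r, x i = 0 :=
    ⟨x.support, fun i hi => DFinsupp.notMem_support_iff.1 hi⟩
  have e : extUnitPre f E A x = ∑ i ∈ r, (extObj f E).act (extG f E i) (f.map (x i)) :=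
    HilbertModule.lsum_eq _ x r hr
  rw [one_mul]
  refine le_of_sq_le_sq ?_ (norm_nonneg _)
  rw [HilbertModule.norm_sq, HilbertModule.norm_sq, HilbertModule.inner_comb _ _ r hr, e,
    HilbertModule.inner_sum_left]
  simp only [HilbertModule.inner_sum]
  refine le_trans (le_of_eq ?_) (f.norm_map_le _)
  congr 1
  rw [f.map_sum]
  refine Finset.sum_congr rfl fun i _ => ?_
  rw [f.map_sum]
  refine Finset.sum_congr rfl fun j _ => ?_
  rw [HilbertModule.inner_act, HilbertModule.inner_act_left, inner_extG, f.map_comp, f.map_comp,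
    f.map_adj]

open Classical in
/-- The canonical map `E(A) → (H f E)(f A)`, `x ↦ x ⊗ 1`. -/
noncomputable def extUnit (E : HMod C) (A : C) : E.obj A →L[ℂ] (extObj f E).obj (f.obj A) :=
  (extUnitPre f E A).extendOfNorm (HilbertModule.comb (E := E.toHilbertModule) E.gen A)

lemma extUnit_act_gen (E : HMod C) {A : C} (i : E.GenIdx) (h : A ⟶ E.genObj i) :
    extUnit f E A (E.act (E.gen i) h) = (extObj f E).act (extG f E i) (f.map h) := by
  classical
  have := LinearMap.extendOfNorm_eq (f := extUnitPre f E A) (E.generates_gen.denseRange A)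
    ⟨1, norm_extUnitPre_le f E A⟩ (DFinsupp.single i h)
  rw [HilbertModule.comb_single] at this
  refine this.trans ?_
  unfold extUnitPre
  rw [DFinsupp.lsum_single]
  rfl

lemma extUnit_gen (E : HMod C) (i : E.GenIdx) : extUnit f E (E.genObj i) (E.gen i) = extG f E i := by
  have := extUnit_act_gen f E i (𝟙 _)
  rwa [E.act_id, f.map_id, (extObj f E).act_id] at this

/-- `⟨y ⊗ 1, x ⊗ 1⟩ = f(⟨y, x⟩)`. -/
lemma inner_extUnit (E : HMod C) {A B : C} (y : E.obj B) (x : E.obj A) :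
    (extObj f E).inner (extUnit f E B y) (extUnit f E A x) = f.map (E.inner y x) := by
  refine E.generates_gen.induction (p := fun y => (extObj f E).inner (extUnit f E B y)
    (extUnit f E A x) = f.map (E.inner y x)) ?_ ?_ ?_ ?_ ?_ y
  · exact isClosed_eq (HilbertModule.cont_inner (extUnit f E B).continuous continuous_const)
      (f.continuous_map.comp (HilbertModule.cont_inner continuous_id continuous_const))
  · intro i h
    refine E.generates_gen.induction (p := fun x => (extObj f E).inner
      (extUnit f E B (E.act (E.gen i) h)) (extUnit f E A x) =
        f.map (E.inner (E.act (E.gen i) h) x)) ?_ ?_ ?_ ?_ ?_ x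
    · exact isClosed_eq (HilbertModule.cont_inner continuous_const (extUnit f E A).continuous)
        (f.continuous_map.comp (HilbertModule.cont_inner continuous_const continuous_id))
    · intro j k
      rw [extUnit_act_gen, extUnit_act_gen, HilbertModule.inner_act, HilbertModule.inner_act_left,
        HilbertModule.inner_act, HilbertModule.inner_act_left, inner_extG, f.map_comp, f.map_comp,
        f.map_adj]
    · simp
    · intro x x' hx hx'
      rw [map_add, HilbertModule.inner_add, HilbertModule.inner_add, f.map_add, hx, hx']
    · intro c x hx
      rw [map_smul, HilbertModule.inner_smul, HilbertModule.inner_smul, f.map_smul, hx]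
  · simp
  · intro x x' hx hx'
    rw [map_add, HilbertModule.inner_add_left, HilbertModule.inner_add_left, f.map_add, hx, hx']
  · intro c x hx
    rw [map_smul, HilbertModule.inner_smul_left, HilbertModule.inner_smul_left, f.map_smul, hx]

/-- `(x h) ⊗ 1 = (x ⊗ 1) f(h)`. -/
lemma extUnit_act (E : HMod C) {A B : C} (x : E.obj A) (h : B ⟶ A) :
    extUnit f E B (E.act x h) = (extObj f E).act (extUnit f E A x) (f.map h) := by
  refine (generates_extG f E).ext fun i => ?_
  rw [← extUnit_gen, (extObj f E).inner_act, inner_extUnit, inner_extUnit, E.inner_act, f.map_comp]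

lemma exists_extMap {E F : HMod C} (T : E ⟶ F) : ∃ S : extObj f E ⟶ extObj f F,
    ∀ (A : C) (x : E.obj A), HMod.ap S (extUnit f E A x) = extUnit f F A (HMod.ap T x) := by
  have hex : ∀ {E F : HMod C} (T : E ⟶ F), ∃ U : HilbertModule.LinFam
      (extObj f E).toHilbertModule (extObj f F).toHilbertModule,
      (∀ (A : D) (i : E.GenIdx) (h : A ⟶ f.obj (E.genObj i)),
        U A ((extObj f E).act (extG f E i) h) =
          (extObj f F).act (extUnit f F _ (HMod.ap T (E.gen i))) h) ∧
      ∀ (A : D) (x : (extObj f E).obj A), ‖U A x‖ ≤ ‖T‖ * ‖x‖ := by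
    intro E F T
    refine (generates_extG f E).exists_linFam (fun i => extUnit f F _ (HMod.ap T (E.gen i))) ‖T‖
      fun A x => ?_
    classical
    obtain ⟨r, hr⟩ : ∃ r : Finset E.GenIdx, ∀ i ∉ r, x i = 0 :=
      ⟨x.support, fun i hi => DFinsupp.notMem_support_iff.1 hi⟩
    refine le_of_sq_le_sq ?_ (by positivity)
    rw [mul_pow, HilbertModule.norm_sq, HilbertModule.norm_sq, HilbertModule.inner_comb _ _ r hr,
      HilbertModule.inner_comb _ _ r hr]
    simp only [inner_extUnit, inner_extG]
    have hpos : IsPos (((‖T‖ ^ 2 : ℝ) : ℂ) • 𝟙 E - T ≫ adj T) :=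
      (isPos_comp_adj T).smul_id_sub (CStarCategory.norm_sq T).ge
    obtain ⟨S, hS⟩ := hpos
    have h1 := isPos_gram f F r (fun i => HMod.ap T (E.gen i)) x
    have h2 := isPos_gram f E r (fun i => HMod.ap S (E.gen i)) x
    have e : ∀ i j, E.inner (HMod.ap S (E.gen i)) (HMod.ap S (E.gen j)) =
        ((‖T‖ ^ 2 : ℝ) : ℂ) • E.inner (E.gen i) (E.gen j) -
          F.inner (HMod.ap T (E.gen i)) (HMod.ap T (E.gen j)) := by
      intro i j
      rw [HMod.inner_ap_left, ← HMod.comp_ap, ← hS, HMod.sub_ap, HMod.smul_ap, HMod.id_ap,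
        HMod.comp_ap, HilbertModule.inner_sub, HilbertModule.inner_smul, ← HMod.inner_ap_left]
    simp only [e, f.map_sub, f.map_smul, sub_comp', comp_sub', smul_comp, comp_smul,
      Finset.sum_sub_distrib, ← Finset.smul_sum] at h2
    have h3 := h1.norm_le h2
    rw [norm_smul, Complex.norm_real, Real.norm_of_nonneg (by positivity)] at h3
    exact h3
  obtain ⟨U, hU, hUn⟩ := hex T
  obtain ⟨V, hV, hVn⟩ := hex (adj T)
  rw [norm_adj] at hVn
  have hadj : HilbertModule.IsAdjointPair U V := by
    refine (generates_extG f E).isAdjointPair (generates_extG f F) hUn hVn ?_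
    intro A B i h k e
    rw [hU, hV, HilbertModule.inner_act_left, HilbertModule.inner_act_left,
      HilbertModule.inner_act, HilbertModule.inner_act, ← extUnit_gen, ← extUnit_gen,
      inner_extUnit, inner_extUnit, HMod.inner_ap_left]
  refine ⟨HMod.Hom.mk U (HilbertModule.isOperator_of_pair hadj ‖T‖ hUn), fun A x => ?_⟩
  rw [HMod.ap_mk]
  have hUc : Continuous (U (f.obj A)) :=
    (LinearMap.mkContinuous (U (f.obj A)) ‖T‖ (hUn (f.obj A))).continuous
  refine E.generates_gen.induction (p := fun x => U (f.obj A) (extUnit f E A x) =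
    extUnit f F A (HMod.ap T x)) ?_ ?_ ?_ ?_ ?_ x
  · exact isClosed_eq (hUc.comp (extUnit f E A).continuous)
      ((extUnit f F A).continuous.comp (HMod.continuous_ap T))
  · intro i h
    rw [extUnit_act_gen, hU, HMod.ap_act, extUnit_act]
  · simp
  · intro x y hx hy
    rw [map_add, map_add, HMod.ap_add, map_add, hx, hy]
  · intro c x hx
    rw [map_smul, map_smul, HMod.ap_smul, map_smul, hx]

/-- The extension of an operator: the unique operator with `x ⊗ 1 ↦ T x ⊗ 1`. -/
noncomputable def extMap {E F : HMod C} (T : E ⟶ F) : extObj f E ⟶ extObj f F :=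
  (exists_extMap f T).choose

lemma extMap_extUnit {E F : HMod C} (T : E ⟶ F) {A : C} (x : E.obj A) :
    HMod.ap (extMap f T) (extUnit f E A x) = extUnit f F A (HMod.ap T x) :=
  (exists_extMap f T).choose_spec A x

/-- Two operators on the extension of scalars are equal if they agree on the elements `x ⊗ 1`. -/
lemma ext_hom_ext {E : HMod C} {F : HMod D} {S S' : extObj f E ⟶ F}
    (h : ∀ (A : C) (x : E.obj A), HMod.ap S (extUnit f E A x) = HMod.ap S' (extUnit f E A x)) :
    S = S' := by
  refine (HMod.homEquiv _ _).injective (Subtype.ext ?_)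
  refine (generates_extG f E).eq_of_eq (HMod.homEquiv _ _ S).2.1 (HMod.homEquiv _ _ S').2.1
    fun i => ?_
  rw [← extUnit_gen]
  exact h _ _

/-- The functor `H f : H C → H D` (extension of scalars along `f`). -/
noncomputable def extF : CStarFunctor (HMod C) (HMod D) where
  obj := extObj f
  map := extMap f
  map_id E := ext_hom_ext f fun A x => by
    rw [extMap_extUnit, HMod.id_ap, HMod.id_ap]
  map_comp T S := ext_hom_ext f fun A x => by
    rw [HMod.comp_ap, extMap_extUnit, extMap_extUnit, extMap_extUnit, HMod.comp_ap]
  map_add T S := ext_hom_ext f fun A x => by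
    rw [HMod.add_ap, extMap_extUnit, extMap_extUnit, extMap_extUnit, HMod.add_ap, map_add]
  map_smul c T := ext_hom_ext f fun A x => by
    rw [HMod.smul_ap, extMap_extUnit, extMap_extUnit, HMod.smul_ap, map_smul]
  map_adj {E F} T := ext_hom_ext f fun A y => by
    refine (generates_extG f E).ext fun i => ?_
    rw [extMap_extUnit, ← extUnit_gen, ← HMod.inner_ap_left, extMap_extUnit, inner_extUnit,
      inner_extUnit, HMod.inner_ap_left]

/-- The canonical isomorphism `Y_{f A} → H f (Y_A)`: it corresponds to the element `1 ⊗ 1`. -/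
noncomputable def extYoneda (A : C) : Y (f.obj A) ⟶ extObj f (Y A) :=
  hat (extObj f (Y A)) (extUnit f (Y A) A (Y.elem (𝟙 A)))

lemma extYoneda_isUnitary (A : C) : IsUnitary (extYoneda f A) where
  comp_adj := by
    rw [extYoneda, hat_comp_adj_hat, inner_extUnit]
    have : (Y A).inner (Y.elem (𝟙 A)) (Y.elem (𝟙 A)) = 𝟙 A := by
      change 𝟙 A ≫ adj (𝟙 A) = 𝟙 A
      rw [adj_id, Category.comp_id]
    rw [this, f.map_id]
    exact (yonedaF D).map_id _
  adj_comp := ext_hom_ext f fun B h => by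
    rw [extYoneda, HMod.comp_ap, adj_hat_ap, inner_extUnit, hat_ap, HMod.id_ap]
    have : (Y A).inner (Y.elem (𝟙 A)) h = Y.arrow h := by
      change Y.arrow h ≫ adj (𝟙 A) = Y.arrow h
      rw [adj_id, Category.comp_id]
    rw [this]
    refine (extUnit_act f (Y A) (Y.elem (𝟙 A)) (Y.arrow h)).symm.trans ?_
    congr 1
    exact Category.comp_id (Y.arrow h)

end Extension

/-- A pre-complete structure on a unital C*-category `C`: a C*-functor `L : H C → C` with a
natural isometric (that is, unitary) isomorphism from the identity of `C` to `L ∘ Y`. -/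
structure PreComplete (C : Type u) [CStarCategory.{v} C] where
  L : CStarFunctor (HMod C) C
  unit : ∀ A : C, A ⟶ L.obj (Y A)
  unit_isUnitary : ∀ A : C, IsUnitary (unit A)
  unit_natural : ∀ {A B : C} (f : A ⟶ B), f ≫ unit B = unit A ≫ L.map ((yonedaF C).map f)

/-- The natural pre-complete structure on `H C`, given by restriction along the Yoneda
embedding. -/
noncomputable def HMod.preComplete (C : Type u) [CStarCategory.{v} C] : PreComplete (HMod C) where
  L := restrF C
  unit := restrUnit
  unit_isUnitary := restrUnit_isUnitary
  unit_natural := restrUnit_natural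

/-- A C*-functor `f : C → D` between pre-complete C*-categories is continuous if there is a natural
unitary isomorphism `f ∘ L ≅ L' ∘ H f` which is the canonical one on representable modules, that
is, the one obtained from `L Y_A ≅ A`, `H f (Y_A) ≅ Y_{f A}` and `L' Y_{f A} ≅ f A`. -/
def IsContinuous {C : Type u} [CStarCategory.{v} C] {D : Type u₁} [CStarCategory.{v} D]
    (P : PreComplete C) (Q : PreComplete D) (f : CStarFunctor C D) : Prop :=
  ∃ θ : ∀ E : HMod C, f.obj (P.L.obj E) ⟶ Q.L.obj ((extF f).obj E),
    (∀ E, IsUnitary (θ E)) ∧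
    (∀ (E F : HMod C) (T : E ⟶ F),
      f.map (P.L.map T) ≫ θ F = θ E ≫ Q.L.map ((extF f).map T)) ∧
    ∀ A : C, f.map (P.unit A) ≫ θ (Y A) = Q.unit (f.obj A) ≫ Q.L.map (extYoneda f A)

section Hereditary

variable {C : Type u} [CStarCategory.{v} C]

/-- A hereditary C*-subalgebra of the C*-algebra `C(X)` of endomorphisms of `X`. -/
structure HereditarySubalgebra (X : C) where
  toSubalgebra : NonUnitalStarSubalgebra ℂ (End X)
  isClosed : IsClosed (toSubalgebra : Set (End X))
  hereditary : ∀ a ∈ toSubalgebra, ∀ b ∈ toSubalgebra, ∀ c : End X, a * c * b ∈ toSubalgebra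

namespace HereditarySubalgebra

variable {X : C} (𝒜 : HereditarySubalgebra X)

/-- The closed span of the elements `a ∘ h` with `a ∈ 𝒜` and `h : B ⟶ X`. -/
def submodule (B : C) : Submodule ℂ (B ⟶ X) :=
  (Submodule.span ℂ {x : B ⟶ X | ∃ a ∈ 𝒜.toSubalgebra, ∃ h : B ⟶ X, x = h ≫ a}).topologicalClosure

lemma comp_mem {A B : C} {x : A ⟶ X} (hx : x ∈ 𝒜.submodule A) (f : B ⟶ A) :
    f ≫ x ∈ 𝒜.submodule B := by
  have hc : IsClosed {x : A ⟶ X | f ≫ x ∈ 𝒜.submodule B} :=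
    (Submodule.isClosed_topologicalClosure _).preimage (cont_comp continuous_const continuous_id)
  refine hc.closure_subset_iff.2 (fun y hy => ?_) hx
  change f ≫ y ∈ 𝒜.submodule B
  induction hy using Submodule.span_induction with
  | mem y hy =>
    obtain ⟨a, ha, h, rfl⟩ := hy
    refine Submodule.le_topologicalClosure _ (Submodule.subset_span ⟨a, ha, f ≫ h, ?_⟩)
    exact (Category.assoc f h a).symm
  | zero =>
    rw [comp_zero']
    exact Submodule.zero_mem _
  | add y z _ _ hy hz =>
    rw [comp_add]
    exact Submodule.add_mem _ hy hz
  | smul c y _ hy =>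
    rw [comp_smul]
    exact Submodule.smul_mem _ c hy

lemma mem {a : X ⟶ X} (ha : a ∈ 𝒜.toSubalgebra) : a ∈ 𝒜.submodule X :=
  Submodule.le_topologicalClosure _ (Submodule.subset_span ⟨a, ha, 𝟙 X, (Category.id_comp a).symm⟩)

/-- The Hilbert submodule `𝒜 X` of `Y_X`. -/
noncomputable def hilbertModule : HilbertModule C where
  obj B := 𝒜.submodule B
  normedAddCommGroup B := inferInstance
  normedSpace B := inferInstance
  completeSpace B :=
    (Submodule.isClosed_topologicalClosure _).completeSpace_coe
  act x f := ⟨f ≫ x.1, 𝒜.comp_mem x.2 f⟩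
  add_act x y f := Subtype.ext (comp_add f x.1 y.1)
  smul_act c x f := Subtype.ext (comp_smul c f x.1)
  act_add x f g := Subtype.ext (add_comp f g x.1)
  act_smul c x f := Subtype.ext (smul_comp c f x.1)
  act_id x := Subtype.ext (Category.id_comp x.1)
  act_comp x f g := Subtype.ext (Category.assoc g f x.1)
  inner u v := v.1 ≫ adj u.1
  adj_inner u v := by rw [BanachStarCategory.adj_comp, adj_adj]
  inner_add u v w := add_comp v.1 w.1 (adj u.1)
  inner_smul c u v := smul_comp c v.1 (adj u.1)
  inner_act u v f := Category.assoc f v.1 (adj u.1)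
  inner_self_pos u := CStarCategory.adj_pos u.1
  norm_sq u := CStarCategory.norm_sq u.1

/-- The Hilbert submodule `𝒜 X` of `Y_X` as an object of `H C`; it is generated by the elements
of `𝒜`. -/
noncomputable def toHMod : HMod C where
  toHilbertModule := 𝒜.hilbertModule
  small := by
    refine ⟨𝒜.toSubalgebra, fun _ => X, fun a => ⟨a.1, 𝒜.mem a.2⟩, fun B x => ?_⟩
    change 𝒜.submodule B at x
    have h : Submodule.span ℂ {y : B ⟶ X | ∃ a ∈ 𝒜.toSubalgebra, ∃ h : B ⟶ X, y = h ≫ a} ≤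
        (Submodule.span ℂ {y : 𝒜.submodule B | ∃ (a : 𝒜.toSubalgebra) (h : B ⟶ X),
          y = 𝒜.hilbertModule.act ⟨a.1, 𝒜.mem a.2⟩ h}).map (𝒜.submodule B).subtype := by
      rw [Submodule.span_le]
      rintro y ⟨a, ha, h, rfl⟩
      exact ⟨⟨h ≫ a, 𝒜.comp_mem (𝒜.mem ha) h⟩, Submodule.subset_span ⟨⟨a, ha⟩, h, rfl⟩, rfl⟩
    have hx : x.1 ∈ closure (Submodule.span ℂ {y : B ⟶ X | ∃ a ∈ 𝒜.toSubalgebra, ∃ h : B ⟶ X,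
        y = h ≫ a} : Set (B ⟶ X)) := x.2
    have hx' := closure_mono h hx
    rw [Submodule.map_coe] at hx'
    refine (closure_subtype (x := x) (s := (Submodule.span ℂ {y : 𝒜.submodule B |
      ∃ (a : 𝒜.toSubalgebra) (h : B ⟶ X), y = 𝒜.hilbertModule.act ⟨a.1, 𝒜.mem a.2⟩ h} :
        Set (𝒜.submodule B)))).2 ?_
    exact hx'

/-- The inclusion of `𝒜 X` in `Y_X`. -/
noncomputable def incl {B : C} (x : 𝒜.toHMod.obj B) : B ⟶ X := Subtype.val (p := (· ∈ 𝒜.submodule B)) x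

end HereditarySubalgebra

end Hereditary

namespace PreComplete

variable {C : Type u} [CStarCategory.{v} C] (P : PreComplete C)

/-- The canonical embedding of `H` in `Y_{L H}`: it sends `x ∈ H(A)`, seen as an operator
`Y_A → H`, to `A ≅ L Y_A → L H`. -/
noncomputable def mu (H : HMod C) {A : C} (x : H.obj A) : A ⟶ P.L.obj H :=
  P.unit A ≫ P.L.map (hat H x)

/-- A hereditary subalgebra `𝒜` of `C(X)` is weakly dense if there is an isomorphism from `L(𝒜 X)`
to `X` that is compatible with the inclusions of `𝒜 X`. -/
def WeaklyDense {X : C} (𝒜 : HereditarySubalgebra X) : Prop :=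
  ∃ φ : P.L.obj 𝒜.toHMod ≅ X, ∀ (B : C) (x : 𝒜.toHMod.obj B),
    P.mu 𝒜.toHMod x ≫ φ.hom = 𝒜.incl x

/-- Condition (C1): a morphism out of `L H` that vanishes on `H` is zero. -/
def C1 : Prop :=
  ∀ (H : HMod C) (A : C) (l : P.L.obj H ⟶ A),
    (∀ (B : C) (x : H.obj B), P.mu H x ≫ l = 0) → l = 0

/-- Condition (C2): the functor `L : H C → C` is continuous. -/
def C2 : Prop := IsContinuous (HMod.preComplete C) P P.L

/-- Condition (C3): hereditary subalgebras that contain a weakly dense one are weakly dense. -/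
def C3 : Prop :=
  ∀ (X : C) (𝒜 ℬ : HereditarySubalgebra X), 𝒜.toSubalgebra ≤ ℬ.toSubalgebra →
    P.WeaklyDense 𝒜 → P.WeaklyDense ℬ

/-- A pre-adjoint pair for the closure operation `H ↦ Y_{L H}`: bounded linear maps `f : A → Y_{L B}`
and `g : B → Y_{L A}` with `⟨f a, μ b⟩ = ⟨μ a, g b⟩`. -/
structure PreAdjointPair (A B : HMod C) where
  f : HilbertModule.LinFam A.toHilbertModule (Y (P.L.obj B)).toHilbertModule
  g : HilbertModule.LinFam B.toHilbertModule (Y (P.L.obj A)).toHilbertModule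
  f_bounded : HilbertModule.IsBounded f
  g_bounded : HilbertModule.IsBounded g
  inner_eq : ∀ (X Z : C) (a : A.obj X) (b : B.obj Z),
    (Y (P.L.obj B)).inner (f X a) (Y.elem (P.mu B b)) =
      (Y (P.L.obj A)).inner (Y.elem (P.mu A a)) (g Z b)

/-- Condition (C4): every pre-adjoint pair has an extension, i.e. an operator
`Y_{L A} → Y_{L B}` that extends `f`. -/
def C4 : Prop :=
  ∀ (A B : HMod C) (p : P.PreAdjointPair A B), ∃ T : Y (P.L.obj A) ⟶ Y (P.L.obj B),
    ∀ (X : C) (a : A.obj X), HMod.ap T (Y.elem (P.mu A a)) = p.f X a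

end PreComplete
end CStarCat

/-!
The proof rests on a dictionary between closed submodules of a representable module and hereditary
subalgebras. A Hilbert module `E` with a natural isometric map `k : E → Y_X`, which need not be
adjointable, has the hereditary subalgebra `𝒜 = W(X) ∩ W(X)*`, where `W` is the range of `k`. Every
`w ∈ W(B)` is the limit of the morphisms `w w* (w w* + ε)⁻¹ w`, and `w w* ∈ 𝒜`, so that `𝒜 X = W`
(`IsoEmbedding.submodule_hereditarySubalgebra`). Hence weak density may be discussed for arbitrary
submodules of `Y_X`. Under (C1) a morphism `L H → X` that is isometric on `H` is isometric, so the
isomorphism in the definition of weak density is unitary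
(`PreComplete.C1.weaklyDense_hereditarySubalgebra_iff`).

(C1) and (C3) imply (C2). For a module `V` over `H C`, the extension of scalars `W` of `V` along `L`
embeds in `Y_{L (R V)}`: the generator `x ⊗ 1` with `x ∈ V(E)` goes to the value of `L` at the
operator `E ≅ R Y_E → R V` defined by `x`. The elements `(x ⊗ 1) ι_A` with `x ∈ V(Y_A)` form a copy
of `R V` in `W`, embedded in `Y_{L (R V)}` by `μ`, and this copy is weakly dense for the trivial
reason that the identity of `L (R V)` extends `μ`. By (C3) the larger `W` is weakly dense as well,
that is, `L (R V) ≅ L W`. Naturality and the value at `Y_E` are identities of morphisms that can be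
tested on `R V` and on the generators (`PreComplete.C1.c2_of_c3`).

(C1) and (C4) imply (C3). Let `𝒜 ⊆ ℬ` with `𝒜` weakly dense, so that `L (𝒜 X) ≅ X`. The inclusions
`𝒜 X ⊆ ℬ X → Y_{L (ℬ X)}` and `ℬ X ⊆ Y_X ≅ Y_{L (𝒜 X)}` form a pre-adjoint pair. The operator given
by (C4) is isometric because it is so on `𝒜 X`, and its adjoint is isometric because it extends the
inclusion of `ℬ X`, which can be tested against `𝒜 X` (`PreComplete.C1.c3_of_c4`).
-/

namespace CStarCat

open BanachStarCategory HilbertModule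

/-! ### Approximation by multiples of a positive element -/

section Approximation

attribute [local instance] CStarAlgebra.spectralOrder CStarAlgebra.spectralOrderedRing

/-- Continuous functional calculus with `S = (K + ε)⁻¹`, for which `1 - K S = ε (K + ε)⁻¹`. -/
lemma exists_approx_one_sub_mul {R : Type*} [CStarAlgebra R] {K : R} (hK : 0 ≤ K) {ε : ℝ}
    (hε : 0 < ε) : ∃ S : R, star (1 - K * S) = 1 - K * S ∧
      ‖(1 - K * S) * K * (1 - K * S)‖ ≤ ε := by
  have hsp : ∀ t ∈ spectrum ℝ K, 0 ≤ t := fun t ht => spectrum_nonneg_of_nonneg hK ht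
  have hsa : IsSelfAdjoint K := hK.isSelfAdjoint
  have hc1 : ContinuousOn (fun t : ℝ => (t + ε)⁻¹) (spectrum ℝ K) := by
    refine ContinuousOn.inv₀ (by fun_prop) fun t ht => ?_
    have := hsp t ht
    linarith
  have hc2 : ContinuousOn (fun t : ℝ => ε / (t + ε)) (spectrum ℝ K) := by
    refine ContinuousOn.div (by fun_prop) (by fun_prop) fun t ht => ?_
    have := hsp t ht
    linarith
  have hM : 1 - K * cfc (fun t : ℝ => (t + ε)⁻¹) K = cfc (fun t : ℝ => ε / (t + ε)) K := by
    have e1 : K * cfc (fun t : ℝ => (t + ε)⁻¹) K = cfc (fun t : ℝ => t * (t + ε)⁻¹) K := by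
      conv_lhs => enter [1]; rw [← cfc_id' ℝ K]
      rw [← cfc_mul _ _ K]
    rw [e1, ← cfc_one ℝ K, ← cfc_sub _ _ K]
    refine cfc_congr fun t ht => ?_
    have h0 := hsp t ht
    have h1 : t + ε ≠ 0 := by linarith
    simp only [Pi.one_apply]
    field_simp
    ring
  refine ⟨cfc (fun t : ℝ => (t + ε)⁻¹) K, ?_, ?_⟩
  · rw [hM]
    exact (cfc_predicate _ K : IsSelfAdjoint _).star_eq
  · have e2 : cfc (fun t : ℝ => ε / (t + ε)) K * K * cfc (fun t : ℝ => ε / (t + ε)) K =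
        cfc (fun t : ℝ => ε / (t + ε) * t * (ε / (t + ε))) K := by
      conv_lhs => enter [1, 2]; rw [← cfc_id' ℝ K]
      rw [← cfc_mul _ _ K, ← cfc_mul _ _ K]
    rw [hM, e2]
    refine norm_cfc_le hε.le fun t ht => ?_
    have h0 := hsp t ht
    have h1 : 0 < t + ε := by linarith
    have h2 : ε / (t + ε) ≤ 1 := (div_le_one h1).2 (by linarith)
    have h3 : ε / (t + ε) * t ≤ ε := by
      rw [div_mul_eq_mul_div, div_le_iff₀ h1]
      nlinarith
    rw [Real.norm_of_nonneg (by positivity)]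
    exact (mul_le_of_le_one_right (by positivity) h2).trans h3

/-- A morphism `w` is a limit of morphisms `w w* h`. -/
lemma mem_closure_range_comp {C : Type u} [CStarCategory.{v} C] {B X : C} (w : B ⟶ X) :
    w ∈ closure (Set.range fun h : B ⟶ X => h ≫ adj w ≫ w) := by
  rw [Metric.mem_closure_range_iff]
  intro ε hε
  have hpos : IsPos (adj w ≫ w) := by
    simpa only [adj_adj] using isPos_comp_adj (adj w)
  obtain ⟨S, hS, hle⟩ := exists_approx_one_sub_mul (R := End X) (K := adj w ≫ w)
    ((isPos_iff _).1 hpos) (ε := (ε / 2) ^ 2) (by positivity)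
  obtain ⟨M, hM⟩ : ∃ M : X ⟶ X, M = 𝟙 X - S ≫ adj w ≫ w := ⟨_, rfl⟩
  have hMadj : adj M = M := by rw [hM]; exact hS
  have hMle : ‖M ≫ (adj w ≫ w) ≫ M‖ ≤ (ε / 2) ^ 2 := by rw [hM]; exact hle
  refine ⟨w ≫ S, ?_⟩
  have e : w - (w ≫ S) ≫ adj w ≫ w = w ≫ M := by
    rw [hM, comp_sub', Category.comp_id, Category.assoc]
  rw [dist_eq_norm, e]
  have h : ‖w ≫ M‖ ^ 2 ≤ (ε / 2) ^ 2 := by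
    rw [← norm_adj, CStarCategory.norm_sq, adj_adj, BanachStarCategory.adj_comp, hMadj]
    simpa only [Category.assoc] using hMle
  have := le_of_sq_le_sq h (by positivity)
  linarith

end Approximation

/-! ### Isometric embeddings of Hilbert modules in representable modules -/

/-- A realization of a Hilbert module `E` as a closed submodule of `Y_X`: a natural linear map
`E(A) → C(A, X)` that preserves the scalar product. It need not have an adjoint. -/
structure IsoEmbedding {C : Type u} [CStarCategory.{v} C] (E : HilbertModule C) (X : C) where
  map : ∀ {A : C}, E.obj A →ₗ[ℂ] (A ⟶ X)
  map_act : ∀ {A B : C} (x : E.obj A) (f : B ⟶ A), map (E.act x f) = f ≫ map x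
  map_inner : ∀ {A B : C} (y : E.obj B) (x : E.obj A), map x ≫ adj (map y) = E.inner y x

namespace IsoEmbedding

variable {C : Type u} [CStarCategory.{v} C]

lemma norm_map {E : HilbertModule C} {X : C} (k : IsoEmbedding E X) {A : C} (x : E.obj A) :
    ‖k.map x‖ = ‖x‖ := by
  refine (sq_eq_sq₀ (norm_nonneg _) (norm_nonneg _)).1 ?_
  rw [CStarCategory.norm_sq, k.map_inner, E.norm_sq]

lemma map_injective {E : HilbertModule C} {X : C} (k : IsoEmbedding E X) {A : C} :
    Function.Injective (k.map (A := A)) := by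
  refine (injective_iff_map_eq_zero _).2 fun x hx => ?_
  rw [← norm_eq_zero, ← k.norm_map, hx, norm_zero]

lemma isClosed_range {E : HilbertModule C} {X : C} (k : IsoEmbedding E X) (A : C) :
    IsClosed (LinearMap.range (k.map (A := A)) : Set (A ⟶ X)) := by
  have h : Isometry (k.map (A := A)) :=
    AddMonoidHomClass.isometry_of_norm _ k.norm_map
  rw [LinearMap.coe_range]
  exact h.isClosedEmbedding.isClosed_range

lemma comp_mem_range {E : HilbertModule C} {X : C} (k : IsoEmbedding E X) {A B : C} {a : A ⟶ X}
    (ha : a ∈ LinearMap.range (k.map (A := A))) (f : B ⟶ A) :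
    f ≫ a ∈ LinearMap.range (k.map (A := B)) := by
  obtain ⟨x, rfl⟩ := ha
  exact ⟨E.act x f, k.map_act x f⟩

/-- The hereditary subalgebra `W(X) ∩ W(X)*` of `C(X)`, where `W ⊆ Y_X` is the range of the
embedding. -/
def hereditarySubalgebra {E : HilbertModule C} {X : C} (k : IsoEmbedding E X) :
    HereditarySubalgebra X where
  toSubalgebra :=
    { carrier := {a : X ⟶ X | a ∈ LinearMap.range (k.map (A := X)) ∧
        adj a ∈ LinearMap.range (k.map (A := X))}
      add_mem' := fun {a b} ha hb => ⟨Submodule.add_mem _ ha.1 hb.1, by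
        have := Submodule.add_mem _ ha.2 hb.2
        rwa [← adj_add] at this⟩
      zero_mem' := ⟨Submodule.zero_mem _, by
        have := Submodule.zero_mem (LinearMap.range (k.map (A := X)))
        rwa [← adj_zero'] at this⟩
      smul_mem' := fun c a ha => ⟨Submodule.smul_mem _ c ha.1, by
        have := Submodule.smul_mem _ ((starRingEnd ℂ) c) ha.2
        rwa [← adj_smul] at this⟩
      mul_mem' := fun {a b} ha hb => ⟨k.comp_mem_range ha.1 b, by
        have := k.comp_mem_range hb.2 (adj (A := X) (B := X) a)
        rwa [← BanachStarCategory.adj_comp] at this⟩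
      star_mem' := fun {a} ha => ⟨ha.2, by
        have := ha.1
        rwa [← adj_adj (A := X) (B := X) a] at this⟩ }
  isClosed := (k.isClosed_range X).inter ((k.isClosed_range X).preimage continuous_adj)
  hereditary a ha b hb c := by
    refine ⟨k.comp_mem_range (k.comp_mem_range ha.1 c) b, ?_⟩
    have := k.comp_mem_range hb.2 (adj (A := X) (B := X) a ≫ adj (A := X) (B := X) c)
    rwa [← BanachStarCategory.adj_comp, ← BanachStarCategory.adj_comp] at this

/-- If `𝒜` is the hereditary subalgebra of a closed submodule `W ⊆ Y_X`, then `𝒜 X = W`. -/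
lemma submodule_hereditarySubalgebra {E : HilbertModule C} {X : C} (k : IsoEmbedding E X) (B : C) :
    k.hereditarySubalgebra.submodule B = LinearMap.range (k.map (A := B)) := by
  refine le_antisymm (Submodule.topologicalClosure_minimal _ ?_ (k.isClosed_range B)) ?_
  · rw [Submodule.span_le]
    rintro _ ⟨a, ha, h, rfl⟩
    exact k.comp_mem_range ha.1 h
  · intro w hw
    refine closure_mono ?_ (mem_closure_range_comp w)
    rintro _ ⟨h, rfl⟩
    have hmem : adj w ≫ w ∈ LinearMap.range (k.map (A := X)) := k.comp_mem_range hw _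
    refine Submodule.subset_span ⟨adj w ≫ w, ⟨hmem, ?_⟩, h, rfl⟩
    rwa [BanachStarCategory.adj_comp, adj_adj]

/-- The identification of `E` with `𝒜 X`, for the hereditary subalgebra `𝒜` of an embedding of `E`
in `Y_X`. -/
lemma exists_unitary {E : HMod C} {X : C} (k : IsoEmbedding E.toHilbertModule X) :
    ∃ U : E ⟶ k.hereditarySubalgebra.toHMod, IsUnitary U ∧
      ∀ (A : C) (x : E.obj A), k.hereditarySubalgebra.incl (HMod.ap U x) = k.map x := by
  obtain ⟨e, he⟩ : ∃ e : ∀ A : C, E.obj A ≃ₗ[ℂ] k.hereditarySubalgebra.toHMod.obj A,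
      ∀ A x, k.hereditarySubalgebra.incl (e A x) = k.map x :=
    ⟨fun A => (LinearEquiv.ofInjective (k.map (A := A)) k.map_injective).trans
      (LinearEquiv.ofEq _ _ (k.submodule_hereditarySubalgebra A).symm), fun A x => rfl⟩
  have hinner : ∀ {A B : C} (y : E.obj B) (x : E.obj A),
      k.hereditarySubalgebra.toHMod.inner (e B y) (e A x) = E.inner y x := fun y x => by
    change k.hereditarySubalgebra.incl (e _ x) ≫ adj (k.hereditarySubalgebra.incl (e _ y)) = _
    rw [he, he, k.map_inner]
  have hpair : IsAdjointPair (E := E.toHilbertModule)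
      (F := k.hereditarySubalgebra.toHMod.toHilbertModule)
      (fun A => (e A).toLinearMap) (fun A => (e A).symm.toLinearMap) := fun A B x y => by
    change k.hereditarySubalgebra.toHMod.inner (e A x) y = E.inner x ((e B).symm y)
    rw [← hinner, LinearEquiv.apply_symm_apply]
  have hbound : ∀ (A : C) (x : E.obj A), ‖e A x‖ ≤ 1 * ‖x‖ := fun A x => by
    rw [one_mul]
    exact (k.norm_map x).le.trans' (congrArg norm (he A x)).le
  obtain ⟨U, hU⟩ : ∃ U : E ⟶ k.hereditarySubalgebra.toHMod,
      ∀ (A : C) (x : E.obj A), HMod.ap U x = e A x :=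
    ⟨HMod.Hom.mk _ (isOperator_of_pair hpair 1 hbound), fun A x => HMod.ap_mk _ _ x⟩
  have hU' : ∀ (A : C) (y : k.hereditarySubalgebra.toHMod.obj A),
      HMod.ap (adj U) y = (e A).symm y := fun A y => by
    refine ext_inner fun B x => ?_
    rw [← HMod.inner_ap_left, hU]
    exact hpair B A x y
  refine ⟨U, ⟨HMod.hom_ext fun A x => ?_, HMod.hom_ext fun A y => ?_⟩, fun A x => by rw [hU, he]⟩
  · rw [HMod.comp_ap, hU, hU', HMod.id_ap, LinearEquiv.symm_apply_apply]
  · rw [HMod.comp_ap, hU', hU, HMod.id_ap, LinearEquiv.apply_symm_apply]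

end IsoEmbedding

/-- A family of morphisms `b i : s i ⟶ X` with the same Gram matrix as a generating family of a
Hilbert module `E` defines an embedding of `E` in `Y_X`. -/
lemma HilbertModule.Generates.exists_isoEmbedding {C : Type u} [CStarCategory.{v} C]
    {E : HilbertModule C} {I : Type*} {s : I → C} {a : ∀ i, E.obj (s i)} (ha : E.Generates a)
    {X : C} (b : ∀ i, s i ⟶ X) (hab : ∀ i j, b j ≫ adj (b i) = E.inner (a i) (a j)) :
    ∃ k : IsoEmbedding E X, ∀ i, k.map (a i) = b i := by
  classical
  -- The family `b` and its Gram matrix in terms of the module `Y_X`.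
  obtain ⟨b', hb', hab'⟩ : ∃ b' : ∀ i, (yonedaModule X).obj (s i), (∀ i, b' i = b i) ∧
      ∀ i j, (yonedaModule X).inner (b' i) (b' j) = E.inner (a i) (a j) := ⟨b, fun _ => rfl, hab⟩
  have hnorm : ∀ (A : C) (x : Π₀ i, (A ⟶ s i)),
      ‖comb b' A x‖ ≤ 1 * ‖comb a A x‖ := fun A x => by
    obtain ⟨r, hr⟩ : ∃ r : Finset I, ∀ i ∉ r, x i = 0 :=
      ⟨x.support, fun i hi => DFinsupp.notMem_support_iff.1 hi⟩
    rw [one_mul]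
    refine le_of_sq_le_sq (le_of_eq ?_) (norm_nonneg _)
    rw [HilbertModule.norm_sq, HilbertModule.norm_sq, inner_comb _ _ r hr, inner_comb _ _ r hr]
    refine congrArg norm (Finset.sum_congr rfl fun i _ => Finset.sum_congr rfl fun j _ => ?_)
    rw [hab']
  obtain ⟨U, hU, hUle⟩ := ha.exists_linFam b' 1 hnorm
  have hUc : ∀ A, Continuous (U A) := fun A => (LinearMap.mkContinuous (U A) 1 (hUle A)).continuous
  have hUgen : ∀ {A : C} (i : I) (f : A ⟶ s i), U A (E.act (a i) f) = f ≫ b i :=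
    fun i f => (hU _ i f).trans (congrArg (f ≫ ·) (hb' i))
  have hinner : ∀ {A B : C} (y : E.obj B) (x : E.obj A),
      (yonedaModule X).inner (U B y) (U A x) = E.inner y x := by
    intro A B y x
    refine ha.induction (p := fun y => (yonedaModule X).inner (U B y) (U A x) = E.inner y x)
      ?_ ?_ ?_ ?_ ?_ y
    · exact isClosed_eq (cont_inner (hUc B) continuous_const)
        (cont_inner continuous_id continuous_const)
    · intro i f
      refine ha.induction (p := fun x => (yonedaModule X).inner (U B (E.act (a i) f)) (U A x) =
        E.inner (E.act (a i) f) x) ?_ ?_ ?_ ?_ ?_ x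
      · exact isClosed_eq (cont_inner continuous_const (hUc A))
          (cont_inner continuous_const continuous_id)
      · intro j h
        rw [hUgen, hUgen, E.inner_act, inner_act_left, ← hab]
        change (h ≫ b j) ≫ adj (f ≫ b i) = _
        rw [BanachStarCategory.adj_comp]
        simp only [Category.assoc]
      · simp
      · intro x x' hx hx'
        rw [map_add, HilbertModule.inner_add, E.inner_add, hx, hx']
      · intro c x hx
        rw [map_smul, HilbertModule.inner_smul, E.inner_smul, hx]
    · simp
    · intro y y' hy hy'
      rw [map_add, inner_add_left, inner_add_left, hy, hy']
    · intro c y hy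
      rw [map_smul, inner_smul_left, inner_smul_left, hy]
  have hact : ∀ {A B : C} (x : E.obj A) (f : B ⟶ A), U B (E.act x f) = f ≫ U A x := by
    intro A B x f
    refine ha.induction (p := fun x => U B (E.act x f) = f ≫ U A x) ?_ ?_ ?_ ?_ ?_ x
    · exact isClosed_eq ((hUc B).comp (continuous_actL f)) (cont_comp continuous_const (hUc A))
    · intro i h
      rw [← E.act_comp, hUgen, hUgen, Category.assoc]
    · have h0 : E.act (0 : E.obj A) f = 0 := (actL f).map_zero
      rw [h0, map_zero, map_zero]
      exact (comp_zero' f).symm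
    · intro x y hx hy
      rw [E.add_act, map_add, map_add, hx, hy]
      exact (comp_add f _ _).symm
    · intro c x hx
      rw [E.smul_act, map_smul, map_smul, hx]
      exact (comp_smul c f _).symm
  refine ⟨⟨fun {A} => U A, hact, hinner⟩, fun i => ?_⟩
  have := hUgen i (𝟙 (s i))
  rwa [E.act_id, Category.id_comp] at this

/-- The inclusion of `𝒜 X` in `Y_X`, as an embedding. -/
noncomputable def HereditarySubalgebra.inclEmb {C : Type u} [CStarCategory.{v} C] {X : C}
    (𝒜 : HereditarySubalgebra X) : IsoEmbedding 𝒜.toHMod.toHilbertModule X where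
  map := fun {A} => (𝒜.submodule A).subtype
  map_act _ _ := rfl
  map_inner _ _ := rfl

/-! ### Unitary morphisms -/

lemma IsUnitary.comp {C : Type u} [CStarCategory.{v} C] {A B D : C} {f : A ⟶ B} {g : B ⟶ D}
    (hf : IsUnitary f) (hg : IsUnitary g) : IsUnitary (f ≫ g) where
  comp_adj := by
    rw [BanachStarCategory.adj_comp, Category.assoc, ← Category.assoc g, hg.comp_adj,
      Category.id_comp, hf.comp_adj]
  adj_comp := by
    rw [BanachStarCategory.adj_comp, Category.assoc, ← Category.assoc (adj f), hf.adj_comp,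
      Category.id_comp, hg.adj_comp]

lemma IsUnitary.adj {C : Type u} [CStarCategory.{v} C] {A B : C} {f : A ⟶ B}
    (hf : IsUnitary f) : IsUnitary (adj f) where
  comp_adj := by rw [adj_adj, hf.adj_comp]
  adj_comp := by rw [adj_adj, hf.comp_adj]

lemma IsUnitary.map {C : Type u} [CStarCategory.{v} C] {D : Type u₁} [CStarCategory.{v} D]
    (F : CStarFunctor C D) {A B : C} {f : A ⟶ B} (hf : IsUnitary f) : IsUnitary (F.map f) where
  comp_adj := by rw [← F.map_adj, ← F.map_comp, hf.comp_adj, F.map_id]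
  adj_comp := by rw [← F.map_adj, ← F.map_comp, hf.adj_comp, F.map_id]

namespace PreComplete

variable {C : Type u} [CStarCategory.{v} C] (P : PreComplete C)

/-! ### The embedding of `H` in `Y_{L H}` -/

lemma unit_comp_map_yonedaMap {A B : C} (f : A ⟶ B) :
    P.unit A ≫ P.L.map (yonedaMap f) = f ≫ P.unit B := (P.unit_natural f).symm

lemma mu_inner (H : HMod C) {A B : C} (y : H.obj B) (x : H.obj A) :
    P.mu H x ≫ adj (P.mu H y) = H.inner y x := by
  rw [mu, mu, BanachStarCategory.adj_comp, ← P.L.map_adj, Category.assoc,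
    ← Category.assoc (P.L.map _), ← P.L.map_comp, hat_comp_adj_hat, ← Category.assoc,
    unit_comp_map_yonedaMap, Category.assoc, (P.unit_isUnitary B).comp_adj, Category.comp_id]

lemma mu_act (H : HMod C) {A B : C} (x : H.obj A) (f : B ⟶ A) :
    P.mu H (H.act x f) = f ≫ P.mu H x := by
  rw [mu, mu, ← yonedaMap_hat, P.L.map_comp, ← Category.assoc, unit_comp_map_yonedaMap,
    Category.assoc]

lemma mu_map {H K : HMod C} (T : H ⟶ K) {A : C} (x : H.obj A) :
    P.mu H x ≫ P.L.map T = P.mu K (HMod.ap T x) := by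
  rw [mu, mu, Category.assoc, ← P.L.map_comp, hat_comp]

/-- The canonical embedding of `H` in `Y_{L H}`. -/
noncomputable def muEmb (H : HMod C) : IsoEmbedding H.toHilbertModule (P.L.obj H) where
  map := fun {A} =>
    { toFun := fun x => P.mu H x
      map_add' := fun x y => by
        rw [mu, mu, mu, hat_add, P.L.map_add, comp_add]
      map_smul' := fun c x => by
        rw [mu, mu, hat_smul, P.L.map_smul, comp_smul, RingHom.id_apply] }
  map_act x f := P.mu_act H x f
  map_inner y x := P.mu_inner H y x

variable {P}

/-! ### Consequences of (C1) -/

lemma C1.hom_ext (h1 : P.C1) {H : HMod C} {A : C} {l m : P.L.obj H ⟶ A}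
    (h : ∀ (B : C) (x : H.obj B), P.mu H x ≫ l = P.mu H x ≫ m) : l = m := by
  rw [← sub_eq_zero]
  refine h1 H A _ fun B x => ?_
  rw [comp_sub', h, sub_self]

/-- An endomorphism of `L H` is determined by its matrix coefficients on `H`. -/
lemma C1.end_ext (h1 : P.C1) {H : HMod C} {l m : P.L.obj H ⟶ P.L.obj H}
    (h : ∀ (A B : C) (x : H.obj A) (y : H.obj B),
      P.mu H x ≫ l ≫ adj (P.mu H y) = P.mu H x ≫ m ≫ adj (P.mu H y)) : l = m := by
  rw [← adj_adj l, ← adj_adj m]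
  refine congrArg adj (h1.hom_ext fun B y => ?_)
  rw [← adj_adj (P.mu H y), ← BanachStarCategory.adj_comp, ← BanachStarCategory.adj_comp]
  exact congrArg adj (h1.hom_ext fun A x => h A B x y)

/-- A morphism `L H → X` that is isometric on `H` is isometric. -/
lemma C1.comp_adj_eq_id (h1 : P.C1) {H : HMod C} {X : C} (k : IsoEmbedding H.toHilbertModule X)
    {T : P.L.obj H ⟶ X} (hT : ∀ (A : C) (x : H.obj A), P.mu H x ≫ T = k.map x) :
    T ≫ adj T = 𝟙 _ := by
  refine h1.end_ext fun A B x y => ?_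
  rw [Category.id_comp, mu_inner, ← k.map_inner, ← hT, ← hT, BanachStarCategory.adj_comp]
  simp only [Category.assoc]

/-! ### Weakly dense submodules of representable modules -/

variable (P) in
/-- The inclusion of a submodule `H` of `Y_X` extends to a unitary isomorphism `L H → X`. -/
def IsWeaklyDenseEmb {H : HMod C} {X : C} (k : IsoEmbedding H.toHilbertModule X) : Prop :=
  ∃ T : P.L.obj H ⟶ X, IsUnitary T ∧ ∀ (A : C) (x : H.obj A), P.mu H x ≫ T = k.map x

/-- Under (C1), an isomorphism that extends the inclusion of `𝒜 X` is automatically unitary. -/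
lemma C1.weaklyDense_iff (h1 : P.C1) {X : C} (𝒜 : HereditarySubalgebra X)
    (k : IsoEmbedding 𝒜.toHMod.toHilbertModule X)
    (hk : ∀ (A : C) (x : 𝒜.toHMod.obj A), k.map x = 𝒜.incl x) :
    P.WeaklyDense 𝒜 ↔ P.IsWeaklyDenseEmb k := by
  constructor
  · rintro ⟨φ, hφ⟩
    have hT : ∀ (A : C) (x : 𝒜.toHMod.obj A), P.mu _ x ≫ φ.hom = k.map x :=
      fun A x => (hφ A x).trans (hk A x).symm
    have h := h1.comp_adj_eq_id k hT
    have hadj : adj φ.hom = φ.inv := by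
      rw [← Category.comp_id φ.inv, ← h, φ.inv_hom_id_assoc]
    exact ⟨φ.hom, ⟨h, by rw [hadj, φ.inv_hom_id]⟩, hT⟩
  · rintro ⟨T, hT, h⟩
    exact ⟨⟨T, adj T, hT.comp_adj, hT.adj_comp⟩, fun A x => (h A x).trans (hk A x)⟩

/-- Weak density depends only on the submodule of `Y_X`, up to unitary isomorphism. -/
lemma IsWeaklyDenseEmb.of_unitary {H K : HMod C} {X : C} {k : IsoEmbedding H.toHilbertModule X}
    {m : IsoEmbedding K.toHilbertModule X} {U : H ⟶ K} (hU : IsUnitary U)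
    (hm : ∀ (A : C) (x : H.obj A), m.map (HMod.ap U x) = k.map x) (hd : P.IsWeaklyDenseEmb m) :
    P.IsWeaklyDenseEmb k := by
  obtain ⟨T, hT, h⟩ := hd
  refine ⟨P.L.map U ≫ T, (hU.map P.L).comp hT, fun A x => ?_⟩
  rw [← Category.assoc, mu_map, h, hm]

/-- Every submodule of `Y_X` is of the form `𝒜 X` for its hereditary subalgebra `𝒜`. -/
lemma C1.weaklyDense_hereditarySubalgebra_iff (h1 : P.C1) {H : HMod C} {X : C}
    (k : IsoEmbedding H.toHilbertModule X) :
    P.WeaklyDense k.hereditarySubalgebra ↔ P.IsWeaklyDenseEmb k := by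
  rw [h1.weaklyDense_iff _ k.hereditarySubalgebra.inclEmb fun A x => rfl]
  obtain ⟨U, hU, h⟩ := k.exists_unitary
  refine ⟨fun hd => hd.of_unitary hU h, fun hd => hd.of_unitary hU.adj fun A y => ?_⟩
  rw [← h, ← HMod.comp_ap, hU.adj_comp, HMod.id_ap]
  rfl

/-- Under (C1) and (C3), a submodule that contains a weakly dense one is weakly dense. -/
lemma C3.isWeaklyDenseEmb (h3 : P.C3) (h1 : P.C1) {H K : HMod C} {X : C}
    {k : IsoEmbedding H.toHilbertModule X} {m : IsoEmbedding K.toHilbertModule X}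
    (hkm : ∀ (A : C) (x : H.obj A), k.map x ∈ LinearMap.range (m.map (A := A)))
    (hd : P.IsWeaklyDenseEmb k) : P.IsWeaklyDenseEmb m := by
  rw [← h1.weaklyDense_hereditarySubalgebra_iff] at hd ⊢
  have hle : LinearMap.range (k.map (A := X)) ≤ LinearMap.range (m.map (A := X)) := by
    rintro _ ⟨x, rfl⟩
    exact hkm X x
  exact h3 X k.hereditarySubalgebra m.hereditarySubalgebra (fun a ha => ⟨hle ha.1, hle ha.2⟩) hd

/-! ### Continuity of `L` -/

/-- For `x ∈ V(E)`, the value of `L` at the operator `E ≅ R Y_E → R V` that corresponds to `x`. -/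
noncomputable def extArrow (P : PreComplete C) (V : HMod (HMod C)) {E : HMod C} (x : V.obj E) :
    P.L.obj E ⟶ P.L.obj (restr V) :=
  P.L.map (restrUnit E ≫ restrMap (hat V x))

lemma extArrow_comp_adj (V : HMod (HMod C)) {E F : HMod C} (y : V.obj F) (x : V.obj E) :
    P.extArrow V x ≫ adj (P.extArrow V y) = P.L.map (V.inner y x) := by
  have e1 : restrMap (hat V x) ≫ adj (restrMap (hat V y)) =
      restrMap (yonedaMap (V.inner y x)) := by
    rw [← hat_comp_adj_hat]
    refine Eq.trans ?_ ((restrF C).map_comp _ _).symm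
    exact congrArg (restrMap (hat V x) ≫ ·) ((restrF C).map_adj (hat V y)).symm
  rw [extArrow, extArrow, ← P.L.map_adj, ← P.L.map_comp, BanachStarCategory.adj_comp,
    Category.assoc, ← Category.assoc (restrMap _), e1, ← Category.assoc, ← restrUnit_natural,
    Category.assoc, (restrUnit_isUnitary F).comp_adj, Category.comp_id]

lemma restrUnit_comp_restrMap_hat (V : HMod (HMod C)) {A : C} (x : V.obj (Y A)) :
    restrUnit (Y A) ≫ restrMap (hat V x) = hat (restr V) (restr.elem x) :=
  HMod.hom_ext fun B f => by
    rw [HMod.comp_ap, restrUnit_ap, restrMap_ap, hat_ap (restr V)]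
    exact congrArg restr.elem (hat_ap V x (Y.elem (hat (Y A) f)))

/-- The extension of scalars of `V` along `L`, realized as a submodule of `Y_{L (R V)}`. -/
lemma exists_extEmb (P : PreComplete C) (V : HMod (HMod C)) :
    ∃ m : IsoEmbedding (extObj P.L V).toHilbertModule (P.L.obj (restr V)),
      ∀ (E : HMod C) (x : V.obj E), m.map (extUnit P.L V E x) = P.extArrow V x := by
  have hgen : (extObj P.L V).Generates (I := Σ E : HMod C, V.obj E) (s := fun p => P.L.obj p.1)
      (fun p => extUnit P.L V p.1 p.2) := fun A => by
    refine (generates_extG P.L V A).mono (Submodule.span_mono ?_)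
    rintro _ ⟨i, f, rfl⟩
    exact ⟨⟨_, V.gen i⟩, f, by dsimp only; rw [extUnit_gen]⟩
  obtain ⟨m, hm⟩ := hgen.exists_isoEmbedding (fun p => P.extArrow V p.2) fun i j => by
    rw [extArrow_comp_adj, inner_extUnit]
  exact ⟨m, fun E x => hm ⟨E, x⟩⟩

/-- The unitary `L (R V) ≅ L W` is obtained from the weak density in `Y_{L (R V)}` of the extension
of scalars `W` of `V`, which contains a copy of `R V`. -/
theorem C1.c2_of_c3 (h1 : P.C1) (h3 : P.C3) : P.C2 := by
  choose m hm using P.exists_extEmb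
  -- The inclusion of `R V` in the extension of scalars, as submodules of `Y_{L (R V)}`.
  have hj : ∀ (V : HMod (HMod C)) {A : C} (x : V.obj (Y A)),
      (m V).map ((extObj P.L V).act (extUnit P.L V (Y A) x) (P.unit A)) =
        P.mu (restr V) (restr.elem x) := fun V A x => by
    rw [(m V).map_act, hm, extArrow, restrUnit_comp_restrMap_hat, mu]
  have hd : ∀ V : HMod (HMod C), P.IsWeaklyDenseEmb (m V) := fun V => by
    refine h3.isWeaklyDenseEmb h1 (k := P.muEmb (restr V)) (fun A x => ⟨_, hj V (restr.val x)⟩) ?_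
    refine ⟨𝟙 _, ⟨?_, ?_⟩, fun A x => Category.comp_id _⟩ <;> rw [adj_id, Category.comp_id]
  choose T hT hmT using hd
  have hθ : ∀ (V : HMod (HMod C)) {A : C} (w : (extObj P.L V).obj A),
      (m V).map w ≫ adj (T V) = P.mu (extObj P.L V) w := fun V A w => by
    rw [← hmT, Category.assoc, (hT V).comp_adj, Category.comp_id]
  have hμ : ∀ (V : HMod (HMod C)) {A : C} (x : V.obj (Y A)),
      P.mu (restr V) (restr.elem x) ≫ adj (T V) =
        P.mu (extObj P.L V) ((extObj P.L V).act (extUnit P.L V (Y A) x) (P.unit A)) :=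
    fun V A x => by rw [← hj, hθ]
  have hnat : ∀ {V W : HMod (HMod C)} (S : V ⟶ W),
      P.L.map (restrMap S) ≫ adj (T W) = adj (T V) ≫ P.L.map (extMap P.L S) := fun {V W} S => by
    refine h1.hom_ext fun A x => ?_
    rw [← Category.assoc, ← Category.assoc, mu_map, restrMap_ap, hμ]
    refine Eq.trans ?_ (congrArg (· ≫ P.L.map (extMap P.L S)) (hμ V (restr.val x)).symm)
    rw [mu_map, HMod.ap_act, extMap_extUnit]
  refine ⟨fun V => adj (T V), fun V => (hT V).adj, fun V W S => hnat S, fun E => ?_⟩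
  have hid : hat (Y E) (Y.elem (𝟙 E)) = 𝟙 (Y E) := (yonedaF (HMod C)).map_id E
  have hunit : P.extArrow (Y E) (Y.elem (𝟙 E)) = P.L.map (restrUnit E) := by
    rw [extArrow, hid]
    refine congrArg P.L.map (Eq.trans ?_ (Category.comp_id _))
    exact congrArg (restrUnit E ≫ ·) ((restrF C).map_id (Y E))
  change P.L.map (restrUnit E) ≫ adj (T (Y E)) = P.mu (extObj P.L (Y E)) _
  rw [← hunit, ← hm, hθ]

/-! ### Extension of pre-adjoint pairs -/

/-- For `𝒜 ⊆ ℬ` with `𝒜` weakly dense, (C4) gives a morphism `L (𝒜 X) → L (ℬ X)`; its adjoint followed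
by `L (𝒜 X) ≅ X` is the required isomorphism. -/
theorem C1.c3_of_c4 (h1 : P.C1) (h4 : P.C4) : P.C3 := by
  intro X 𝒜 ℬ hle h𝒜
  rw [h1.weaklyDense_iff 𝒜 𝒜.inclEmb fun A x => rfl] at h𝒜
  rw [h1.weaklyDense_iff ℬ ℬ.inclEmb fun A x => rfl]
  obtain ⟨T, hT, hμT⟩ := h𝒜
  have hsub : ∀ A : C, 𝒜.submodule A ≤ ℬ.submodule A := fun A =>
    Submodule.topologicalClosure_mono (Submodule.span_mono
      fun x ⟨a, ha, h, hx⟩ => ⟨a, hle ha, h, hx⟩)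
  obtain ⟨j, hj⟩ : ∃ j : ∀ A : C, 𝒜.toHMod.obj A →ₗ[ℂ] ℬ.toHMod.obj A,
      ∀ A x, ℬ.inclEmb.map (j A x) = 𝒜.inclEmb.map x :=
    ⟨fun A => Submodule.inclusion (hsub A), fun A x => rfl⟩
  have hj_act : ∀ {A B : C} (x : 𝒜.toHMod.obj A) (f : B ⟶ A),
      j B (𝒜.toHMod.act x f) = ℬ.toHMod.act (j A x) f := fun x f =>
    ℬ.inclEmb.map_injective (by
      rw [hj, ℬ.inclEmb.map_act, 𝒜.inclEmb.map_act, hj])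
  have hj_norm : ∀ {A : C} (x : 𝒜.toHMod.obj A), ‖j A x‖ = ‖x‖ := fun x => by
    rw [← ℬ.inclEmb.norm_map, hj, 𝒜.inclEmb.norm_map]
  -- The inclusion of `𝒜 X` in `ℬ X`, and that of `ℬ X` in `Y_X ≅ Y_{L (𝒜 X)}`.
  obtain ⟨S, hS⟩ := h4 𝒜.toHMod ℬ.toHMod
    { f := fun A => (P.muEmb ℬ.toHMod).map ∘ₗ j A
      g := fun A => compR (adj T) ∘ₗ ℬ.inclEmb.map
      f_bounded :=
        ⟨fun x f => (congrArg (P.mu ℬ.toHMod) (hj_act x f)).trans (P.mu_act _ _ _), 1, fun A x =>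
          ((P.muEmb ℬ.toHMod).norm_map (j A x)).le.trans (by rw [one_mul, hj_norm])⟩
      g_bounded :=
        ⟨fun x f => Category.assoc f (ℬ.inclEmb.map x) (adj T), ‖adj T‖, fun A x =>
          (norm_comp_le (ℬ.inclEmb.map x) (adj T)).trans
            (by rw [ℬ.inclEmb.norm_map, mul_comm])⟩
      inner_eq := fun A B a b => by
        change P.mu ℬ.toHMod b ≫ adj (P.mu ℬ.toHMod (j A a)) =
          (ℬ.inclEmb.map b ≫ adj T) ≫ adj (P.mu 𝒜.toHMod a)
        rw [mu_inner, ← ℬ.inclEmb.map_inner, hj, ← hμT, BanachStarCategory.adj_comp,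
          Category.assoc] }
  have hS' : ∀ (A : C) (a : 𝒜.toHMod.obj A), P.mu 𝒜.toHMod a ≫ unY S = P.mu ℬ.toHMod (j A a) :=
    fun A a => by
      refine Eq.trans ?_ (hS A a)
      conv_rhs => rw [← yonedaMap_unY S]
      exact (yonedaMap_ap (unY S) (Y.elem (P.mu 𝒜.toHMod a))).symm
  have hunit : unY S ≫ adj (unY S) = 𝟙 _ := h1.end_ext fun A B x y => by
    have e : P.mu 𝒜.toHMod x ≫ (unY S ≫ adj (unY S)) ≫ adj (P.mu 𝒜.toHMod y) =
        (P.mu 𝒜.toHMod x ≫ unY S) ≫ adj (P.mu 𝒜.toHMod y ≫ unY S) := by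
      rw [BanachStarCategory.adj_comp]
      simp only [Category.assoc]
    rw [e, hS', hS', mu_inner, Category.id_comp, mu_inner, ← ℬ.inclEmb.map_inner, hj, hj,
      𝒜.inclEmb.map_inner]
  -- Both sides have the same scalar products with the elements of the weakly dense `𝒜 X`.
  have hb : ∀ (B : C) (b : ℬ.toHMod.obj B),
      P.mu ℬ.toHMod b ≫ adj (unY S) = ℬ.inclEmb.map b ≫ adj T := fun B b => by
    rw [← adj_adj (P.mu ℬ.toHMod b ≫ adj (unY S)), ← adj_adj (ℬ.inclEmb.map b ≫ adj T)]
    refine congrArg adj (h1.hom_ext fun A a => ?_)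
    rw [← adj_adj (P.mu 𝒜.toHMod a), ← BanachStarCategory.adj_comp,
      ← BanachStarCategory.adj_comp, Category.assoc, Category.assoc,
      ← BanachStarCategory.adj_comp, ← BanachStarCategory.adj_comp, hS', hμT, mu_inner, ← hj,
      ℬ.inclEmb.map_inner]
  have hR : ∀ (B : C) (b : ℬ.toHMod.obj B),
      P.mu ℬ.toHMod b ≫ adj (unY S) ≫ T = ℬ.inclEmb.map b := fun B b => by
    rw [← Category.assoc, hb, Category.assoc, hT.adj_comp, Category.comp_id]
  refine ⟨adj (unY S) ≫ T, ⟨h1.comp_adj_eq_id ℬ.inclEmb hR, ?_⟩, hR⟩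
  rw [BanachStarCategory.adj_comp, adj_adj, Category.assoc, ← Category.assoc (unY S), hunit,
    Category.id_comp, hT.adj_comp]

end PreComplete

end CStarCat

theorem mainTheorem7 {C : Type u} [CStarCat.CStarCategory.{v} C] (P : CStarCat.PreComplete C) :
    (P.C1 → P.C3 → P.C2) ∧ (P.C1 → P.C4 → P.C3 ∧ P.C2) :=
  ⟨fun h1 h3 => h1.c2_of_c3 h3, fun h1 h4 => ⟨h1.c3_of_c4 h4, h1.c2_of_c3 (h1.c3_of_c4 h4)⟩⟩
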